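/- Let $n\ge 1$ and let $\rho:\mathbb R^n\to(0,\infty)$ be a critical radius function, i.e. $\rho$ is measurable (for instance continuous) and there are $C_0,k_0\ge 1$ such that, for all $x,y\in\mathbb R^n$, $$C_0^{-1}\rho(x)\Bigl(1+\tfrac{|x-y|}{\rho(x)}\Bigr)^{-k_0}\le\rho(y)\le C_0\,\rho(x)\Bigl(1+\tfrac{|x-y|}{\rho(x)}\Bigr)^{\frac{k_0}{k_0+1}} .$$ A weight is a locally integrable function that is positive a.e. For $\theta\ge0$ and a ball $B=B(x_0,r)$ put $\Psi_\theta(B)=(1+r/\rho(x_0))^\theta$. For $1<p<\infty$ let $A_p^{\rho,\theta}$ be the class of weights $\omega$ with $$\sup_B\Bigl(\frac1{\Psi_\theta(B)|B|}\int_B\omega\Bigr)\Bigl(\frac1{\Psi_\theta(B)|B|}\int_B\omega^{-\frac1{p-1}}\Bigr)^{p-1}<\infty ,$$ and let $A_1^{\rho,\theta}$ be the class of weights $\omega$ for which there is a constant $C$ with $\sup_{B\ni x}\frac1{\Psi_\theta(B)|B|}\int_B\omega\le C\,\omega(x)$ for a.e. $x$. Put $A_p^{\rho,\infty}=\bigcup_{\theta\ge0}A_p^{\rho,\theta}$,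 $A_\infty^{\rho,\infty}=\bigcup_{1\le p<\infty}A_p^{\rho,\infty}$ and $q_\omega=\inf\{p\in[1,\infty):\omega\in A_p^{\rho,\infty}\}$. For measurable $g\ge 0$ let $\|g\|_{L^p_\omega}=(\int g^p\omega\,dx)^{1/p}$, and let $L^p_\omega$ be the set of those $g$ for which this is finite. For $\varphi\in\mathcal D(\mathbb R^n)=C_c^\infty(\mathbb R^n)$ and $l\in\mathbb Z$ let $\varphi_l(x)=2^{ln}\varphi(2^lx)$. For $N\in\mathbb Z_{\ge0}$ and $R>0$ let $\mathcal D_{N,R}$ be the set of all $\varphi\in\mathcal D(\mathbb R^n)$ with $\operatorname{supp}\varphi\subset B(0,R)$ and $|\partial^\alpha\varphi|\le1$ for all $|\alpha|\le N$. For $f\in\mathcal D'(\mathbb R^n)$, $x\in\mathbb R^n$ and $\psi_0\in\mathcal D(\mathbb R^n)$ let, with $l$ ranging over $\mathbb Z$, $$\mathcal M_{N,R}f(x)=\sup\{|\varphi_l*f(x)|:2^{-l}<\rho(x),\ \varphi\in\mathcal D_{N,R}\},$$ $$\widetilde{\mathcal M}_{N,R}f(x)=\sup\{|\varphi_l*f(z)|:|x-z|<2^{-l}<\rho(x),\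 \varphi\in\mathcal D_{N,R}\},$$ $$\psi_0^+(f)(x)=\sup_{2^{-l}<\rho(x)}|(\psi_0)_l*f(x)|,\qquad (\psi_0)^*_\nabla(f)(x)=\sup_{|x-y|<2^{-l}<\rho(x)}|(\psi_0)_l*f(y)| .$$ Fix $R>1$ and write $\mathcal M_N=\mathcal M_{N,R}$, $\widetilde{\mathcal M}_N=\widetilde{\mathcal M}_{N,R}$, $\mathcal M^0_N=\mathcal M_{N,1}$, $\widetilde{\mathcal M}^0_N=\widetilde{\mathcal M}_{N,1}$. Let $h^p_{\rho,N}(\omega)=\{f\in\mathcal D'(\mathbb R^n):\mathcal M_Nf\in L^p_\omega\}$ with $\|f\|_{h^p_{\rho,N}(\omega)}=\|\mathcal M_Nf\|_{L^p_\omega}$. **Theorem 3.2.** Let $\omega\in A_\infty^{\rho,\infty}$, $p\in(0,1]$, $\psi_0\in\mathcal D(\mathbb R^n)$ with $\int\psi_0\ne0$, and let $N$ be an integer with $$N\ge N_{p,\omega}:=\max\Bigl\{\bigl\lfloor n(\tfrac{q_\omega}{p}-1)\bigr\rfloor+2,\ \bigl\lfloor \tfrac{2nq_\omega}{p}\bigr\rfloor+1\Bigr\}.$$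 Then for every $f\in\mathcal D'(\mathbb R^n)$ the following are equivalent: 1. $f\in h^p_{\rho,N}(\omega)$; 2. $\psi_0^+(f)\in L^p_\omega$; 3. $(\psi_0)^*_\nabla(f)\in L^p_\omega$; 4. $\widetilde{\mathcal M}_Nf\in L^p_\omega$; 5. $\widetilde{\mathcal M}^0_Nf\in L^p_\omega$; 6. $\mathcal M^0_Nf\in L^p_\omega$. Moreover, for all $f\in h^p_{\rho,N}(\omega)$, $$\|f\|_{h^p_{\rho,N}(\omega)}\sim\|\psi_0^+(f)\|_{L^p_\omega}\sim\|(\psi_0)^*_\nabla(f)\|_{L^p_\omega}\sim\|\widetilde{\mathcal M}_Nf\|_{L^p_\omega}\sim\|\widetilde{\mathcal M}^0_Nf\|_{L^p_\omega}\sim\|\mathcal M^0_Nf\|_{L^p_\omega},$$ where the implicit constants do not depend on $f$. -/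

import Mathlib

open MeasureTheory Set
open scoped ENNReal NNReal Distributions

noncomputable section

namespace LocalHardy

/-- The Euclidean space `ℝⁿ` with its Euclidean norm and Lebesgue measure. -/
abbrev Eucl (n : ℕ) : Type := EuclideanSpace ℝ (Fin n)

/-- The space `𝓓(ℝⁿ)` of complex-valued smooth compactly supported functions. -/
abbrev TestFun (n : ℕ) : Type := 𝓓((⊤ : TopologicalSpace.Opens (Eucl n)), ℂ)

/-- The space `𝓓'(ℝⁿ)` of distributions: the continuous complex-linear functionals on `𝓓(ℝⁿ)`,
which carries its canonical LF topology. -/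
abbrev Distr (n : ℕ) : Type := TestFun n →L[ℂ] ℂ

variable {n : ℕ}

/-! ### Critical radius functions and weights -/

/-- A critical radius function: a positive (measurable) function `ρ` on `ℝⁿ` such that, for some
`C₀, k₀ ≥ 1` and all `x, y`,
`C₀⁻¹ ρ(x) (1 + |x - y| / ρ(x)) ^ (-k₀) ≤ ρ(y) ≤ C₀ ρ(x) (1 + |x - y| / ρ(x)) ^ (k₀ / (k₀ + 1))`. -/
def IsCriticalRadius (ρ : Eucl n → ℝ) : Prop :=
  Measurable ρ ∧ (∀ x, 0 < ρ x) ∧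
    ∃ C₀ k₀ : ℝ, 1 ≤ C₀ ∧ 1 ≤ k₀ ∧ ∀ x y : Eucl n,
      C₀⁻¹ * ρ x * (1 + ‖x - y‖ / ρ x) ^ (-k₀) ≤ ρ y ∧
      ρ y ≤ C₀ * ρ x * (1 + ‖x - y‖ / ρ x) ^ (k₀ / (k₀ + 1))

/-- `Ψ_θ(B) |B|` for the ball `B = B(x₀, r)`, where `Ψ_θ(B) = (1 + r / ρ(x₀)) ^ θ`. -/
def psiVol (ρ : Eucl n → ℝ) (θ : ℝ) (x₀ : Eucl n) (r : ℝ) : ℝ≥0∞ :=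
  ENNReal.ofReal ((1 + r / ρ x₀) ^ θ) * volume (Metric.ball x₀ r)

/-- A weight: a locally integrable function which is positive (almost everywhere). -/
def IsWeight (ω : Eucl n → ℝ) : Prop :=
  LocallyIntegrable ω ∧ ∀ᵐ x, 0 < ω x

/-- The maximal function `M_{V,θ} f(x) = sup_{B ∋ x} (Ψ_θ(B) |B|)⁻¹ ∫_B |f|`, the supremum being
over all balls `B` that contain `x`. -/
def maxFun (ρ : Eucl n → ℝ) (θ : ℝ) (f : Eucl n → ℝ) (x : Eucl n) : ℝ≥0∞ :=
  ⨆ (x₀ : Eucl n) (r : ℝ) (_ : 0 < r) (_ : x ∈ Metric.ball x₀ r),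
    (∫⁻ y in Metric.ball x₀ r, ‖f y‖ₑ) / psiVol ρ θ x₀ r

/-- The class `A_1^{ρ,θ}(ℝⁿ)`. -/
def MemA1 (ρ : Eucl n → ℝ) (θ : ℝ) (ω : Eucl n → ℝ) : Prop :=
  IsWeight ω ∧ ∃ C : ℝ≥0, ∀ᵐ x, maxFun ρ θ ω x ≤ C * ENNReal.ofReal (ω x)

/-- The condition that defines the class `A_p^{ρ,θ}(ℝⁿ)` for `1 < p < ∞`. -/
def MemApGt (ρ : Eucl n → ℝ) (p θ : ℝ) (ω : Eucl n → ℝ) : Prop :=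
  IsWeight ω ∧ ∃ C : ℝ≥0, ∀ (x₀ : Eucl n) (r : ℝ), 0 < r →
    (∫⁻ y in Metric.ball x₀ r, ENNReal.ofReal (ω y)) / psiVol ρ θ x₀ r *
      ((∫⁻ y in Metric.ball x₀ r, ENNReal.ofReal (ω y ^ (-(1 / (p - 1))))) /
        psiVol ρ θ x₀ r) ^ (p - 1) ≤ C

/-- The class `A_p^{ρ,∞}(ℝⁿ) = ⋃_{θ ≥ 0} A_p^{ρ,θ}(ℝⁿ)` for `1 ≤ p < ∞`. -/
def MemAp (ρ : Eucl n → ℝ) (p : ℝ) (ω : Eucl n → ℝ) : Prop :=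
  ∃ θ : ℝ, 0 ≤ θ ∧ ((p = 1 ∧ MemA1 ρ θ ω) ∨ (1 < p ∧ MemApGt ρ p θ ω))

/-- The class `A_∞^{ρ,∞}(ℝⁿ) = ⋃_{p ≥ 1} A_p^{ρ,∞}(ℝⁿ)`. -/
def MemAInfty (ρ : Eucl n → ℝ) (ω : Eucl n → ℝ) : Prop :=
  ∃ p : ℝ, 1 ≤ p ∧ MemAp ρ p ω

/-- The critical index `q_ω = inf {p ∈ [1, ∞) : ω ∈ A_p^{ρ,∞}(ℝⁿ)}`. -/
def critIndex (ρ : Eucl n → ℝ) (ω : Eucl n → ℝ) : ℝ :=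
  sInf {p : ℝ | 1 ≤ p ∧ MemAp ρ p ω}

/-- The order `N_{p,ω} = max {[n (q_ω / p - 1)] + 2, [2 n q_ω / p] + 1}`. -/
def orderIndex (ρ : Eucl n → ℝ) (ω : Eucl n → ℝ) (p : ℝ) : ℤ :=
  max (⌊(n : ℝ) * (critIndex ρ ω / p - 1)⌋ + 2) (⌊2 * ((n : ℝ) * critIndex ρ ω / p)⌋ + 1)

/-- The `L^p_ω(ℝⁿ)` (quasi-)norm `(∫ g^p ω)^(1/p)` of a `[0, ∞]`-valued function. -/
def wnorm (ω : Eucl n → ℝ) (p : ℝ) (g : Eucl n → ℝ≥0∞) : ℝ≥0∞ :=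
  (∫⁻ x, g x ^ p * ENNReal.ofReal (ω x)) ^ (1 / p)

/-- Membership in `L^p_ω(ℝⁿ)`: measurability and finiteness of the (quasi-)norm. -/
def MemLpw (ω : Eucl n → ℝ) (p : ℝ) (g : Eucl n → ℝ≥0∞) : Prop :=
  AEMeasurable g ∧ wnorm ω p g < ∞

/-! ### Convolution with dilated test functions -/

/-- The test function `y ↦ φ_l(x - y)`, where `φ_l(z) = 2^{ln} φ(2^l z)`. -/
def dilTrans (φ : TestFun n) (l : ℤ) (x : Eucl n) : TestFun n where
  toFun y := ((2 : ℝ) ^ (l * (n : ℤ))) • φ (((2 : ℝ) ^ l) • (x - y))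
  contDiff' := by
    have h : ContDiff ℝ ((⊤ : ℕ∞) : WithTop ℕ∞) (fun y : Eucl n => ((2 : ℝ) ^ l) • (x - y)) := by
      fun_prop
    exact (φ.contDiff.comp h).const_smul _
  hasCompactSupport' := by
    have hc : ((2 : ℝ) ^ l) ≠ 0 := by positivity
    have h : HasCompactSupport (fun y : Eucl n => φ (((2 : ℝ) ^ l) • (x - y))) :=
      φ.hasCompactSupport.comp_homeomorph
        ((Homeomorph.subLeft x).trans (Homeomorph.smulOfNeZero _ hc))
    exact h.smul_left (f := fun _ : Eucl n => ((2 : ℝ) ^ (l * (n : ℤ))))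
  tsupport_subset' := by simp

/-- The convolution `(φ_l * f)(x) = ⟨f, φ_l(x - ·)⟩` of a distribution with a dilated
test function. -/
def conv (φ : TestFun n) (l : ℤ) (f : Distr n) (x : Eucl n) : ℂ :=
  f (dilTrans φ l x)

/-- The class `𝓓_{N,R}(ℝⁿ)`: the test functions supported in `B(0, R)` all of whose partial
derivatives of order at most `N` are bounded by `1` in absolute value. (The partial derivatives
`∂^α φ(x)` with `|α| = k` are the values of the `k`-th derivative on `k`-tuples of vectors of the
standard basis.) -/
def testClass (n N : ℕ) (R : ℝ) : Set (TestFun n) :=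
  {φ | tsupport φ ⊆ Metric.ball 0 R ∧
    ∀ k : ℕ, k ≤ N → ∀ (s : Fin k → Fin n) (x : Eucl n),
      ‖iteratedFDeriv ℝ k φ x (fun i => EuclideanSpace.single (s i) (1 : ℝ))‖ ≤ 1}

/-! ### Local maximal functions

The scales are the dyadic numbers `2^{-l}`, `l ∈ ℤ`, with `2^{-l} < ρ(x)`. These are the integers
`l ≥ j_x`, where `j_x` is the integer with `2^{-j_x} < ρ(x) ≤ 2^{-j_x + 1}`. -/

/-- The local vertical grand maximal function `𝓜_{N,R}(f)`. -/
def grandVert (ρ : Eucl n → ℝ) (N : ℕ) (R : ℝ) (f : Distr n) (x : Eucl n) : ℝ≥0∞ :=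
  ⨆ (l : ℤ) (_ : (2 : ℝ) ^ (-l) < ρ x) (φ : TestFun n) (_ : φ ∈ testClass n N R),
    ‖conv φ l f x‖ₑ

/-- The local nontangential grand maximal function `𝓜̃_{N,R}(f)`. -/
def grandNontan (ρ : Eucl n → ℝ) (N : ℕ) (R : ℝ) (f : Distr n) (x : Eucl n) : ℝ≥0∞ :=
  ⨆ (l : ℤ) (_ : (2 : ℝ) ^ (-l) < ρ x) (z : Eucl n) (_ : ‖x - z‖ < (2 : ℝ) ^ (-l))
    (φ : TestFun n) (_ : φ ∈ testClass n N R), ‖conv φ l f z‖ₑ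

/-- The local vertical maximal function `ψ₀⁺(f)`. -/
def vertMax (ρ : Eucl n → ℝ) (ψ₀ : TestFun n) (f : Distr n) (x : Eucl n) : ℝ≥0∞ :=
  ⨆ (l : ℤ) (_ : (2 : ℝ) ^ (-l) < ρ x), ‖conv ψ₀ l f x‖ₑ

/-- The local nontangential maximal function `(ψ₀)^*_∇(f)`. -/
def nontanMax (ρ : Eucl n → ℝ) (ψ₀ : TestFun n) (f : Distr n) (x : Eucl n) : ℝ≥0∞ :=
  ⨆ (l : ℤ) (_ : (2 : ℝ) ^ (-l) < ρ x) (y : Eucl n) (_ : ‖x - y‖ < (2 : ℝ) ^ (-l)),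
    ‖conv ψ₀ l f y‖ₑ

/-- The weighted local Hardy space `h^p_{ρ,N}(ω)`, defined through the local vertical grand maximal
function `𝓜_N = 𝓜_{N,R}`, for a fixed radius `R > 1`. -/
def hardySpace (ρ ω : Eucl n → ℝ) (p : ℝ) (N : ℕ) (R : ℝ) : Set (Distr n) :=
  {f | MemLpw ω p (grandVert ρ N R f)}

/-- The (quasi-)norm of `h^p_{ρ,N}(ω)`. -/
def hardyNorm (ρ ω : Eucl n → ℝ) (p : ℝ) (N : ℕ) (R : ℝ) (f : Distr n) : ℝ≥0∞ :=
  wnorm ω p (grandVert ρ N R f)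

/-- `1/C ≤ a/b ≤ C`, written without division. -/
def Comparable (C : ℝ≥0) (a b : ℝ≥0∞) : Prop := a ≤ C * b ∧ b ≤ C * a

end LocalHardy

end

noncomputable section

namespace LocalHardy

variable {n : ℕ}

/-! ### Partial derivatives of test functions -/

/-! Up to constants, every maximal function in the theorem is trivially dominated by a nontangential
grand maximal function of large radius. What remains is the reverse bound: `grandNontan` of any
radius is controlled in `L^p_ω` by `vertMax` of a single test function `ψ` with nonzero integral
(`exists_wnorm_grandNontan_le`). Applied to `ψ₀`, and to an auxiliary bump supported in the unit
ball, it closes the circle of inequalities.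

Normalise `∫ ψ = 1` and let `A_k` be convolution with the reflected dilate of `ψ` at scale `2^{-k}`.
The `A_k` commute, `f (A_k h)` is the integral of `h` against `ψ_k * f`, and each factor `1 - A_k`
trades one derivative for a factor `2^{-k}`. Telescoping `(1 - A_k)^(L+1)` over successive scales
expresses `φ_l * f` through the functions `ψ_k * f` with `k` beyond `l`, with weights `2^{-iL}`
(`exists_reproducing_estimate`).

Taking `φ = ψ` makes the estimate self-referential. Splitting `F = F^(1-r) F^r` and absorbing the
first factor in a weighted supremum gives a sub-mean value inequality for `|ψ_j * f|^r` with `r ≤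
1`. Absorption needs that supremum to be finite. The local finite order of `f` gives this first with
an exponent depending on `f`; the resulting bound is the input of a second pass with the universal
exponent `n / r` (`exists_rpow_le_lintegral_tailMax`).

Inserting this into the reproducing estimate with `L = N > n / r` gives the pointwise bound
`grandNontan ≤ C (locMax (vertMax^r))^(1/r)` (`exists_grandNontan_le_locMax`). Only balls of radius
at most `K ρ(x)` occur in `locMax`. There `Ψ_θ` is bounded, so the weight behaves like a classical
`A_q` weight, and Vitali covering with Marcinkiewicz interpolation bounds `locMax` on `L^{p/r}_ω`
when `q < p / r` (`MemAp.exists_strong_type`). The lower bound on `N` leaves room for such `r` and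
`q` (`exists_exponents`). -/

/-- The `e`-th partial derivative as an operator on test functions. -/
def partialDeriv (e : Fin n) : TestFun n →ₗ[ℂ] TestFun n where
  toFun φ :=
    { toFun := fun x => fderiv ℝ φ x (EuclideanSpace.single e 1)
      contDiff' := (φ.contDiff.fderiv_right (m := ((⊤ : ℕ∞) : WithTop ℕ∞)) le_rfl).clm_apply
        contDiff_const
      hasCompactSupport' := φ.hasCompactSupport.fderiv_apply ℝ _
      tsupport_subset' := by simp }
  map_add' φ χ := by
    ext x
    have h1 : DifferentiableAt ℝ φ x := (φ.contDiff.differentiable (by simp)).differentiableAt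
    have h2 : DifferentiableAt ℝ χ x := (χ.contDiff.differentiable (by simp)).differentiableAt
    simpa using congrArg (fun T => T (EuclideanSpace.single e (1 : ℝ))) (fderiv_add h1 h2)
  map_smul' c φ := by
    ext x
    have h1 : DifferentiableAt ℝ φ x := (φ.contDiff.differentiable (by simp)).differentiableAt
    simpa using congrArg (fun T => T (EuclideanSpace.single e (1 : ℝ))) (fderiv_const_smul h1 c)

theorem partialDeriv_apply (e : Fin n) (φ : TestFun n) (x : Eucl n) :
    partialDeriv e φ x = fderiv ℝ φ x (EuclideanSpace.single e 1) := rfl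

/-- The iterated partial derivative along a list of coordinate directions. -/
def partialDerivs : List (Fin n) → TestFun n →ₗ[ℂ] TestFun n
  | [] => LinearMap.id
  | e :: s => partialDeriv e ∘ₗ partialDerivs s

@[simp] theorem partialDerivs_nil (φ : TestFun n) : partialDerivs [] φ = φ := rfl

@[simp] theorem partialDerivs_cons (e : Fin n) (s : List (Fin n)) (φ : TestFun n) :
    partialDerivs (e :: s) φ = partialDeriv e (partialDerivs s φ) := rfl

theorem differentiableAt_testFun (φ : TestFun n) (x : Eucl n) : DifferentiableAt ℝ φ x :=
  (φ.contDiff.differentiable (by simp)).differentiableAt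

theorem partialDerivs_ofFn (φ : TestFun n) (k : ℕ) (s : Fin k → Fin n) (x : Eucl n) :
    partialDerivs (List.ofFn s) φ x =
      iteratedFDeriv ℝ k φ x (fun i => EuclideanSpace.single (s i) (1 : ℝ)) := by
  induction k generalizing x with
  | zero => simp
  | succ k ih =>
    rw [List.ofFn_succ, partialDerivs_cons, partialDeriv_apply, iteratedFDeriv_succ_apply_left]
    have h1 : ⇑(partialDerivs (List.ofFn fun i : Fin k => s i.succ) φ) =
        fun y => iteratedFDeriv ℝ k φ y (fun i => EuclideanSpace.single (s i.succ) (1 : ℝ)) :=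
      funext fun y => ih _ y
    rw [h1]
    have h2 : DifferentiableAt ℝ (iteratedFDeriv ℝ k φ) x :=
      (φ.contDiff.differentiable_iteratedFDeriv (m := k)
        (by exact_mod_cast ENat.natCast_lt_top k)).differentiableAt
    rw [fderiv_continuousMultilinear_apply_const_apply h2]
    rfl

/-- All partial derivatives of order `i` are bounded by `B`. -/
def DerivBound (i : ℕ) (B : ℝ) (φ : TestFun n) : Prop :=
  ∀ s : List (Fin n), s.length = i → ∀ x, ‖partialDerivs s φ x‖ ≤ B

theorem derivBound_zero_iff {B : ℝ} {φ : TestFun n} : DerivBound 0 B φ ↔ ∀ x, ‖φ x‖ ≤ B := by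
  constructor
  · intro h x
    exact h [] rfl x
  · intro h s hs x
    rw [List.length_eq_zero_iff] at hs
    subst hs
    exact h x

theorem DerivBound.mono {i : ℕ} {B B' : ℝ} {φ : TestFun n} (h : DerivBound i B φ) (hB : B ≤ B') :
    DerivBound i B' φ := fun s hs x => (h s hs x).trans hB

theorem DerivBound.add {i : ℕ} {B B' : ℝ} {φ χ : TestFun n} (h : DerivBound i B φ)
    (h' : DerivBound i B' χ) : DerivBound i (B + B') (φ + χ) := by
  intro s hs x
  rw [map_add]
  exact (norm_add_le _ _).trans (add_le_add (h s hs x) (h' s hs x))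

theorem DerivBound.smul {i : ℕ} {B : ℝ} {φ : TestFun n} (h : DerivBound i B φ) (c : ℂ) :
    DerivBound i (‖c‖ * B) (c • φ) := by
  intro s hs x
  rw [map_smul]
  exact (norm_smul_le c _).trans (mul_le_mul_of_nonneg_left (h s hs x) (norm_nonneg _))

theorem exists_derivBound (φ : TestFun n) (N : ℕ) :
    ∃ B : ℝ, 0 < B ∧ ∀ i ≤ N, DerivBound i B φ := by
  have hfin : {s : List (Fin n) | s.length ≤ N}.Finite := List.finite_length_le _ N
  have h (s : List (Fin n)) : ∃ C : ℝ, ∀ x, ‖partialDerivs s φ x‖ ≤ C :=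
    (partialDerivs s φ).continuous.bounded_above_of_compact_support
      (partialDerivs s φ).hasCompactSupport
  choose C hC using h
  refine ⟨∑ s ∈ hfin.toFinset, |C s| + 1, by positivity, fun i hi s hs x => ?_⟩
  have h1 : |C s| ≤ ∑ s ∈ hfin.toFinset, |C s| :=
    Finset.single_le_sum (f := fun s => |C s|) (fun _ _ => abs_nonneg _)
      (by simp [hs, hi])
  linarith [hC s x, le_abs_self (C s)]

theorem mem_testClass_iff {N : ℕ} {R : ℝ} {φ : TestFun n} :
    φ ∈ testClass n N R ↔ tsupport φ ⊆ Metric.ball 0 R ∧ ∀ k ≤ N, DerivBound k 1 φ := by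
  refine and_congr_right fun _ => forall₂_congr fun k _ => ?_
  constructor
  · rintro h s rfl x
    have := h s.get x
    rwa [← partialDerivs_ofFn, List.ofFn_get] at this
  · intro h s x
    rw [← partialDerivs_ofFn]
    exact h _ (by simp) x

/-- The full `i`-th derivative is controlled by the partial derivatives of order `i`. -/
theorem DerivBound.norm_iteratedFDeriv_le {i : ℕ} {B : ℝ} {φ : TestFun n} (h : DerivBound i B φ)
    (x : Eucl n) : ‖iteratedFDeriv ℝ i φ x‖ ≤ (n : ℝ) ^ i * B := by
  -- `B` may be negative when `n = 0 < i`, since there are then no lists to test; the power of `n`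
  -- vanishes in that case.
  have hB' : 0 ≤ (n : ℝ) ^ i * B := by
    rcases Nat.eq_zero_or_pos n with hn | hn
    · rcases Nat.eq_zero_or_pos i with hi | hi
      · subst hi
        simpa using (norm_nonneg _).trans (derivBound_zero_iff.1 h 0)
      · simp [hn, hi.ne']
    · have : 0 ≤ B := (norm_nonneg _).trans (h (List.replicate i ⟨0, hn⟩) (by simp) 0)
      positivity
  refine ContinuousMultilinearMap.opNorm_le_bound hB' fun v => ?_
  have hv (j : Fin i) : v j = ∑ e : Fin n, (v j e) • EuclideanSpace.single e (1 : ℝ) := by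
    ext a
    simp [Finset.sum_apply, Pi.single_apply]
  have h1 : iteratedFDeriv ℝ i φ x v = ∑ s : Fin i → Fin n, (∏ j, v j (s j)) •
      iteratedFDeriv ℝ i φ x (fun j => EuclideanSpace.single (s j) (1 : ℝ)) := by
    conv_lhs => rw [show v = fun j => ∑ e : Fin n, (v j e) • EuclideanSpace.single e (1 : ℝ) from
      funext hv]
    rw [ContinuousMultilinearMap.map_sum]
    exact Finset.sum_congr rfl fun s _ =>
      ContinuousMultilinearMap.map_smul_univ _ (fun j => v j (s j)) _
  rw [h1]
  refine (norm_sum_le _ _).trans ?_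
  have h2 (s : Fin i → Fin n) : ‖(∏ j, v j (s j)) •
      iteratedFDeriv ℝ i φ x (fun j => EuclideanSpace.single (s j) (1 : ℝ))‖ ≤
      (∏ j, ‖v j‖) * B := by
    rw [norm_smul, norm_prod]
    refine mul_le_mul ?_ ?_ (norm_nonneg _) (Finset.prod_nonneg fun _ _ => norm_nonneg _)
    · exact Finset.prod_le_prod (fun _ _ => norm_nonneg _) fun j _ => PiLp.norm_apply_le _ _
    · rw [← partialDerivs_ofFn]
      exact h _ (by simp) x
  refine (Finset.sum_le_sum fun s _ => h2 s).trans ?_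
  simp only [Finset.sum_const, Finset.card_univ, Fintype.card_fun, Fintype.card_fin, nsmul_eq_mul]
  push_cast
  exact (le_of_eq (by ring))

theorem norm_fderiv_le {B : ℝ} {φ : TestFun n} (h : DerivBound 1 B φ) (x : Eucl n) :
    ‖fderiv ℝ φ x‖ ≤ n * B := by
  have := h.norm_iteratedFDeriv_le x
  rwa [pow_one, norm_iteratedFDeriv_one] at this

/-! ### Convolution operators on test functions -/

theorem integrable_testFun_mul {h : Eucl n → ℂ} (hh : Continuous h) (κ : TestFun n) :
    Integrable (fun w => h w * κ w) :=
  (hh.mul κ.continuous).integrable_of_hasCompactSupport κ.hasCompactSupport.mul_left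

theorem integrable_testFun (κ : TestFun n) : Integrable κ :=
  κ.continuous.integrable_of_hasCompactSupport κ.hasCompactSupport

theorem convolutionExists_testFun (h κ : TestFun n) (x : Eucl n) :
    Integrable (fun w => h w * κ (x - w)) := by
  have := integrable_testFun_mul (h := fun w => κ (x - w)) (by fun_prop) h
  simpa only [mul_comm] using this

/-- The operator `h ↦ h ⋆ κ` on test functions. -/
def convOp (κ : TestFun n) : Module.End ℂ (TestFun n) where
  toFun h :=
    { toFun := convolution h κ (ContinuousLinearMap.mul ℝ ℂ) volume
      contDiff' := κ.hasCompactSupport.contDiff_convolution_right _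
        h.continuous.locallyIntegrable κ.contDiff
      hasCompactSupport' := h.hasCompactSupport.convolution _ κ.hasCompactSupport
      tsupport_subset' := by simp }
  map_add' h h' := by
    ext x
    change ∫ w, (h w + h' w) * κ (x - w) = (∫ w, h w * κ (x - w)) + ∫ w, h' w * κ (x - w)
    simp_rw [add_mul]
    exact integral_add (convolutionExists_testFun h κ x) (convolutionExists_testFun h' κ x)
  map_smul' c h := by
    ext x
    change ∫ w, (c * h w) * κ (x - w) = c * ∫ w, h w * κ (x - w)
    simp_rw [mul_assoc]
    exact integral_const_mul _ _

theorem convOp_apply (κ h : TestFun n) (x : Eucl n) :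
    convOp κ h x = ∫ w, h w * κ (x - w) := rfl

theorem convOp_apply' (κ h : TestFun n) (x : Eucl n) :
    convOp κ h x = ∫ w, h (x - w) * κ w := by
  rw [convOp_apply, ← integral_sub_left_eq_self _ volume x]
  simp

theorem convOp_comm (κ h : TestFun n) : convOp κ h = convOp h κ := by
  ext x
  rw [convOp_apply, convOp_apply']
  simp_rw [mul_comm]

/-- Fubini for continuous compactly supported integrands. Commutation is what permits geometric-sum
identities in two different convolution operators. -/
theorem convOp_commute (κ κ' : TestFun n) : Commute (convOp κ) (convOp κ') := by
  refine LinearMap.ext fun h => TestFunction.ext fun x => ?_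
  change convOp κ (convOp κ' h) x = convOp κ' (convOp κ h) x
  simp only [convOp_apply']
  have h1 (w : Eucl n) : (∫ v, h (x - w - v) * κ' v) * κ w = ∫ v, h (x - w - v) * κ' v * κ w :=
    (integral_mul_const _ _).symm
  have h2 (w : Eucl n) : (∫ v, h (x - w - v) * κ v) * κ' w = ∫ v, h (x - w - v) * κ v * κ' w :=
    (integral_mul_const _ _).symm
  simp_rw [h1, h2]
  rw [integral_integral_swap_of_hasCompactSupport]
  · refine integral_congr_ae (.of_forall fun v => integral_congr_ae (.of_forall fun w => ?_))
    simp only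
    rw [sub_right_comm]
    ring
  · have := κ.continuous
    have := κ'.continuous
    have := h.continuous
    fun_prop
  · refine HasCompactSupport.intro (κ.hasCompactSupport.prod κ'.hasCompactSupport) ?_
    rintro ⟨w, v⟩ hwv
    simp only [mem_prod, not_and_or] at hwv
    rcases hwv with hw | hv
    · simp [image_eq_zero_of_notMem_tsupport hw]
    · simp [image_eq_zero_of_notMem_tsupport hv]

theorem partialDeriv_convOp (e : Fin n) (κ h : TestFun n) :
    partialDeriv e (convOp κ h) = convOp (partialDeriv e κ) h := by
  ext x
  rw [partialDeriv_apply]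
  have h1 := κ.hasCompactSupport.hasFDerivAt_convolution_right (μ := volume) (f := h)
    (ContinuousLinearMap.mul ℝ ℂ) h.continuous.locallyIntegrable
    (κ.contDiff.of_le (by simp)) x
  have h2 : fderiv ℝ (convOp κ h) x = _ := h1.fderiv
  rw [h2, convolution_precompR_apply (hf := h.continuous.locallyIntegrable)
    (hcg := κ.hasCompactSupport.fderiv ℝ) (hg := κ.contDiff.continuous_fderiv (by simp))]
  rfl

theorem partialDerivs_convOp (s : List (Fin n)) (κ h : TestFun n) :
    partialDerivs s (convOp κ h) = convOp (partialDerivs s κ) h := by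
  induction s with
  | nil => rfl
  | cons e s ih => rw [partialDerivs_cons, ih, partialDeriv_convOp, partialDerivs_cons]

theorem partialDerivs_convOp' (s : List (Fin n)) (κ h : TestFun n) :
    partialDerivs s (convOp κ h) = convOp κ (partialDerivs s h) := by
  rw [convOp_comm, partialDerivs_convOp, convOp_comm]

theorem norm_convOp_le {κ h : TestFun n} {B c : ℝ} (hB : 0 ≤ B) (hh : ∀ x, ‖h x‖ ≤ B)
    (hc : ∫ x, ‖κ x‖ ≤ c) (x : Eucl n) : ‖convOp κ h x‖ ≤ c * B := by
  rw [convOp_apply']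
  refine (norm_integral_le_of_norm_le (g := fun w => ‖κ w‖ * B)
    ((integrable_testFun κ).norm.mul_const B) (.of_forall fun w => ?_)).trans ?_
  · rw [norm_mul, mul_comm]
    exact mul_le_mul_of_nonneg_left (hh _) (norm_nonneg _)
  · rw [integral_mul_const]
    exact mul_le_mul_of_nonneg_right hc hB

theorem DerivBound.convOp {i : ℕ} {κ h : TestFun n} {B c : ℝ} (hB : 0 ≤ B)
    (hh : DerivBound i B h) (hc : ∫ x, ‖κ x‖ ≤ c) : DerivBound i (c * B) (convOp κ h) := by
  intro s hs x
  rw [partialDerivs_convOp']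
  exact norm_convOp_le hB (hh s hs) hc x

theorem DerivBound.neg {i : ℕ} {B : ℝ} {φ : TestFun n} (h : DerivBound i B φ) :
    DerivBound i B (-φ) := by
  intro s hs x
  rw [map_neg]
  simpa using h s hs x

theorem DerivBound.sub {i : ℕ} {B B' : ℝ} {φ χ : TestFun n} (h : DerivBound i B φ)
    (h' : DerivBound i B' χ) : DerivBound i (B + B') (φ - χ) := by
  rw [sub_eq_add_neg]
  exact h.add h'.neg

theorem DerivBound.sum {ι : Type*} {i : ℕ} {S : Finset ι} {B : ι → ℝ} {φ : ι → TestFun n}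
    (h : ∀ a ∈ S, DerivBound i (B a) (φ a)) : DerivBound i (∑ a ∈ S, B a) (∑ a ∈ S, φ a) := by
  classical
  induction S using Finset.induction_on with
  | empty =>
    intro s _ x
    simp
  | insert a S ha ih =>
    rw [Finset.sum_insert ha, Finset.sum_insert ha]
    exact (h a (Finset.mem_insert_self _ _)).add
      (ih fun b hb => h b (Finset.mem_insert_of_mem hb))

/-- The test function `φ` vanishes outside the open ball `B(z, r)`. -/
def SuppIn (z : Eucl n) (r : ℝ) (φ : TestFun n) : Prop := ∀ x, φ x ≠ 0 → ‖x - z‖ < r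

theorem SuppIn.mono {z : Eucl n} {r r' : ℝ} {φ : TestFun n} (h : SuppIn z r φ) (hr : r ≤ r') :
    SuppIn z r' φ := fun x hx => (h x hx).trans_le hr

theorem SuppIn.add {z : Eucl n} {r : ℝ} {φ χ : TestFun n} (h : SuppIn z r φ) (h' : SuppIn z r χ) :
    SuppIn z r (φ + χ) := by
  intro x hx
  by_cases h0 : φ x = 0
  · exact h' x fun h1 => hx (by simp [h0, h1])
  · exact h x h0

theorem SuppIn.neg {z : Eucl n} {r : ℝ} {φ : TestFun n} (h : SuppIn z r φ) :
    SuppIn z r (-φ) := fun x hx => h x (by simpa using hx)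

theorem SuppIn.sub {z : Eucl n} {r : ℝ} {φ χ : TestFun n} (h : SuppIn z r φ) (h' : SuppIn z r χ) :
    SuppIn z r (φ - χ) := by
  rw [sub_eq_add_neg]
  exact h.add h'.neg

theorem SuppIn.sum {ι : Type*} {z : Eucl n} {r : ℝ} {S : Finset ι} {φ : ι → TestFun n}
    (h : ∀ a ∈ S, SuppIn z r (φ a)) : SuppIn z r (∑ a ∈ S, φ a) := by
  classical
  induction S using Finset.induction_on with
  | empty => intro x hx; simp at hx
  | insert a S ha ih =>
    rw [Finset.sum_insert ha]
    exact (h a (Finset.mem_insert_self _ _)).add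
      (ih fun b hb => h b (Finset.mem_insert_of_mem hb))

theorem SuppIn.convOp {z : Eucl n} {r ε : ℝ} {κ h : TestFun n} (hh : SuppIn z r h)
    (hκ : SuppIn 0 ε κ) : SuppIn z (r + ε) (convOp κ h) := by
  intro x hx
  by_contra hlt
  refine hx ?_
  rw [convOp_apply]
  refine integral_eq_zero_of_ae (.of_forall fun w => ?_)
  by_contra hw
  have h1 : h w ≠ 0 := fun h0 => hw (by simp [h0])
  have h2 : κ (x - w) ≠ 0 := fun h0 => hw (by simp [h0])
  have h3 := hh w h1
  have h4 := hκ _ h2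
  rw [sub_zero] at h4
  have h5 : ‖x - z‖ ≤ ‖x - w‖ + ‖w - z‖ := norm_sub_le_norm_sub_add_norm_sub _ _ _
  linarith

/-- Since `κ` has integral one, `h - h * κ` averages the increments `h x - h (x - w)` over `‖w‖ <
ε`, and the mean value inequality applies. The factor `n` comes from bounding the full derivative by
the partial ones. -/
theorem norm_sub_convOp_le {κ h : TestFun n} {B c ε : ℝ} (hB : 0 ≤ B) (hε : 0 ≤ ε)
    (hh : DerivBound 1 B h) (hκ : SuppIn 0 ε κ) (h1 : ∫ x, κ x = 1) (hc : ∫ x, ‖κ x‖ ≤ c)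
    (x : Eucl n) : ‖(h - convOp κ h) x‖ ≤ (n * c * ε) * B := by
  have h2 : (h - convOp κ h) x = ∫ w, (h x - h (x - w)) * κ w := by
    rw [show (h - convOp κ h) x = h x - convOp κ h x from rfl, convOp_apply']
    simp_rw [sub_mul]
    rw [integral_sub ((integrable_testFun κ).const_mul _)
      (integrable_testFun_mul (by fun_prop) κ), integral_const_mul, h1, mul_one]
  rw [h2]
  refine (norm_integral_le_of_norm_le (g := fun w => ‖κ w‖ * (n * B * ε))
    ((integrable_testFun κ).norm.mul_const _) (.of_forall fun w => ?_)).trans ?_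
  · rw [norm_mul, mul_comm]
    by_cases hw : κ w = 0
    · simp [hw]
    refine mul_le_mul_of_nonneg_left ?_ (norm_nonneg _)
    have h3 : ‖h x - h (x - w)‖ ≤ n * B * ‖x - (x - w)‖ :=
      convex_univ.norm_image_sub_le_of_norm_fderiv_le (𝕜 := ℝ)
        (fun y _ => differentiableAt_testFun h y) (fun y _ => norm_fderiv_le hh y)
        (mem_univ _) (mem_univ _)
    refine h3.trans (mul_le_mul_of_nonneg_left ?_ (by positivity))
    have := hκ w hw
    rw [sub_zero] at this
    simpa using this.le
  · rw [integral_mul_const]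
    refine (mul_le_mul_of_nonneg_right hc (by positivity)).trans (le_of_eq (by ring))

theorem DerivBound.sub_convOp_of_succ {i : ℕ} {κ h : TestFun n} {B c ε : ℝ} (hB : 0 ≤ B)
    (hε : 0 ≤ ε) (hh : DerivBound (i + 1) B h) (hκ : SuppIn 0 ε κ) (h1 : ∫ x, κ x = 1)
    (hc : ∫ x, ‖κ x‖ ≤ c) : DerivBound i ((n * c * ε) * B) (h - LocalHardy.convOp κ h) := by
  intro s hs x
  rw [map_sub, partialDerivs_convOp']
  refine norm_sub_convOp_le hB hε ?_ hκ h1 hc x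
  intro s' hs' y
  obtain ⟨e, rfl⟩ := List.length_eq_one_iff.1 hs'
  exact hh (e :: s) (by simp [hs]) y

/-- Iterated exchange: convolution commutes with partial derivatives, so each factor consumes one
derivative and pays back one `ε`. -/
theorem DerivBound.one_sub_convOp_pow {i b : ℕ} {κ h : TestFun n} {B c ε : ℝ} (hB : 0 ≤ B)
    (hc0 : 0 ≤ c) (hε : 0 ≤ ε) (hh : DerivBound (i + b) B h) (hκ : SuppIn 0 ε κ)
    (h1 : ∫ x, κ x = 1) (hc : ∫ x, ‖κ x‖ ≤ c) :
    DerivBound i ((n * c * ε) ^ b * B) (((1 - LocalHardy.convOp κ) ^ b) h) := by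
  induction b generalizing i with
  | zero => simpa using hh
  | succ b ih =>
    have h2 := ih (i := i + 1) (by rwa [add_assoc, add_comm 1 b])
    rw [pow_succ', pow_succ', mul_assoc]
    exact h2.sub_convOp_of_succ (by positivity) hε hκ h1 hc

/-- The crude counterpart, with no derivative spent and no gain; it serves the initial term of the
telescoping sum. -/
theorem DerivBound.one_sub_convOp_pow' {i b : ℕ} {κ h : TestFun n} {B c : ℝ} (hB : 0 ≤ B)
    (hc0 : 0 ≤ c) (hh : DerivBound i B h) (hc : ∫ x, ‖κ x‖ ≤ c) :
    DerivBound i ((1 + c) ^ b * B) (((1 - LocalHardy.convOp κ) ^ b) h) := by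
  induction b with
  | zero => simpa using hh
  | succ b ih =>
    rw [pow_succ', pow_succ', mul_assoc]
    refine (ih.sub (ih.convOp (by positivity) hc)).mono (le_of_eq (by ring))

theorem SuppIn.one_sub_convOp_pow {z : Eucl n} {r ε : ℝ} {κ h : TestFun n} (b : ℕ)
    (hε : 0 ≤ ε) (hh : SuppIn z r h) (hκ : SuppIn 0 ε κ) :
    SuppIn z (r + b * ε) (((1 - LocalHardy.convOp κ) ^ b) h) := by
  induction b with
  | zero => simpa using hh
  | succ b ih =>
    rw [pow_succ']
    have h2 : r + ((b + 1 : ℕ) : ℝ) * ε = r + b * ε + ε := by push_cast; ring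
    rw [h2]
    exact (ih.mono (by linarith)).sub (ih.convOp hκ)

/-! ### Dilated and translated test functions -/

theorem dilTrans_apply (φ : TestFun n) (l : ℤ) (x y : Eucl n) :
    dilTrans φ l x y = ((2 : ℝ) ^ (l * (n : ℤ))) • φ (((2 : ℝ) ^ l) • (x - y)) := rfl

theorem dilTrans_eq_zero_sub (φ : TestFun n) (l : ℤ) (x y : Eucl n) :
    dilTrans φ l x y = dilTrans φ l 0 (y - x) := by
  simp [dilTrans_apply]

theorem dilTrans_smul (c : ℂ) (φ : TestFun n) (l : ℤ) (x : Eucl n) :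
    dilTrans (c • φ) l x = c • dilTrans φ l x := by
  ext y
  change ((2 : ℝ) ^ (l * (n : ℤ))) • (c • φ _) = c • (((2 : ℝ) ^ (l * (n : ℤ))) • φ _)
  rw [smul_comm]

theorem conv_smul (c : ℂ) (φ : TestFun n) (l : ℤ) (f : Distr n) (x : Eucl n) :
    conv (c • φ) l f x = c * conv φ l f x := by
  rw [conv, dilTrans_smul, map_smul, smul_eq_mul, conv]

/-- Chain rule; the sign reflects the dependence on `x - y`. -/
theorem partialDeriv_dilTrans (e : Fin n) (φ : TestFun n) (l : ℤ) (x : Eucl n) :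
    partialDeriv e (dilTrans φ l x) =
      ((-(2 : ℝ) ^ l : ℝ) : ℂ) • dilTrans (partialDeriv e φ) l x := by
  ext y
  have h1 : HasFDerivAt (fun y : Eucl n => ((2 : ℝ) ^ l) • (x - y))
      (((2 : ℝ) ^ l) • (-ContinuousLinearMap.id ℝ (Eucl n))) y := by
    exact ((hasFDerivAt_id (𝕜 := ℝ) y).const_sub x).fun_const_smul ((2 : ℝ) ^ l)
  have h2 := ((differentiableAt_testFun φ (((2 : ℝ) ^ l) • (x - y))).hasFDerivAt.comp y h1).const_smul
    ((2 : ℝ) ^ (l * (n : ℤ)))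
  have h3 : fderiv ℝ (dilTrans φ l x) y = _ := h2.fderiv
  rw [partialDeriv_apply, h3]
  change ((2 : ℝ) ^ (l * (n : ℤ))) • fderiv ℝ φ _ (((2 : ℝ) ^ l) • (-EuclideanSpace.single e 1)) =
    ((-(2 : ℝ) ^ l : ℝ) : ℂ) • ((2 : ℝ) ^ (l * (n : ℤ))) • fderiv ℝ φ _ (EuclideanSpace.single e 1)
  simp only [map_smul, map_neg, Complex.real_smul, smul_eq_mul]
  push_cast
  ring

theorem partialDerivs_dilTrans (s : List (Fin n)) (φ : TestFun n) (l : ℤ) (x : Eucl n) :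
    partialDerivs s (dilTrans φ l x) =
      ((-(2 : ℝ) ^ l : ℝ) : ℂ) ^ s.length • dilTrans (partialDerivs s φ) l x := by
  induction s with
  | nil => simp
  | cons e s ih =>
    rw [partialDerivs_cons, ih, map_smul, partialDeriv_dilTrans, smul_smul, List.length_cons,
      pow_succ, partialDerivs_cons]

theorem DerivBound.dilTrans {i : ℕ} {B : ℝ} {φ : TestFun n} (h : DerivBound i B φ) (l : ℤ)
    (x : Eucl n) : DerivBound i ((2 : ℝ) ^ (l * (n : ℤ)) * ((2 : ℝ) ^ l) ^ i * B)
      (dilTrans φ l x) := by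
  rintro s rfl y
  rw [partialDerivs_dilTrans]
  change ‖((-(2 : ℝ) ^ l : ℝ) : ℂ) ^ s.length • ((2 : ℝ) ^ (l * (n : ℤ))) • partialDerivs s φ _‖ ≤ _
  rw [norm_smul, norm_smul, norm_pow, Complex.norm_real, norm_neg, Real.norm_of_nonneg (by positivity),
    Real.norm_of_nonneg (by positivity), ← mul_assoc, mul_comm (((2 : ℝ) ^ l) ^ _)]
  exact mul_le_mul_of_nonneg_left (h s rfl _) (by positivity)

theorem SuppIn.dilTrans {R : ℝ} {φ : TestFun n} (h : SuppIn 0 R φ) (l : ℤ) (x : Eucl n) :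
    SuppIn x (R * (2 : ℝ) ^ (-l)) (dilTrans φ l x) := by
  intro y hy
  have h1 := h (((2 : ℝ) ^ l) • (x - y)) fun h0 => hy (by simp [dilTrans_apply, h0])
  rw [sub_zero, norm_smul, Real.norm_of_nonneg (by positivity), norm_sub_rev] at h1
  rw [zpow_neg, ← div_eq_mul_inv, lt_div_iff₀ (by positivity), mul_comm]
  exact h1

theorem suppIn_of_tsupport_subset {R : ℝ} {φ : TestFun n} (h : tsupport φ ⊆ Metric.ball 0 R) :
    SuppIn 0 R φ := fun x hx => by
  have := h (subset_tsupport _ hx)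
  rwa [mem_ball_zero_iff, ← sub_zero x] at this

theorem exists_tsupport_subset_ball (φ : TestFun n) :
    ∃ R : ℝ, 0 < R ∧ tsupport φ ⊆ Metric.ball 0 R := by
  obtain ⟨R, hR⟩ := φ.hasCompactSupport.isCompact.isBounded.subset_ball 0
  exact ⟨max R 1, by positivity, hR.trans (Metric.ball_subset_ball (le_max_left _ _))⟩

theorem exists_suppIn (z : Eucl n) (φ : TestFun n) : ∃ R : ℝ, 0 < R ∧ SuppIn z R φ := by
  obtain ⟨R, hR0, hR⟩ := exists_tsupport_subset_ball φ
  refine ⟨R + ‖z‖, by positivity, fun x hx => ?_⟩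
  have := suppIn_of_tsupport_subset hR x hx
  rw [sub_zero] at this
  linarith [norm_sub_le x z]

/-- A general codomain lets one change of variables serve both `φ` and `‖φ‖`. -/
theorem integral_dilTrans_zero {F : Type*} [NormedAddCommGroup F] [NormedSpace ℝ F]
    (g : Eucl n → F) (l : ℤ) :
    ∫ y, ((2 : ℝ) ^ (l * (n : ℤ))) • g (((2 : ℝ) ^ l) • ((0 : Eucl n) - y)) = ∫ y, g y := by
  rw [integral_smul]
  have h1 : ∫ y, g (((2 : ℝ) ^ l) • ((0 : Eucl n) - y)) = ∫ y, g (((2 : ℝ) ^ l) • y) := by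
    rw [← integral_neg_eq_self]
    simp
  rw [h1, Measure.integral_comp_smul, finrank_euclideanSpace, Fintype.card_fin, smul_smul,
    abs_of_nonneg (by positivity), zpow_mul, zpow_natCast, mul_inv_cancel₀ (by positivity), one_smul]

theorem integral_dilTrans (φ : TestFun n) (l : ℤ) : ∫ y, dilTrans φ l 0 y = ∫ y, φ y :=
  integral_dilTrans_zero φ l

theorem integral_norm_dilTrans (φ : TestFun n) (l : ℤ) :
    ∫ y, ‖dilTrans φ l 0 y‖ = ∫ y, ‖φ y‖ := by
  rw [← integral_dilTrans_zero (fun y => ‖φ y‖) l]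
  refine integral_congr_ae (.of_forall fun y => ?_)
  simp only [dilTrans_apply, norm_smul, smul_eq_mul]
  rw [Real.norm_of_nonneg (by positivity)]

/-! ### Distributions on jets -/

/-- The lists of coordinate directions of length at most `m`. -/
def listsLE (n m : ℕ) : Finset (List (Fin n)) := (List.finite_length_le (Fin n) m).toFinset

theorem mem_listsLE {m : ℕ} {s : List (Fin n)} : s ∈ listsLE n m ↔ s.length ≤ m := by
  simp [listsLE]

/-- The family of all partial derivatives of order at most `m`, as bounded functions. -/
def jet (m : ℕ) : TestFun n →ₗ[ℂ] (listsLE n m → BoundedContinuousFunction (Eucl n) ℂ) :=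
  LinearMap.pi fun s =>
    (TestFunction.toBoundedContinuousFunctionCLM ℂ).toLinearMap ∘ₗ partialDerivs s.1

theorem jet_apply (m : ℕ) (φ : TestFun n) (s : listsLE n m) (x : Eucl n) :
    jet m φ s x = partialDerivs s.1 φ x := rfl

theorem jet_injective (m : ℕ) : Function.Injective (jet (n := n) m) := by
  intro φ χ h
  ext x
  have := congrArg (fun J => J ⟨[], mem_listsLE.2 (by simp)⟩ x) h
  simpa only [jet_apply, partialDerivs_nil] using this

theorem norm_jet_le {m : ℕ} {φ : TestFun n} {B : ℝ} (hB : 0 ≤ B) (h : ∀ i ≤ m, DerivBound i B φ) :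
    ‖jet m φ‖ ≤ B := by
  refine (pi_norm_le_iff_of_nonneg hB).2 fun s => (BoundedContinuousFunction.norm_le hB).2 fun x => ?_
  exact h _ (mem_listsLE.1 s.2) _ rfl x

theorem derivBound_jet {m i : ℕ} (hi : i ≤ m) (φ : TestFun n) : DerivBound i ‖jet m φ‖ φ := by
  rintro s rfl x
  have h1 := BoundedContinuousFunction.norm_coe_le_norm (jet m φ ⟨s, mem_listsLE.2 hi⟩) x
  exact h1.trans (norm_le_pi_norm (jet m φ) _)

/-- Restricted to functions supported in a closed ball, `f` is continuous on a Fréchet space, hence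
bounded by finitely many derivative seminorms: distributions have finite order locally. -/
theorem exists_norm_le_jet (f : Distr n) (z : Eucl n) (r : ℝ) :
    ∃ (m : ℕ) (C : ℝ), ∀ φ : TestFun n, SuppIn z r φ → ‖f φ‖ ≤ C * ‖jet m φ‖ := by
  let K : TopologicalSpace.Compacts (Eucl n) := ⟨Metric.closedBall z r, isCompact_closedBall z r⟩
  have hK : (K : Set (Eucl n)) ⊆ ((⊤ : TopologicalSpace.Opens (Eucl n)) : Set (Eucl n)) := by simp
  let g : ContDiffMapSupportedIn (Eucl n) ℂ ⊤ K →L[ℂ] ℂ := f.comp (TestFunction.ofSupportedInCLM ℂ hK)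
  obtain ⟨S, C, -, hC⟩ := Seminorm.bound_of_continuous
    (ContDiffMapSupportedIn.withSeminorms ℂ (Eucl n) ℂ ⊤ K)
    ((normSeminorm ℂ ℂ).comp g.toLinearMap) (by exact continuous_norm.comp g.continuous)
  -- The seminorms see full derivatives, which cost `n ^ i` over the partial ones. The base `n + 1 ≥
  -- 1` makes the power monotone in the order.
  refine ⟨S.sup id, C * (n + 1) ^ (S.sup id), fun φ hφ => ?_⟩
  let φ' : ContDiffMapSupportedIn (Eucl n) ℂ ⊤ K :=
    ⟨φ, φ.contDiff, fun x hx => by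
      by_contra h0
      exact hx (by simpa [K, dist_eq_norm] using (hφ x h0).le)⟩
  have h1 : ‖f φ‖ ≤ C * (S.sup (ContDiffMapSupportedIn.seminorm ℂ (Eucl n) ℂ ⊤ K)) φ' := hC φ'
  refine h1.trans ?_
  rw [mul_assoc]
  refine mul_le_mul_of_nonneg_left ?_ C.coe_nonneg
  refine Seminorm.finset_sup_apply_le (by positivity) fun i hi => ?_
  have him : i ≤ S.sup id := Finset.le_sup (f := id) hi
  rw [ContDiffMapSupportedIn.seminorm_top_le_iff ℂ (by positivity)]
  intro x _
  refine ((derivBound_jet him φ).norm_iteratedFDeriv_le x).trans ?_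
  refine mul_le_mul_of_nonneg_right ?_ (norm_nonneg _)
  exact (pow_le_pow_left₀ (by positivity) (by linarith) i).trans
    (pow_le_pow_right₀ (by linarith [n.cast_nonneg (α := ℝ)]) him)

/-- A distribution, restricted to test functions with support in a fixed ball, is the composition
of a jet with a continuous functional on a Banach space. -/
theorem exists_extension_jet (f : Distr n) (z : Eucl n) (r : ℝ) :
    ∃ (m : ℕ) (ℓ : StrongDual ℂ (listsLE n m → BoundedContinuousFunction (Eucl n) ℂ)),
      ∀ φ : TestFun n, SuppIn z r φ → f φ = ℓ (jet m φ) := by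
  obtain ⟨m, C, hC⟩ := exists_norm_le_jet f z r
  -- Jets are injective, so `f` transports to a bounded functional on a subspace of jets, which
  -- Hahn–Banach extends. A functional on a Banach space can then be moved through Bochner
  -- integrals.
  let U : Submodule ℂ (TestFun n) :=
    { carrier := {φ | SuppIn z r φ}
      add_mem' := fun h h' => h.add h'
      zero_mem' := fun x hx => absurd rfl hx
      smul_mem' := fun c φ h x hx => h x fun h0 => hx (by
        change c * φ x = 0
        rw [h0, mul_zero]) }
  let e := U.equivMapOfInjective (jet m) (jet_injective m)
  let g : U.map (jet m) →ₗ[ℂ] ℂ := f.toLinearMap ∘ₗ U.subtype ∘ₗ e.symm.toLinearMap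
  have hg : ∀ v, ‖g v‖ ≤ C * ‖v‖ := by
    intro v
    obtain ⟨φ, rfl⟩ := e.surjective v
    have : g (e φ) = f φ := by simp [g]
    rw [this]
    exact hC φ φ.2
  obtain ⟨ℓ, hℓ, -⟩ := exists_extension_norm_eq (U.map (jet m)) (g.mkContinuous C hg)
  refine ⟨m, ℓ, fun φ hφ => ?_⟩
  have h1 := hℓ (e ⟨φ, hφ⟩)
  have h2 : (g.mkContinuous C hg) (e ⟨φ, hφ⟩) = f φ := by simp [g]
  rw [h2] at h1
  exact h1.symm

/-- Translation is continuous in the sup norm on uniformly continuous functions, and compact support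
supplies the uniform continuity. -/
theorem continuous_toBCF_dilTrans (φ : TestFun n) (l : ℤ) :
    Continuous fun w => TestFunction.toBoundedContinuousFunctionCLM ℂ (dilTrans φ l w) := by
  have hu : UniformContinuous (dilTrans φ l 0) :=
    (dilTrans φ l 0).hasCompactSupport.uniformContinuous_of_continuous (dilTrans φ l 0).continuous
  rw [Metric.continuous_iff]
  intro w ε hε
  obtain ⟨δ, hδ, h⟩ := Metric.uniformContinuous_iff.1 hu (ε / 2) (half_pos hε)
  refine ⟨δ, hδ, fun v hv => ?_⟩
  refine lt_of_le_of_lt ((BoundedContinuousFunction.dist_le (half_pos hε).le).2 fun u => ?_)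
    (half_lt_self hε)
  change dist (dilTrans φ l v u) (dilTrans φ l w u) ≤ _
  rw [dilTrans_eq_zero_sub, dilTrans_eq_zero_sub φ l w]
  exact (h (by rwa [dist_sub_left])).le

theorem continuous_jet_dilTrans (m : ℕ) (φ : TestFun n) (l : ℤ) :
    Continuous fun w => jet m (dilTrans φ l w) := by
  refine continuous_pi fun s => ?_
  have : (fun w => jet m (dilTrans φ l w) s) = fun w => ((-(2 : ℝ) ^ l : ℝ) : ℂ) ^ s.1.length •
      TestFunction.toBoundedContinuousFunctionCLM ℂ (dilTrans (partialDerivs s.1 φ) l w) := by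
    funext w
    have h1 := congrArg (TestFunction.toBoundedContinuousFunctionCLM ℂ)
      (partialDerivs_dilTrans s.1 φ l w)
    rw [map_smul] at h1
    exact h1
  rw [this]
  exact (continuous_toBCF_dilTrans (partialDerivs s.1 φ) l).const_smul
    (((-(2 : ℝ) ^ l : ℝ) : ℂ) ^ s.1.length)

theorem continuous_conv (φ : TestFun n) (l : ℤ) (f : Distr n) : Continuous (conv φ l f) := by
  rw [continuous_iff_continuousAt]
  intro x
  obtain ⟨R, hR0, hR⟩ := exists_suppIn 0 φ
  obtain ⟨m, ℓ, hℓ⟩ := exists_extension_jet f x (R * 2 ^ (-l) + 1)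
  have h1 : ∀ᶠ w in nhds x, conv φ l f w = ℓ (jet m (dilTrans φ l w)) := by
    filter_upwards [Metric.ball_mem_nhds x one_pos] with w hw
    refine hℓ _ fun y hy => ?_
    have h2 := (hR.dilTrans l w) y hy
    rw [Metric.mem_ball, dist_eq_norm] at hw
    linarith [norm_sub_le_norm_sub_add_norm_sub y w x]
  exact ((ℓ.continuous.comp (continuous_jet_dilTrans m φ l)).continuousAt).congr
    (h1.mono fun _ h => h.symm)

/-- `⟨f, h ⋆ κ̌_l⟩ = ∫ h (φ_l ⋆ f)`. -/
theorem apply_convOp_dilTrans (f : Distr n) (φ h : TestFun n) (l : ℤ) :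
    f (convOp (dilTrans φ l 0) h) = ∫ w, h w * conv φ l f w := by
  obtain ⟨R, hR0, hR⟩ := exists_suppIn 0 φ
  obtain ⟨r, hr0, hr⟩ := exists_suppIn 0 h
  obtain ⟨m, ℓ, hℓ⟩ := exists_extension_jet f 0 (r + R * 2 ^ (-l))
  have hint : Integrable fun w => h w • jet m (dilTrans φ l w) :=
    (h.continuous.smul (continuous_jet_dilTrans m φ l)).integrable_of_hasCompactSupport
      h.hasCompactSupport.smul_right
  -- The convolution is a superposition of translates, as a Bochner integral of jets. Evaluation at
  -- a component and a point is continuous linear, which reduces the identity to a scalar one.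
  have h1 : jet m (convOp (dilTrans φ l 0) h) = ∫ w, h w • jet m (dilTrans φ l w) := by
    funext s
    ext x
    let T : (listsLE n m → BoundedContinuousFunction (Eucl n) ℂ) →L[ℂ] ℂ :=
      (BoundedContinuousFunction.evalCLM ℂ x).comp (ContinuousLinearMap.proj s)
    have h2 : T (∫ w, h w • jet m (dilTrans φ l w)) = ∫ w, T (h w • jet m (dilTrans φ l w)) :=
      (T.integral_comp_comm hint).symm
    change _ = T _
    rw [h2, jet_apply, partialDerivs_convOp, convOp_apply]
    refine integral_congr_ae (.of_forall fun w => ?_)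
    simp only [map_smul, smul_eq_mul]
    change _ = h w * partialDerivs s.1 (dilTrans φ l w) x
    rw [partialDerivs_dilTrans, partialDerivs_dilTrans]
    change _ = h w * (_ * dilTrans (partialDerivs s.1 φ) l w x)
    rw [dilTrans_eq_zero_sub _ l w]
    rfl
  rw [hℓ _ (hr.convOp (hR.dilTrans l 0)), h1, ← ℓ.integral_comp_comm hint]
  refine integral_congr_ae (.of_forall fun w => ?_)
  simp only [map_smul, smul_eq_mul]
  by_cases hw : h w = 0
  · simp [hw]
  rw [← hℓ, conv]
  intro y hy
  have h2 := (hR.dilTrans l w) y hy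
  linarith [hr w hw, norm_sub_le_norm_sub_add_norm_sub y w 0]

/-! ### The local reproducing estimate -/

theorem ofReal_two_zpow (k : ℤ) : ENNReal.ofReal ((2 : ℝ) ^ k) = (2 : ℝ≥0∞) ^ (k : ℝ) := by
  rw [← Real.rpow_intCast, ← ENNReal.ofReal_rpow_of_pos two_pos]
  simp

theorem enorm_apply_convOp_le (f : Distr n) (ψ h : TestFun n) (k : ℤ) {z : Eucl n} {r B : ℝ}
    (hh : SuppIn z r h) (hB : DerivBound 0 B h) :
    ‖f (convOp (dilTrans ψ k 0) h)‖ₑ ≤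
      ENNReal.ofReal B * ∫⁻ w in Metric.ball z r, ‖conv ψ k f w‖ₑ := by
  rw [apply_convOp_dilTrans]
  refine (enorm_integral_le_lintegral_enorm _).trans ?_
  rw [← lintegral_indicator Metric.isOpen_ball.measurableSet, ← lintegral_const_mul']
  · refine lintegral_mono fun w => ?_
    by_cases hw : h w = 0
    · simp [hw]
    · have h1 : w ∈ Metric.ball z r := by
        rw [Metric.mem_ball, dist_eq_norm]
        exact hh w hw
      rw [indicator_of_mem h1, enorm_mul]
      gcongr
      rw [← ofReal_norm]
      exact ENNReal.ofReal_le_ofReal (derivBound_zero_iff.1 hB w)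
  · exact ENNReal.ofReal_ne_top

section Reproducing

variable {ψ : TestFun n} {R₀ : ℝ}

/-- `(1 - A_j)^a (1 - A_k)^b` gains `a + b` powers of the scale. -/
theorem DerivBound.one_sub_convOp_pow_mul {a b : ℕ} {ψ h : TestFun n} {R₀ B : ℝ}
    (hψ : SuppIn 0 R₀ ψ) (hψ1 : ∫ x, ψ x = 1) (hR₀ : 0 ≤ R₀) (hB : 0 ≤ B) {j k : ℤ} (hjk : j ≤ k)
    (hh : DerivBound (a + b) B h) :
    DerivBound 0 ((n * (∫ x, ‖ψ x‖) * (R₀ * 2 ^ (-j))) ^ (a + b) * B)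
      (((1 - LocalHardy.convOp (LocalHardy.dilTrans ψ j 0)) ^ a *
        (1 - LocalHardy.convOp (LocalHardy.dilTrans ψ k 0)) ^ b) h) := by
  have hc0 : 0 ≤ ∫ x, ‖ψ x‖ := integral_nonneg fun _ => norm_nonneg _
  have hI (k : ℤ) : ∫ x, LocalHardy.dilTrans ψ k 0 x = 1 := (integral_dilTrans ψ k).trans hψ1
  have h1 := hh.one_sub_convOp_pow hB hc0 (by positivity) (hψ.dilTrans k 0) (hI k)
    (integral_norm_dilTrans ψ k).le
  rw [← zero_add a] at h1
  have h2 := DerivBound.one_sub_convOp_pow (i := 0) (b := a) (by positivity) hc0 (by positivity) h1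
    (hψ.dilTrans j 0) (hI j) (integral_norm_dilTrans ψ j).le
  refine h2.mono ?_
  rw [← mul_assoc, pow_add]
  gcongr
  exact one_le_two

theorem SuppIn.one_sub_convOp_pow_mul {ψ h : TestFun n} {R₀ r : ℝ} {z : Eucl n} (a b : ℕ)
    (hψ : SuppIn 0 R₀ ψ) (hR₀ : 0 ≤ R₀) {j k : ℤ} (hjk : j ≤ k) (hh : SuppIn z r h) :
    SuppIn z (r + (a + b : ℕ) * (R₀ * 2 ^ (-j)))
      (((1 - LocalHardy.convOp (LocalHardy.dilTrans ψ j 0)) ^ a *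
        (1 - LocalHardy.convOp (LocalHardy.dilTrans ψ k 0)) ^ b) h) := by
  have h1 := hh.one_sub_convOp_pow b (by positivity) (hψ.dilTrans k 0)
  refine (h1.one_sub_convOp_pow a (by positivity) (hψ.dilTrans j 0)).mono ?_
  have h2 : R₀ * (2 : ℝ) ^ (-k) ≤ R₀ * 2 ^ (-j) := by
    gcongr
    exact one_le_two
  push_cast
  nlinarith [mul_le_mul_of_nonneg_left h2 (b.cast_nonneg (α := ℝ))]

/-- On a fixed ball containing all the supports, `f` has some finite order `m`. The `m`-jet of the
argument is of size `2^{-(k+i)M}`, because `h` has `m + M` bounded derivatives to spend. -/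
theorem tendsto_apply_one_sub_convOp_pow (hψ : SuppIn 0 R₀ ψ) (hψ1 : ∫ x, ψ x = 1) (hR₀ : 0 ≤ R₀)
    (f : Distr n) (h : TestFun n) (M : ℕ) (k : ℤ) {z : Eucl n} {r : ℝ} (hM : M ≠ 0)
    (hh : SuppIn z r h) :
    Filter.Tendsto (fun i : ℕ => f (((1 - convOp (dilTrans ψ (k + i) 0)) ^ M) h))
      Filter.atTop (nhds 0) := by
  have hc0 : 0 ≤ ∫ x, ‖ψ x‖ := integral_nonneg fun _ => norm_nonneg _
  obtain ⟨m, ℓ, hℓ⟩ := exists_extension_jet f z (r + M * (R₀ * 2 ^ (-k)))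
  obtain ⟨B, hB0, hB⟩ := exists_derivBound h (m + M)
  have h1 (i : ℕ) : ‖f (((1 - convOp (dilTrans ψ (k + i) 0)) ^ M) h)‖ ≤
      ‖ℓ‖ * ((n * (∫ x, ‖ψ x‖) * (R₀ * 2 ^ (-(k + i : ℤ)))) ^ M * B) := by
    rw [hℓ]
    · refine (ℓ.le_opNorm _).trans (mul_le_mul_of_nonneg_left ?_ (norm_nonneg _))
      refine norm_jet_le (by positivity) fun i' hi' => ?_
      exact (hB (i' + M) (by omega)).one_sub_convOp_pow hB0.le hc0 (by positivity)
        (hψ.dilTrans _ 0) ((integral_dilTrans ψ _).trans hψ1) (integral_norm_dilTrans ψ _).le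
    · refine (hh.one_sub_convOp_pow M (by positivity) (hψ.dilTrans _ 0)).mono ?_
      gcongr
      · exact one_le_two
      · omega
  refine squeeze_zero_norm h1 ?_
  have h2 : Filter.Tendsto (fun i : ℕ => (2 : ℝ) ^ (-(k + i : ℤ))) Filter.atTop (nhds 0) := by
    have h3 : (fun i : ℕ => (2 : ℝ) ^ (-(k + i : ℤ))) = fun i : ℕ => (2 : ℝ) ^ (-k) * (1 / 2) ^ i := by
      funext i
      rw [neg_add, zpow_add₀ two_ne_zero, zpow_neg _ (i : ℤ), zpow_natCast, one_div, inv_pow]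
    rw [h3]
    simpa using (tendsto_pow_atTop_nhds_zero_of_lt_one (by norm_num : (0 : ℝ) ≤ 1 / 2)
      (by norm_num)).const_mul ((2 : ℝ) ^ (-k))
  have h4 := ((((h2.const_mul R₀).const_mul (n * (∫ x, ‖ψ x‖))).pow M).mul_const B).const_mul ‖ℓ‖
  simpa [hM] using h4

/-- This is `x^M - y^M = (x - y) ∑ x^a y^(M-1-a)` with `x - y = A_k - A_j`. Every difference thus
lies in the range of the two averaging operators, so pairing it with `f` involves only `ψ_k * f` and
`ψ_j * f`. -/
theorem one_sub_convOp_pow_sub (ψ h : TestFun n) (j k : ℤ) (M : ℕ) :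
    ((1 - convOp (dilTrans ψ j 0)) ^ M) h - ((1 - convOp (dilTrans ψ k 0)) ^ M) h =
      convOp (dilTrans ψ k 0) (∑ a ∈ Finset.range M, ((1 - convOp (dilTrans ψ j 0)) ^ a *
        (1 - convOp (dilTrans ψ k 0)) ^ (M - 1 - a)) h) -
      convOp (dilTrans ψ j 0) (∑ a ∈ Finset.range M, ((1 - convOp (dilTrans ψ j 0)) ^ a *
        (1 - convOp (dilTrans ψ k 0)) ^ (M - 1 - a)) h) := by
  have hc : Commute (1 - convOp (dilTrans ψ j 0)) (1 - convOp (dilTrans ψ k 0)) :=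
    (Commute.one_left _).sub_left ((Commute.one_right _).sub_right (convOp_commute _ _))
  have h1 := hc.mul_geom_sum₂ M
  rw [sub_sub_sub_cancel_left] at h1
  have h2 := LinearMap.congr_fun h1 h
  rw [LinearMap.sub_apply] at h2
  rw [← h2, Module.End.mul_apply, LinearMap.sub_apply, LinearMap.sum_apply]

/-- The same factorisation with the identity operator as one of the two bases. -/
theorem sub_one_sub_convOp_pow (κ h : TestFun n) (M : ℕ) :
    h - ((1 - convOp κ) ^ M) h = convOp κ (∑ a ∈ Finset.range M, ((1 - convOp κ) ^ a) h) := by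
  have h1 := mul_neg_geom_sum (1 - convOp κ) M
  rw [sub_sub_cancel] at h1
  have h2 := LinearMap.congr_fun h1 h
  rw [LinearMap.sub_apply, Module.End.mul_apply, LinearMap.sum_apply] at h2
  exact h2.symm

/-- Telescope `(1 - A_k)^(L+1)` over `k = l + m + i`. Factoring out `A_k - A_j` leaves `L` factors,
which turn the `L` derivatives of `φ` into the weight `2^{-iL}`, while the remainder tends to zero.
The constant is independent of `m`, so the expansion may start at an arbitrarily fine scale. -/
theorem exists_reproducing_estimate (hψ : SuppIn 0 R₀ ψ) (hψ1 : ∫ x, ψ x = 1) (hR₀ : 0 ≤ R₀)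
    {R₁ : ℝ} (L : ℕ) :
    ∃ C : ℝ≥0, ∀ m : ℕ, L + 1 ≤ m → ∀ (f : Distr n) (φ : TestFun n), SuppIn 0 R₁ φ →
      DerivBound 0 1 φ → DerivBound L 1 φ → ∀ (l : ℤ) (z : Eucl n),
      ‖conv φ l f z‖ₑ ≤ C * (2 : ℝ≥0∞) ^ ((l * n : ℤ) : ℝ) *
        ∑' i : ℕ, (2 : ℝ≥0∞) ^ (-(i * L : ℝ)) *
          ∫⁻ w in Metric.ball z ((R₀ + R₁) * 2 ^ (-l)), ‖conv ψ (l + m + i) f w‖ₑ := by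
  set c : ℝ := ∫ x, ‖ψ x‖ with hc
  have hc0 : 0 ≤ c := integral_nonneg fun _ => norm_nonneg _
  set C₁ : ℝ := (L + 1) * (1 + c) ^ L with hC₁
  set C₂ : ℝ := (L + 1) * (n * c * (R₀ * 2)) ^ L with hC₂
  have hC₁0 : 0 ≤ C₁ := by positivity
  have hC₂0 : 0 ≤ C₂ := by positivity
  refine ⟨(C₁ + 2 * C₂).toNNReal, fun m hm f φ hφ hφ0 hφL l z => ?_⟩
  set η := dilTrans φ l z with hη
  set r := (R₀ + R₁) * (2 : ℝ) ^ (-l) with hr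
  set I : ℕ → ℝ≥0∞ := fun i => ∫⁻ w in Metric.ball z r, ‖conv ψ (l + m + i) f w‖ₑ with hI
  set T : ℝ≥0∞ := ∑' i : ℕ, (2 : ℝ≥0∞) ^ (-(i * L : ℝ)) * I i with hT
  set D : ℤ → Module.End ℂ (TestFun n) := fun k => 1 - convOp (dilTrans ψ k 0) with hD
  have hηs : SuppIn z (R₁ * 2 ^ (-l)) η := hφ.dilTrans l z
  have hη0 : DerivBound 0 ((2 : ℝ) ^ (l * (n : ℤ))) η := by simpa using hφ0.dilTrans l z
  have hηL : DerivBound L ((2 : ℝ) ^ (l * (n : ℤ)) * ((2 : ℝ) ^ l) ^ L) η := by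
    simpa using hφL.dilTrans l z
  have hm2 : ((L : ℝ) + 1) ≤ 2 ^ m := by
    have : L + 1 ≤ 2 ^ m := hm.trans Nat.lt_two_pow_self.le
    exact_mod_cast this
  -- At most `L ≤ 2^m` factors act, each widening the support by at most `R₀ 2^{-l-m}`; together
  -- they add at most `R₀ 2^{-l}`.
  have hscale (j : ℤ) (hj : l + m ≤ j) (a : ℕ) (ha : a ≤ L) :
      R₁ * 2 ^ (-l) + a * (R₀ * 2 ^ (-j)) ≤ r := by
    have h1 : (a : ℝ) * 2 ^ (-j) ≤ 2 ^ (-l) := by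
      calc (a : ℝ) * 2 ^ (-j) ≤ 2 ^ m * 2 ^ (-(l + m)) := by
            gcongr
            · exact (by exact_mod_cast ha : (a : ℝ) ≤ L).trans (by linarith)
            · exact one_le_two
        _ = 2 ^ (-l) := by
            rw [← zpow_natCast, ← zpow_add₀ two_ne_zero]
            congr 1
            ring
    have h2 := mul_le_mul_of_nonneg_left h1 hR₀
    rw [hr]
    nlinarith
  -- the first term
  have hfirst : ‖f (η - (D (l + m) ^ (L + 1)) η)‖ₑ ≤
      ENNReal.ofReal (C₁ * 2 ^ (l * (n : ℤ))) * I 0 := by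
    rw [sub_one_sub_convOp_pow]
    have := enorm_apply_convOp_le f ψ (∑ a ∈ Finset.range (L + 1), (D (l + m) ^ a) η) (l + m)
      (z := z) (r := r) (B := C₁ * 2 ^ (l * (n : ℤ))) ?_ ?_
    · simpa [hI] using this
    · refine SuppIn.sum fun a ha => ?_
      refine (hηs.one_sub_convOp_pow a (by positivity) (hψ.dilTrans _ 0)).mono ?_
      exact hscale _ le_rfl a (by simpa [Nat.lt_succ_iff] using ha)
    · have h1 : ∀ a ∈ Finset.range (L + 1),
          DerivBound 0 ((1 + c) ^ L * 2 ^ (l * (n : ℤ))) ((D (l + m) ^ a) η) := by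
        intro a ha
        refine (hη0.one_sub_convOp_pow' (by positivity) hc0
          (integral_norm_dilTrans ψ _).le).mono ?_
        gcongr
        · linarith
        · simpa [Nat.lt_succ_iff] using ha
      refine (DerivBound.sum h1).mono (le_of_eq ?_)
      rw [Finset.sum_const, Finset.card_range, nsmul_eq_mul, hC₁]
      push_cast
      ring
  -- the general term
  have hterm (i : ℕ) : ‖f ((D (l + m + i) ^ (L + 1)) η - (D (l + m + (i + 1 : ℕ)) ^ (L + 1)) η)‖ₑ ≤
      ENNReal.ofReal (C₂ * 2 ^ (l * (n : ℤ))) * ((2 : ℝ≥0∞) ^ (-(i * L : ℝ)) * I i +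
        (2 : ℝ≥0∞) ^ (-((i + 1 : ℕ) * L : ℝ)) * I (i + 1)) := by
    rw [one_sub_convOp_pow_sub, map_sub]
    set h := ∑ a ∈ Finset.range (L + 1), ((1 - convOp (dilTrans ψ (l + m + i) 0)) ^ a *
        (1 - convOp (dilTrans ψ (l + m + (i + 1 : ℕ)) 0)) ^ (L + 1 - 1 - a)) η with hh
    have hs : SuppIn z r h := by
      refine SuppIn.sum fun a ha => ?_
      have haL : a ≤ L := by simpa [Nat.lt_succ_iff] using ha
      refine (SuppIn.one_sub_convOp_pow_mul a _ hψ hR₀ (by push_cast; omega) hηs).mono ?_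
      exact hscale _ (by omega) _ (by omega)
    -- The bound is stated with the finer weight, index `i + 1`. It is relaxed by `hmono` for the
    -- piece averaged at index `i`.
    have hb : DerivBound 0 (C₂ * 2 ^ (l * (n : ℤ)) * 2 ^ (-(((i + 1 : ℕ) * L : ℕ) : ℤ))) h := by
      have h1 : ∀ a ∈ Finset.range (L + 1),
          DerivBound 0 ((n * c * (R₀ * 2 ^ (-(l + m + i : ℤ)))) ^ L *
            ((2 : ℝ) ^ (l * (n : ℤ)) * ((2 : ℝ) ^ l) ^ L))
            (((1 - convOp (dilTrans ψ (l + m + i) 0)) ^ a *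
              (1 - convOp (dilTrans ψ (l + m + (i + 1 : ℕ)) 0)) ^ (L + 1 - 1 - a)) η) := by
        intro a ha
        have haL : a ≤ L := by simpa [Nat.lt_succ_iff] using ha
        have h2 : a + (L + 1 - 1 - a) = L := by omega
        have h3 := DerivBound.one_sub_convOp_pow_mul (a := a) (b := L + 1 - 1 - a) hψ hψ1 hR₀
          (by positivity) (j := l + m + i) (k := l + m + (i + 1 : ℕ)) (by push_cast; omega)
          (h2.symm ▸ hηL)
        rwa [h2] at h3
      refine (DerivBound.sum h1).mono ?_
      rw [Finset.sum_const, Finset.card_range, nsmul_eq_mul, hC₂]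
      have h4 : (n * c * (R₀ * 2 ^ (-(l + m + i : ℤ)))) ^ L *
            ((2 : ℝ) ^ (l * (n : ℤ)) * ((2 : ℝ) ^ l) ^ L) =
          (n * c * (R₀ * 2)) ^ L * (2 : ℝ) ^ (l * (n : ℤ)) *
            ((2 : ℝ) ^ (-(m + 1 + i : ℤ))) ^ L := by
        have h5 : (2 : ℝ) ^ (-(l + m + i : ℤ)) * 2 ^ l = 2 * 2 ^ (-(m + 1 + i : ℤ)) := by
          rw [← zpow_add₀ two_ne_zero, ← zpow_one_add₀ two_ne_zero]
          congr 1
          ring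
        calc _ = (n * c * R₀ * ((2 : ℝ) ^ (-(l + m + i : ℤ)) * 2 ^ l)) ^ L *
              (2 : ℝ) ^ (l * (n : ℤ)) := by ring
          _ = _ := by rw [h5]; ring
      rw [h4]
      have h6 : ((2 : ℝ) ^ (-(m + 1 + i : ℤ))) ^ L ≤ 2 ^ (-(((i + 1 : ℕ) * L : ℕ) : ℤ)) := by
        rw [← zpow_natCast, ← zpow_mul]
        refine zpow_le_zpow_right₀ one_le_two ?_
        push_cast
        nlinarith [mul_nonneg (m.cast_nonneg (α := ℤ)) (L.cast_nonneg (α := ℤ))]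
      push_cast at h6 ⊢
      calc _ = (L + 1) * (n * c * (R₀ * 2)) ^ L * (2 : ℝ) ^ (l * (n : ℤ)) *
            ((2 : ℝ) ^ (-(m + 1 + i : ℤ))) ^ L := by ring
        _ ≤ _ := mul_le_mul_of_nonneg_left h6 (by positivity)
    have hw : ENNReal.ofReal (C₂ * 2 ^ (l * (n : ℤ)) * 2 ^ (-(((i + 1 : ℕ) * L : ℕ) : ℤ))) =
        ENNReal.ofReal (C₂ * 2 ^ (l * (n : ℤ))) * (2 : ℝ≥0∞) ^ (-((i + 1 : ℕ) * L : ℝ)) := by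
      rw [ENNReal.ofReal_mul (by positivity), ofReal_two_zpow]
      congr 2
      push_cast
      ring
    have hmono : (2 : ℝ≥0∞) ^ (-((i + 1 : ℕ) * L : ℝ)) ≤ (2 : ℝ≥0∞) ^ (-(i * L : ℝ)) := by
      refine ENNReal.rpow_le_rpow_of_exponent_le one_le_two ?_
      push_cast
      nlinarith [L.cast_nonneg (α := ℝ)]
    have h1 := enorm_apply_convOp_le f ψ h (l + m + (i + 1 : ℕ)) hs hb
    have h2 := enorm_apply_convOp_le f ψ h (l + m + i) hs hb
    rw [hw] at h1 h2
    generalize ENNReal.ofReal (C₂ * 2 ^ (l * (n : ℤ))) = E at h1 h2 ⊢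
    refine (enorm_sub_le).trans ((add_le_add h1 h2).trans ?_)
    rw [mul_assoc, mul_assoc, ← mul_add, add_comm]
    refine mul_le_mul_right ?_ _
    exact add_le_add (mul_le_mul_left hmono _) le_rfl
  have hpart (k : ℕ) : ‖f η‖ₑ ≤ ‖f ((D (l + m + k) ^ (L + 1)) η)‖ₑ +
      (ENNReal.ofReal (C₁ * 2 ^ (l * (n : ℤ))) * I 0 +
        ENNReal.ofReal (C₂ * 2 ^ (l * (n : ℤ))) * (∑ i ∈ Finset.range k,
          ((2 : ℝ≥0∞) ^ (-(i * L : ℝ)) * I i +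
            (2 : ℝ≥0∞) ^ (-((i + 1 : ℕ) * L : ℝ)) * I (i + 1)))) := by
    induction k with
    | zero =>
      have h1 : f η = f ((D (l + m + (0 : ℕ)) ^ (L + 1)) η) + f (η - (D (l + m) ^ (L + 1)) η) := by
        simp [map_sub]
      rw [h1]
      refine (enorm_add_le _ _).trans (add_le_add le_rfl ?_)
      simpa using hfirst
    | succ k ih =>
      refine ih.trans ?_
      have h1 : f ((D (l + m + k) ^ (L + 1)) η) =
          f ((D (l + m + (k + 1 : ℕ)) ^ (L + 1)) η) +
          f ((D (l + m + k) ^ (L + 1)) η - (D (l + m + (k + 1 : ℕ)) ^ (L + 1)) η) := by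
        simp [map_sub]
      have h2 := (enorm_add_le (f ((D (l + m + (k + 1 : ℕ)) ^ (L + 1)) η)) _).trans
        (add_le_add le_rfl (hterm k))
      rw [← h1] at h2
      refine (add_le_add h2 le_rfl).trans (le_of_eq ?_)
      rw [Finset.sum_range_succ]
      ring
  -- Let `k → ∞` in `hpart`. The initial term contributes one copy of `T`, and each of the two
  -- averages in the telescoped differences contributes another; hence the constant `C₁ + 2 C₂`.
  have hbound : ‖f η‖ₑ ≤ ENNReal.ofReal (C₁ * 2 ^ (l * (n : ℤ))) * T +
      ENNReal.ofReal (C₂ * 2 ^ (l * (n : ℤ))) * (T + T) := by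
    have hlim : Filter.Tendsto (fun k : ℕ => ‖f ((D (l + m + k) ^ (L + 1)) η)‖ₑ +
        (ENNReal.ofReal (C₁ * 2 ^ (l * (n : ℤ))) * T +
          ENNReal.ofReal (C₂ * 2 ^ (l * (n : ℤ))) * (T + T))) Filter.atTop
        (nhds (0 + (ENNReal.ofReal (C₁ * 2 ^ (l * (n : ℤ))) * T +
          ENNReal.ofReal (C₂ * 2 ^ (l * (n : ℤ))) * (T + T)))) := by
      refine Filter.Tendsto.add ?_ tendsto_const_nhds
      have := (tendsto_apply_one_sub_convOp_pow hψ hψ1 hR₀ f η (L + 1) (l + m)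
        (by omega) hηs).enorm
      simpa using this
    rw [zero_add] at hlim
    refine ge_of_tendsto' hlim fun k => (hpart k).trans (add_le_add le_rfl (add_le_add ?_ ?_))
    · refine mul_le_mul_right ?_ _
      have := ENNReal.le_tsum (f := fun i : ℕ => (2 : ℝ≥0∞) ^ (-(i * L : ℝ)) * I i) 0
      simpa using this
    · refine mul_le_mul_right ?_ _
      rw [Finset.sum_add_distrib]
      refine add_le_add (ENNReal.sum_le_tsum _) ?_
      refine (ENNReal.sum_le_tsum (f := fun i : ℕ =>
        (2 : ℝ≥0∞) ^ (-((i + 1 : ℕ) * L : ℝ)) * I (i + 1)) _).trans ?_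
      exact ENNReal.tsum_comp_le_tsum_of_injective (Nat.succ_injective)
        (fun i : ℕ => (2 : ℝ≥0∞) ^ (-(i * L : ℝ)) * I i)
  refine hbound.trans (le_of_eq ?_)
  rw [← two_mul, ENNReal.ofReal_mul hC₁0, ENNReal.ofReal_mul hC₂0, ofReal_two_zpow]
  change _ = ENNReal.ofReal _ * _ * _
  rw [ENNReal.ofReal_add hC₁0 (by positivity), ENNReal.ofReal_mul zero_le_two,
    ENNReal.ofReal_ofNat]
  ring

end Reproducing

/-! ### The sub-mean value property with small exponents -/

/-- The supremum of `|ψ_k * f|` over the scales `k ≥ l`. -/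
def tailMax (ψ : TestFun n) (f : Distr n) (l : ℤ) (w : Eucl n) : ℝ≥0∞ :=
  ⨆ i : ℕ, ‖conv ψ (l + i) f w‖ₑ

theorem enorm_conv_le_tailMax (ψ : TestFun n) (f : Distr n) {l k : ℤ} (h : l ≤ k) (w : Eucl n) :
    ‖conv ψ k f w‖ₑ ≤ tailMax ψ f l w := by
  obtain ⟨i, rfl⟩ := Int.le.dest h
  exact le_iSup (fun i : ℕ => ‖conv ψ (l + i) f w‖ₑ) i

theorem tailMax_anti (ψ : TestFun n) (f : Distr n) {l k : ℤ} (h : l ≤ k) (w : Eucl n) :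
    tailMax ψ f k w ≤ tailMax ψ f l w :=
  iSup_le fun _ => enorm_conv_le_tailMax ψ f (by omega) w

theorem two_rpow_ne_zero (x : ℝ) : (2 : ℝ≥0∞) ^ x ≠ 0 := by simp

theorem two_rpow_add (x y : ℝ) : (2 : ℝ≥0∞) ^ (x + y) = 2 ^ x * 2 ^ y :=
  ENNReal.rpow_add x y two_ne_zero ENNReal.ofNat_ne_top

theorem tsum_two_rpow_neg_le {a : ℝ} (ha : 1 ≤ a) :
    ∑' i : ℕ, (2 : ℝ≥0∞) ^ (-(i * a)) ≤ 2 := by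
  refine (ENNReal.tsum_le_tsum (g := fun i : ℕ => (2⁻¹ : ℝ≥0∞) ^ i) fun i => ?_).trans
    (le_of_eq ?_)
  · rw [← ENNReal.inv_pow, ← ENNReal.rpow_natCast, ← ENNReal.rpow_neg]
    refine ENNReal.rpow_le_rpow_of_exponent_le one_le_two ?_
    nlinarith [i.cast_nonneg (α := ℝ)]
  · rw [ENNReal.tsum_geometric, ENNReal.one_sub_inv_two, inv_inv]

section SubMean

variable {ψ : TestFun n} {R₀ : ℝ}

/-- The reproducing estimate for `ψ` itself, rescaled so that its derivatives are bounded by one. -/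
theorem exists_self_reproducing_estimate (hψ : SuppIn 0 R₀ ψ) (hψ1 : ∫ x, ψ x = 1) (hR₀ : 0 ≤ R₀)
    (L : ℕ) :
    ∃ C : ℝ≥0, ∀ m : ℕ, L + 1 ≤ m → ∀ (f : Distr n) (l : ℤ) (z : Eucl n),
      ‖conv ψ l f z‖ₑ ≤ C * (2 : ℝ≥0∞) ^ ((l * n : ℤ) : ℝ) *
        ∑' i : ℕ, (2 : ℝ≥0∞) ^ (-(i * L : ℝ)) *
          ∫⁻ w in Metric.ball z (2 * R₀ * 2 ^ (-l)), ‖conv ψ (l + m + i) f w‖ₑ := by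
  obtain ⟨B, hB0, hB⟩ := exists_derivBound ψ L
  obtain ⟨C, hC⟩ := exists_reproducing_estimate hψ hψ1 hR₀ (R₁ := R₀) L
  have hBc : ‖((B⁻¹ : ℝ) : ℂ)‖ * B = 1 := by
    rw [Complex.norm_real, Real.norm_of_nonneg (by positivity), inv_mul_cancel₀ hB0.ne']
  refine ⟨B.toNNReal * C, fun m hm f l z => ?_⟩
  have h1 := hC m hm f (((B⁻¹ : ℝ) : ℂ) • ψ) (fun x hx => hψ x fun h0 => hx (by
      change ((B⁻¹ : ℝ) : ℂ) * ψ x = 0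
      rw [h0, mul_zero]))
    (((hB 0 (Nat.zero_le _)).smul _).mono hBc.le) (((hB L le_rfl).smul _).mono hBc.le) l z
  have h2 : conv ψ l f z = (B : ℂ) * conv (((B⁻¹ : ℝ) : ℂ) • ψ) l f z := by
    rw [conv_smul, ← mul_assoc]
    push_cast
    rw [mul_inv_cancel₀ (by exact_mod_cast hB0.ne'), one_mul]
  rw [h2, enorm_mul]
  have h3 : ‖(B : ℂ)‖ₑ = (B.toNNReal : ℝ≥0∞) := by
    rw [← ofReal_norm, Complex.norm_real, Real.norm_of_nonneg hB0.le]
    rfl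
  rw [h3, ENNReal.coe_mul, mul_assoc, mul_assoc, ← two_mul] at *
  exact mul_le_mul_right (by simpa only [mul_assoc] using h1) _

/-- The sub-mean value estimate under an a priori growth bound. -/
theorem exists_rpow_le_of_growth (hψ : SuppIn 0 R₀ ψ) (hψ1 : ∫ x, ψ x = 1) (hR₀ : 0 ≤ R₀)
    {r t : ℝ} (hr0 : 0 < r) (hr1 : r ≤ 1) (hnt : n ≤ t * r) (m₀ : ℕ) :
    ∃ C : ℝ≥0, ∀ (f : Distr n) (j : ℤ) (y : Eucl n) (M : ℝ≥0∞), M ≠ ∞ →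
      (∀ (k : ℕ) (z : Eucl n), ‖z - y‖ ≤ 4 * R₀ * (2 ^ (-j) - 2 ^ (-(j + k))) →
        ‖conv ψ (j + k) f z‖ₑ ≤ M * (2 : ℝ≥0∞) ^ (k * t)) →
      ‖conv ψ j f y‖ₑ ^ r ≤ C * (2 : ℝ≥0∞) ^ ((j * n : ℤ) : ℝ) *
        ∫⁻ w in Metric.ball y (4 * R₀ * 2 ^ (-j)), tailMax ψ f (j + m₀) w ^ r := by
  obtain ⟨L, hL⟩ := exists_nat_ge (t + 1)
  obtain ⟨C, hC⟩ := exists_self_reproducing_estimate hψ hψ1 hR₀ L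
  -- Large enough for the reproducing estimate and also for every scale that occurs to be visible to
  -- `tailMax` from `j + m₀` on.
  set m := m₀ + L + 1 with hm
  have hC' : (C : ℝ≥0∞) * 2 ^ (m * (t * (1 - r))) * 2 ≠ ∞ := by finiteness
  refine ⟨((C : ℝ≥0∞) * 2 ^ (m * (t * (1 - r))) * 2).toNNReal, fun f j y M hM hgrowth => ?_⟩
  rw [ENNReal.coe_toNNReal hC']
  set J := ∫⁻ w in Metric.ball y (4 * R₀ * 2 ^ (-j)), tailMax ψ f (j + m₀) w ^ r with hJ
  -- The admissible radius grows with `k` so that moving from `z` by `2 R₀ 2^{-(j+k)}` lands in the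
  -- region allowed at the next index: half of `4 R₀ 2^{-(j+k)}` is still unused. Hence the supremum
  -- controls all averages that the estimate produces from its own members.
  set S : ℝ≥0∞ := ⨆ (k : ℕ) (z : Eucl n) (_ : ‖z - y‖ ≤ 4 * R₀ * (2 ^ (-j) - 2 ^ (-(j + k)))),
    (2 : ℝ≥0∞) ^ (-(k * t)) * ‖conv ψ (j + k) f z‖ₑ with hS
  have hSM : S ≤ M := by
    refine iSup_le fun k => iSup₂_le fun z hz => ?_
    refine (mul_le_mul_right (hgrowth k z hz) _).trans (le_of_eq ?_)
    rw [mul_left_comm, ← two_rpow_add, neg_add_cancel, ENNReal.rpow_zero, mul_one]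
  have hStop : S ≠ ∞ := ne_top_of_le_ne_top hM hSM
  have hle (k : ℕ) (z : Eucl n) (hz : ‖z - y‖ ≤ 4 * R₀ * (2 ^ (-j) - 2 ^ (-(j + k)))) :
      ‖conv ψ (j + k) f z‖ₑ ≤ S * 2 ^ (k * t) := by
    have h1 : (2 : ℝ≥0∞) ^ (-(k * t)) * ‖conv ψ (j + k) f z‖ₑ ≤ S :=
      le_iSup_of_le k (le_iSup₂_of_le z hz le_rfl)
    calc ‖conv ψ (j + k) f z‖ₑ
        = (2 : ℝ≥0∞) ^ (-(k * t)) * ‖conv ψ (j + k) f z‖ₑ * 2 ^ (k * t) := by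
          rw [mul_right_comm, ← two_rpow_add, neg_add_cancel, ENNReal.rpow_zero, one_mul]
      _ ≤ _ := mul_le_mul_left h1 _
  have h1r : 0 ≤ 1 - r := by linarith
  -- Write each value as `F^(1-r) F^r`, bounding the first factor by `S` and the second by
  -- `tailMax`. Since `L ≥ t + 1`, the sum over `i` converges with ratio at most one half.
  have hmain : S ≤ S ^ (1 - r) * ((C : ℝ≥0∞) * 2 ^ (m * (t * (1 - r))) * 2 *
      (2 : ℝ≥0∞) ^ ((j * n : ℤ) : ℝ) * J) := by
    refine iSup_le fun k => iSup₂_le fun z hz => ?_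
    have hI (i : ℕ) : ∫⁻ w in Metric.ball z (2 * R₀ * 2 ^ (-(j + k))), ‖conv ψ (j + k + m + i) f w‖ₑ ≤
        (S * 2 ^ ((k + m + i : ℕ) * t)) ^ (1 - r) * J := by
      have hfin : (S * 2 ^ ((k + m + i : ℕ) * t)) ^ (1 - r) ≠ ∞ := by finiteness
      rw [hJ, ← lintegral_const_mul' _ _ hfin, ← lintegral_indicator Metric.isOpen_ball.measurableSet,
        ← lintegral_indicator Metric.isOpen_ball.measurableSet]
      refine lintegral_mono fun w => ?_
      by_cases hw : w ∈ Metric.ball z (2 * R₀ * 2 ^ (-(j + k)))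
      · rw [indicator_of_mem hw]
        rw [Metric.mem_ball, dist_eq_norm] at hw
        have hp1 : (2 : ℝ) ^ (-(j + k) : ℤ) = 2 * 2 ^ (-(j + k + 1) : ℤ) := by
          rw [← zpow_one_add₀ two_ne_zero]
          congr 1
          ring
        have hp2 : (2 : ℝ) ^ (-(j + (k + m + i : ℕ)) : ℤ) ≤ 2 ^ (-(j + k + 1) : ℤ) :=
          zpow_le_zpow_right₀ one_le_two (by push_cast; omega)
        have hp3 : (0 : ℝ) < 2 ^ (-(j + k + 1) : ℤ) := by positivity
        have htri := norm_sub_le_norm_sub_add_norm_sub w z y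
        have hwy : ‖w - y‖ ≤ 4 * R₀ * (2 ^ (-j) - 2 ^ (-(j + (k + m + i : ℕ)))) := by
          have := mul_le_mul_of_nonneg_left hp2 hR₀
          rw [hp1] at hw hz
          linarith
        have hwb : w ∈ Metric.ball y (4 * R₀ * 2 ^ (-j)) := by
          have := mul_le_mul_of_nonneg_left hp3.le hR₀
          rw [Metric.mem_ball, dist_eq_norm]
          rw [hp1] at hw hz
          linarith
        rw [indicator_of_mem hwb]
        have hidx : j + k + m + i = j + (k + m + i : ℕ) := by push_cast; ring
        rw [hidx]
        have hF := hle _ w hwy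
        calc ‖conv ψ (j + (k + m + i : ℕ)) f w‖ₑ
            = ‖conv ψ (j + (k + m + i : ℕ)) f w‖ₑ ^ (1 - r) *
              ‖conv ψ (j + (k + m + i : ℕ)) f w‖ₑ ^ r := by
              rw [← ENNReal.rpow_add_of_nonneg _ _ h1r hr0.le, sub_add_cancel, ENNReal.rpow_one]
          _ ≤ _ := mul_le_mul' (ENNReal.rpow_le_rpow hF h1r)
              (ENNReal.rpow_le_rpow (enorm_conv_le_tailMax ψ f (by push_cast; omega) w) hr0.le)
      · rw [indicator_of_notMem hw]
        exact zero_le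
    have h2 := hC m (by omega) f (j + k) z
    have h3 : ∑' i : ℕ, (2 : ℝ≥0∞) ^ (-(i * L : ℝ)) *
        ∫⁻ w in Metric.ball z (2 * R₀ * 2 ^ (-(j + k))), ‖conv ψ (j + k + m + i) f w‖ₑ ≤
        S ^ (1 - r) * 2 ^ ((k + m : ℝ) * (t * (1 - r))) * J * 2 := by
      calc _ ≤ ∑' i : ℕ, S ^ (1 - r) * 2 ^ ((k + m : ℝ) * (t * (1 - r))) * J *
            2 ^ (-(i * (L - t * (1 - r)))) := by
            refine ENNReal.tsum_le_tsum fun i => ?_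
            refine (mul_le_mul_right (hI i) _).trans (le_of_eq ?_)
            rw [ENNReal.mul_rpow_of_nonneg _ _ h1r, ← ENNReal.rpow_mul]
            have : -(i * (L - t * (1 - r))) + (k + m : ℝ) * (t * (1 - r)) =
                -(i * L : ℝ) + (k + m + i : ℕ) * t * (1 - r) := by push_cast; ring
            calc _ = S ^ (1 - r) * (2 ^ (-(i * L : ℝ)) * 2 ^ ((k + m + i : ℕ) * t * (1 - r))) * J := by
                  ring
              _ = S ^ (1 - r) * (2 ^ (-(i * (L - t * (1 - r)))) *
                    2 ^ ((k + m : ℝ) * (t * (1 - r)))) * J := by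
                  rw [← two_rpow_add, ← two_rpow_add, this]
              _ = _ := by ring
        _ ≤ _ := by
            rw [ENNReal.tsum_mul_left]
            refine mul_le_mul_right (tsum_two_rpow_neg_le ?_) _
            nlinarith
    refine (mul_le_mul_right (h2.trans (mul_le_mul_right h3 _)) _).trans ?_
    -- The total coefficient of `k` in the exponent is `n - t r ≤ 0`, so the bound is uniform in
    -- `k`.
    have h4 : (2 : ℝ≥0∞) ^ (-(k * t) + (((j + k) * n : ℤ) : ℝ) + (k + m : ℝ) * (t * (1 - r))) ≤
        2 ^ (m * (t * (1 - r)) + ((j * n : ℤ) : ℝ)) := by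
      refine ENNReal.rpow_le_rpow_of_exponent_le one_le_two ?_
      push_cast
      nlinarith [mul_le_mul_of_nonneg_left hnt (k.cast_nonneg (α := ℝ))]
    rw [two_rpow_add, two_rpow_add, two_rpow_add] at h4
    calc _ = S ^ (1 - r) * (C * (2 ^ (-(k * t)) * 2 ^ ((((j + k) * n : ℤ) : ℝ)) *
          2 ^ ((k + m : ℝ) * (t * (1 - r)))) * 2 * J) := by ring
      _ ≤ S ^ (1 - r) * (C * (2 ^ (m * (t * (1 - r))) * 2 ^ ((j * n : ℤ) : ℝ)) * 2 * J) := by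
          gcongr
      _ = _ := by ring
  have hSr : S ^ r ≤ (C : ℝ≥0∞) * 2 ^ (m * (t * (1 - r))) * 2 *
      (2 : ℝ≥0∞) ^ ((j * n : ℤ) : ℝ) * J := by
    rcases eq_or_ne S 0 with h0 | h0
    · rw [h0, ENNReal.zero_rpow_of_pos hr0]
      exact zero_le
    -- Here finiteness of `S`, from the growth hypothesis, allows cancellation. The size of `M` does
    -- not enter the constant.
    · have hx0 : S ^ (1 - r) ≠ 0 := (ENNReal.rpow_pos (pos_iff_ne_zero.2 h0) hStop).ne'
      have hxt : S ^ (1 - r) ≠ ∞ := by finiteness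
      have hsplit : S = S ^ (1 - r) * S ^ r := by
        rw [← ENNReal.rpow_add_of_nonneg _ _ h1r hr0.le, sub_add_cancel, ENNReal.rpow_one]
      conv_lhs at hmain => rw [hsplit]
      exact (ENNReal.mul_le_mul_iff_right hx0 hxt).1 hmain
  refine (ENNReal.rpow_le_rpow ?_ hr0.le).trans hSr
  have := hle 0 y (by simp)
  simpa using this

/-- Distributions have locally at most polynomial growth in the inverse of the scale. -/
theorem exists_growth_bound (ψ : TestFun n) (f : Distr n) (j : ℤ) (y : Eucl n) (R : ℝ) :
    ∃ (t₀ : ℝ) (M : ℝ≥0), ∀ (k : ℕ) (z : Eucl n), ‖z - y‖ ≤ R →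
      ‖conv ψ (j + k) f z‖ₑ ≤ M * (2 : ℝ≥0∞) ^ (k * t₀) := by
  obtain ⟨R₀, hR₀, hψ⟩ := exists_suppIn 0 ψ
  obtain ⟨m, ℓ, hℓ⟩ := exists_extension_jet f y (R + R₀ * 2 ^ (-j))
  obtain ⟨B, hB0, hB⟩ := exists_derivBound ψ m
  set A : ℝ := ‖ℓ‖ * ((2 : ℝ) ^ (j * (n : ℤ)) * ((2 : ℝ) ^ |j|) ^ m * B) with hA
  -- Dilation costs `2^{(j+k)n}`, and each of at most `m` derivatives costs `2^{j+k}`. Using `|j|`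
  -- keeps the base at least one, so lower orders are dominated by order `m`.
  refine ⟨(n + m : ℕ), A.toNNReal, fun k z hz => ?_⟩
  have h1 : ‖conv ψ (j + k) f z‖ ≤ A * 2 ^ (k * (n + m)) := by
    rw [conv, hℓ]
    · refine (ℓ.le_opNorm _).trans ?_
      rw [hA, mul_assoc]
      refine mul_le_mul_of_nonneg_left (norm_jet_le (by positivity) fun i hi => ?_) (norm_nonneg _)
      refine ((hB i hi).dilTrans (j + k) z).mono ?_
      have h2 : (2 : ℝ) ^ ((j + k) * (n : ℤ)) = 2 ^ (j * (n : ℤ)) * 2 ^ (k * n) := by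
        rw [add_mul, zpow_add₀ two_ne_zero]
        congr 1
      have h3 : ((2 : ℝ) ^ (j + k)) ^ i ≤ ((2 : ℝ) ^ |j|) ^ m * 2 ^ (k * m) := by
        rw [pow_mul, ← mul_pow]
        have h4 : (2 : ℝ) ^ (j + k) ≤ 2 ^ |j| * 2 ^ k := by
          rw [zpow_add₀ two_ne_zero, zpow_natCast]
          gcongr
          · exact one_le_two
          · exact le_abs_self j
        have h5 : (1 : ℝ) ≤ 2 ^ |j| * 2 ^ k :=
          one_le_mul_of_one_le_of_one_le (one_le_zpow₀ one_le_two (abs_nonneg j))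
            (one_le_pow₀ one_le_two)
        exact (pow_le_pow_left₀ (by positivity) h4 i).trans (pow_le_pow_right₀ h5 hi)
      rw [h2, mul_add, pow_add]
      calc _ = 2 ^ (j * (n : ℤ)) * 2 ^ (k * n) * B * ((2 : ℝ) ^ (j + k)) ^ i := by ring
        _ ≤ 2 ^ (j * (n : ℤ)) * 2 ^ (k * n) * B * (((2 : ℝ) ^ |j|) ^ m * 2 ^ (k * m)) :=
          mul_le_mul_of_nonneg_left h3 (by positivity)
        _ = _ := by ring
    · intro x hx
      have h2 := (hψ.dilTrans (j + k) z) x hx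
      have h3 : R₀ * (2 : ℝ) ^ (-(j + k)) ≤ R₀ * 2 ^ (-j) := by
        gcongr
        · exact one_le_two
        · omega
      linarith [norm_sub_le_norm_sub_add_norm_sub x z y]
  rw [← ofReal_norm]
  refine (ENNReal.ofReal_le_ofReal h1).trans (le_of_eq ?_)
  rw [ENNReal.ofReal_mul (by positivity), ← zpow_natCast, ofReal_two_zpow]
  push_cast
  rfl

/-- The sub-mean value property of `|ψ_j * f|^r` for all `0 < r ≤ 1`. -/
theorem exists_rpow_le_lintegral_tailMax (hψ : SuppIn 0 R₀ ψ) (hψ1 : ∫ x, ψ x = 1) (hR₀ : 0 ≤ R₀)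
    {r : ℝ} (hr0 : 0 < r) (hr1 : r ≤ 1) (m₀ : ℕ) :
    ∃ C : ℝ≥0, ∀ (f : Distr n) (j : ℤ) (y : Eucl n),
      ‖conv ψ j f y‖ₑ ^ r ≤ C * (2 : ℝ≥0∞) ^ ((j * n : ℤ) : ℝ) *
        ∫⁻ w in Metric.ball y (4 * R₀ * 2 ^ (-j)), tailMax ψ f (j + m₀) w ^ r := by
  obtain ⟨C, hC⟩ := exists_rpow_le_of_growth hψ hψ1 hR₀ hr0 hr1 (t := n / r)
    (by rw [div_mul_cancel₀ _ hr0.ne']) m₀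
  -- A positive constant is needed so that the right side is infinite when `J` is.
  refine ⟨C + 1, fun f j y => ?_⟩
  set J := ∫⁻ w in Metric.ball y (4 * R₀ * 2 ^ (-j)), tailMax ψ f (j + m₀) w ^ r with hJ
  rcases eq_or_ne J ∞ with hJt | hJt
  · rw [hJt, ENNReal.mul_top (mul_ne_zero (by simp) (two_rpow_ne_zero _))]
    exact le_top
  obtain ⟨t₀, M, hM⟩ := exists_growth_bound ψ f j y (4 * R₀ * 2 ^ (-j))
  -- First pass: `t` and `C'` may depend on `f`, but with `J` finite they yield growth of exactly
  -- the rate `2^{k n / r}` with a finite constant. That is the a priori bound for the second pass,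
  -- whose constant `C` was fixed before `f`.
  set t := max t₀ (n / r) with ht
  obtain ⟨C', hC'⟩ := exists_rpow_le_of_growth hψ hψ1 hR₀ hr0 hr1 (t := t)
    ((div_le_iff₀ hr0).1 (le_max_right _ _)) m₀
  have hfin : (C' : ℝ≥0∞) * 2 ^ ((j * n : ℤ) : ℝ) * J ≠ ∞ := by finiteness
  have h1 := hC f j y (((C' : ℝ≥0∞) * 2 ^ ((j * n : ℤ) : ℝ) * J) ^ (1 / r)) (by finiteness) ?_
  · refine h1.trans ?_
    gcongr
    exact le_self_add
  intro k z hz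
  have hzk (q : ℝ) (hq : q ≤ 4 * R₀ * 2 ^ (-(j + k : ℤ))) (w : Eucl n) (hw : ‖w - z‖ ≤ q) :
      ‖w - y‖ ≤ 4 * R₀ * 2 ^ (-j) := by
    have := norm_sub_le_norm_sub_add_norm_sub w z y
    linarith
  have h2 := hC' f (j + k) z (M * 2 ^ (k * t)) (by finiteness) ?_
  · have hJk : ∫⁻ w in Metric.ball z (4 * R₀ * 2 ^ (-(j + k))), tailMax ψ f (j + k + m₀) w ^ r ≤ J := by
      refine (lintegral_mono fun w =>
        ENNReal.rpow_le_rpow (tailMax_anti ψ f (l := j + m₀) (by omega) w) hr0.le).trans ?_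
      refine lintegral_mono_set fun w hw => ?_
      rw [Metric.mem_ball, dist_eq_norm] at hw ⊢
      have := norm_sub_le_norm_sub_add_norm_sub w z y
      linarith
    have h3 := h2.trans (mul_le_mul_right hJk _)
    have h4 := ENNReal.rpow_le_rpow h3 (one_div_nonneg.2 hr0.le)
    rw [← ENNReal.rpow_mul, mul_one_div_cancel hr0.ne', ENNReal.rpow_one] at h4
    refine h4.trans (le_of_eq ?_)
    have h5 : (((j + k) * n : ℤ) : ℝ) = ((j * n : ℤ) : ℝ) + k * n := by push_cast; ring
    rw [h5, two_rpow_add]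
    have h6 : (C' : ℝ≥0∞) * (2 ^ ((j * n : ℤ) : ℝ) * 2 ^ ((k * n : ℝ))) * J =
        (C' : ℝ≥0∞) * 2 ^ ((j * n : ℤ) : ℝ) * J * 2 ^ ((k * n : ℝ)) := by ring
    rw [h6, ENNReal.mul_rpow_of_nonneg _ _ (one_div_nonneg.2 hr0.le), ← ENNReal.rpow_mul]
    congr 2
    ring
  · intro k' z' hz'
    have h7 : ‖z' - y‖ ≤ 4 * R₀ * 2 ^ (-j) := by
      refine hzk _ ?_ z' hz'
      refine mul_le_mul_of_nonneg_left ?_ (by positivity)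
      have : (0 : ℝ) < 2 ^ (-(j + k + k')) := by positivity
      linarith
    have h8 : j + k + k' = j + (k + k' : ℕ) := by push_cast; ring
    rw [h8]
    refine (hM (k + k') z' h7).trans ?_
    rw [mul_assoc, ← two_rpow_add]
    gcongr
    · exact one_le_two
    · rw [← add_mul]
      push_cast
      gcongr
      exact le_max_left _ _

end SubMean

/-! ### Pointwise domination of the grand maximal function -/

/-- The local centred maximal function over the balls `B(x, K 2^{-l})` with `2^{-l} < ρ(x)`. -/
def locMax (ρ : Eucl n → ℝ) (K : ℝ) (g : Eucl n → ℝ≥0∞) (x : Eucl n) : ℝ≥0∞ :=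
  ⨆ (l : ℤ) (_ : (2 : ℝ) ^ (-l) < ρ x),
    (∫⁻ y in Metric.ball x (K * 2 ^ (-l)), g y) / volume (Metric.ball x (K * 2 ^ (-l)))

theorem volume_ball_mul_two_zpow (x : Eucl n) {K : ℝ} (hK : 0 < K) (l : ℤ) :
    volume (Metric.ball x (K * 2 ^ (-l))) =
      ENNReal.ofReal (K ^ n) * volume (Metric.ball (0 : Eucl n) 1) *
        (2 : ℝ≥0∞) ^ (-((l * n : ℤ) : ℝ)) := by
  rw [Measure.addHaar_ball_of_pos _ _ (by positivity), finrank_euclideanSpace, Fintype.card_fin, mul_pow,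
    ENNReal.ofReal_mul (by positivity), ← zpow_natCast ((2 : ℝ) ^ (-l)), ← zpow_mul, ofReal_two_zpow]
  push_cast
  rw [mul_right_comm, neg_mul]

/-- Slow variation: within distance `K ρ(x)` the factor `(1 + |x - y| / ρ(x))^(-k₀)` is at least `(1
+ K)^(-k₀)`. -/
theorem IsCriticalRadius.exists_pos_mul_le {ρ : Eucl n → ℝ} (hρ : IsCriticalRadius ρ) {K : ℝ}
    (hK : 0 ≤ K) : ∃ ε : ℝ, 0 < ε ∧ ∀ x y : Eucl n, ‖x - y‖ ≤ K * ρ x → ε * ρ x ≤ ρ y := by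
  obtain ⟨-, hpos, C₀, k₀, hC₀, hk₀, h⟩ := hρ
  refine ⟨C₀⁻¹ * (1 + K) ^ (-k₀), by positivity, fun x y hxy => le_trans ?_ (h x y).1⟩
  have h1 : ‖x - y‖ / ρ x ≤ K := (div_le_iff₀ (hpos x)).2 hxy
  have h2 : 0 ≤ ‖x - y‖ / ρ x := div_nonneg (norm_nonneg _) (hpos x).le
  have h3 : (1 + K) ^ (-k₀) ≤ (1 + ‖x - y‖ / ρ x) ^ (-k₀) :=
    Real.rpow_le_rpow_of_nonpos (by linarith) (by linarith) (by linarith)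
  have h4 : 0 ≤ C₀⁻¹ * ρ x := mul_nonneg (by positivity) (hpos x).le
  calc _ = C₀⁻¹ * ρ x * (1 + K) ^ (-k₀) := by ring
    _ ≤ _ := mul_le_mul_of_nonneg_left h3 h4

theorem tsum_two_rpow_neg_ne_top {a : ℝ} (ha : 0 < a) :
    ∑' i : ℕ, (2 : ℝ≥0∞) ^ (-(i * a)) ≠ ∞ := by
  have h1 (i : ℕ) : (2 : ℝ≥0∞) ^ (-(i * a)) = ((2 : ℝ≥0∞) ^ (-a)) ^ i := by
    rw [← ENNReal.rpow_natCast, ← ENNReal.rpow_mul]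
    congr 1
    ring
  simp_rw [h1]
  rw [ENNReal.tsum_geometric, ENNReal.inv_ne_top, Ne, tsub_eq_zero_iff_le, not_le]
  exact ENNReal.rpow_lt_one_of_one_lt_of_neg ENNReal.one_lt_two (by linarith)

/-- Insert the sub-mean value inequality into the reproducing estimate with `L = N`. The former
costs `2^{i n / r}` and the latter gains `2^{-iN}`, so `N > n / r` sums the series; the remaining
powers of `2^l` cancel. -/
theorem exists_grandNontan_le_locMax {ρ : Eucl n → ℝ} (hρ : IsCriticalRadius ρ) {ψ : TestFun n}
    (hψ1 : ∫ x, ψ x = 1) {N : ℕ} {R₁ r : ℝ} (hR₁ : 0 ≤ R₁) (hr0 : 0 < r) (hr1 : r ≤ 1)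
    (hN : n < N * r) :
    ∃ (C : ℝ≥0) (K : ℝ), 0 < K ∧ ∀ (f : Distr n) (x : Eucl n),
      grandNontan ρ N R₁ f x ≤ C * locMax ρ K (fun w => vertMax ρ ψ f w ^ r) x ^ (1 / r) := by
  obtain ⟨R₀, hR₀, hψ⟩ := exists_suppIn 0 ψ
  -- In units of `2^{-l}`: the aperture `x` to `z`, then the reproducing ball around `z`, then the
  -- sub-mean value ball around `w`.
  set K : ℝ := 1 + R₀ + R₁ + 4 * R₀ with hK
  have hK0 : 0 < K := by positivity
  obtain ⟨ε, hε0, hε⟩ := hρ.exists_pos_mul_le hK0.le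
  -- `vertMax` at a nearby `v` sees only scales below `ρ(v)`, which may be smaller than `ρ(x)` by
  -- the factor `ε`. Skipping `m₀` dyadic scales restores admissibility.
  obtain ⟨m₀, hm₀⟩ := exists_pow_lt_of_lt_one hε0 (by norm_num : (1 / 2 : ℝ) < 1)
  obtain ⟨C₁, hC₁⟩ := exists_reproducing_estimate hψ hψ1 hR₀.le (R₁ := R₁) N
  obtain ⟨C₂, hC₂⟩ := exists_rpow_le_lintegral_tailMax hψ hψ1 hR₀.le hr0 hr1 m₀
  set V : ℝ≥0∞ := volume (Metric.ball (0 : Eucl n) 1) with hV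
  have hVtop : V ≠ ∞ := measure_ball_lt_top.ne
  set T : ℝ≥0∞ := ∑' i : ℕ, (2 : ℝ≥0∞) ^ (-(i * (N - n / r))) with hT
  have hTtop : T ≠ ∞ := tsum_two_rpow_neg_ne_top (by
    rw [sub_pos, div_lt_iff₀ hr0]
    exact hN)
  have hrinv : 0 ≤ 1 / r := by positivity
  set A : ℝ≥0∞ := C₁ * (ENNReal.ofReal ((R₀ + R₁) ^ n) * V) *
    ((C₂ : ℝ≥0∞) * (ENNReal.ofReal (K ^ n) * V)) ^ (1 / r) * 2 ^ ((N + 1 : ℕ) * (n / r)) * T with hA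
  have hAtop : A ≠ ∞ := by finiteness
  refine ⟨A.toNNReal, K, hK0, fun f x => ?_⟩
  rw [ENNReal.coe_toNNReal hAtop]
  refine iSup₂_le fun l hl => iSup₂_le fun z hz => iSup₂_le fun φ hφ => ?_
  have hφ' := mem_testClass_iff.1 hφ
  set g : Eucl n → ℝ≥0∞ := fun w => vertMax ρ ψ f w ^ r with hg
  set J := ∫⁻ v in Metric.ball x (K * 2 ^ (-l)), g v with hJ
  have h2l : (0 : ℝ) < 2 ^ (-l) := by positivity
  have htail (j : ℤ) (hj : l ≤ j) (v : Eucl n) (hv : v ∈ Metric.ball x (K * 2 ^ (-l))) :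
      tailMax ψ f (j + m₀) v ≤ vertMax ρ ψ f v := by
    rw [Metric.mem_ball, dist_comm, dist_eq_norm] at hv
    have h1 := hε x v (hv.le.trans (mul_le_mul_of_nonneg_left hl.le hK0.le))
    refine iSup_le fun i => ?_
    refine le_iSup₂_of_le (j + m₀ + i) ?_ le_rfl
    refine lt_of_lt_of_le ?_ h1
    calc (2 : ℝ) ^ (-(j + m₀ + i)) ≤ 2 ^ (-(l + m₀)) :=
          zpow_le_zpow_right₀ one_le_two (by omega)
      _ = (1 / 2) ^ m₀ * 2 ^ (-l) := by
          rw [neg_add, zpow_add₀ two_ne_zero, zpow_neg _ (m₀ : ℤ), zpow_natCast, one_div, inv_pow,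
            mul_comm]
      _ < ε * ρ x := by
          refine mul_lt_mul'' hm₀ hl (by positivity) h2l.le
  have hF (i : ℕ) (w : Eucl n) (hw : w ∈ Metric.ball z ((R₀ + R₁) * 2 ^ (-l))) :
      ‖conv ψ (l + (N + 1 : ℕ) + i) f w‖ₑ ≤
        ((C₂ : ℝ≥0∞) * J) ^ (1 / r) * 2 ^ (((l + (N + 1 : ℕ) + i : ℤ) : ℝ) * (n / r)) := by
    have h1 := hC₂ f (l + (N + 1 : ℕ) + i) w
    have h2 : ∫⁻ v in Metric.ball w (4 * R₀ * 2 ^ (-(l + (N + 1 : ℕ) + i))),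
        tailMax ψ f (l + (N + 1 : ℕ) + i + m₀) v ^ r ≤ J := by
      have hsub : Metric.ball w (4 * R₀ * 2 ^ (-(l + (N + 1 : ℕ) + i))) ⊆
          Metric.ball x (K * 2 ^ (-l)) := by
        intro v hv
        rw [Metric.mem_ball, dist_eq_norm] at hv hw ⊢
        have h3 : (2 : ℝ) ^ (-(l + (N + 1 : ℕ) + i)) ≤ 2 ^ (-l) :=
          zpow_le_zpow_right₀ one_le_two (by push_cast; omega)
        have h4 := mul_le_mul_of_nonneg_left h3 (by positivity : 0 ≤ 4 * R₀)
        have h5 := norm_sub_le_norm_sub_add_norm_sub v w x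
        have h6 := norm_sub_le_norm_sub_add_norm_sub w z x
        rw [norm_sub_rev] at hz
        rw [hK]
        linarith
      refine (lintegral_mono_set hsub).trans ?_
      refine setLIntegral_mono' Metric.isOpen_ball.measurableSet fun v hv => ?_
      exact ENNReal.rpow_le_rpow (htail _ (by push_cast; omega) v hv) hr0.le
    have h3 := ENNReal.rpow_le_rpow (h1.trans (mul_le_mul_right h2 _)) hrinv
    rw [← ENNReal.rpow_mul, mul_one_div_cancel hr0.ne', ENNReal.rpow_one, mul_right_comm,
      ENNReal.mul_rpow_of_nonneg _ _ hrinv, ← ENNReal.rpow_mul] at h3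
    refine h3.trans (le_of_eq ?_)
    congr 2
    push_cast
    ring
  have hI (i : ℕ) : ∫⁻ w in Metric.ball z ((R₀ + R₁) * 2 ^ (-l)),
      ‖conv ψ (l + (N + 1 : ℕ) + i) f w‖ₑ ≤
      ((C₂ : ℝ≥0∞) * J) ^ (1 / r) * 2 ^ (((l + (N + 1 : ℕ) + i : ℤ) : ℝ) * (n / r)) *
        (ENNReal.ofReal ((R₀ + R₁) ^ n) * V * 2 ^ (-((l * n : ℤ) : ℝ))) := by
    rw [← volume_ball_mul_two_zpow z (by positivity)]
    refine (setLIntegral_mono' Metric.isOpen_ball.measurableSet (hF i)).trans (le_of_eq ?_)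
    rw [setLIntegral_const]
  have hJle : J ≤ locMax ρ K g x * (ENNReal.ofReal (K ^ n) * V * 2 ^ (-((l * n : ℤ) : ℝ))) := by
    rw [← volume_ball_mul_two_zpow x hK0]
    have h1 : J / volume (Metric.ball x (K * 2 ^ (-l))) ≤ locMax ρ K g x :=
      le_iSup₂_of_le (f := fun (l : ℤ) (_ : (2 : ℝ) ^ (-l) < ρ x) =>
        (∫⁻ y in Metric.ball x (K * 2 ^ (-l)), g y) / volume (Metric.ball x (K * 2 ^ (-l))))
        l hl le_rfl
    rw [ENNReal.div_le_iff (Metric.measure_ball_pos _ _ (by positivity)).ne'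
      measure_ball_lt_top.ne] at h1
    exact h1
  refine (hC₁ (N + 1) le_rfl f φ (suppIn_of_tsupport_subset hφ'.1) (hφ'.2 0 (Nat.zero_le _))
    (hφ'.2 N le_rfl) l z).trans ?_
  have hsum : ∑' i : ℕ, (2 : ℝ≥0∞) ^ (-(i * N : ℝ)) *
      ∫⁻ w in Metric.ball z ((R₀ + R₁) * 2 ^ (-l)), ‖conv ψ (l + (N + 1 : ℕ) + i) f w‖ₑ ≤
      ((C₂ : ℝ≥0∞) * J) ^ (1 / r) * 2 ^ ((l + (N + 1 : ℕ) : ℝ) * (n / r)) *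
        (ENNReal.ofReal ((R₀ + R₁) ^ n) * V * 2 ^ (-((l * n : ℤ) : ℝ))) * T := by
    rw [hT, ← ENNReal.tsum_mul_left]
    refine ENNReal.tsum_le_tsum fun i => (mul_le_mul_right (hI i) _).trans (le_of_eq ?_)
    have : -(i * N : ℝ) + ((l + (N + 1 : ℕ) + i : ℤ) : ℝ) * (n / r) =
        (l + (N + 1 : ℕ) : ℝ) * (n / r) + -(i * (N - n / r)) := by push_cast; ring
    calc _ = ((C₂ : ℝ≥0∞) * J) ^ (1 / r) *
          (2 ^ (-(i * N : ℝ)) * 2 ^ (((l + (N + 1 : ℕ) + i : ℤ) : ℝ) * (n / r))) *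
          (ENNReal.ofReal ((R₀ + R₁) ^ n) * V * 2 ^ (-((l * n : ℤ) : ℝ))) := by ring
      _ = _ := by
        rw [← two_rpow_add, this, two_rpow_add]
        ring
  have hJr : ((C₂ : ℝ≥0∞) * J) ^ (1 / r) ≤ locMax ρ K g x ^ (1 / r) *
      (((C₂ : ℝ≥0∞) * (ENNReal.ofReal (K ^ n) * V)) ^ (1 / r) * 2 ^ (-(l * (n / r)))) := by
    have h1 := ENNReal.rpow_le_rpow (mul_le_mul_right hJle (C₂ : ℝ≥0∞)) hrinv
    refine h1.trans (le_of_eq ?_)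
    have h2 : (C₂ : ℝ≥0∞) * (locMax ρ K g x *
        (ENNReal.ofReal (K ^ n) * V * 2 ^ (-((l * n : ℤ) : ℝ)))) =
        locMax ρ K g x * ((C₂ : ℝ≥0∞) * (ENNReal.ofReal (K ^ n) * V) *
          2 ^ (-((l * n : ℤ) : ℝ))) := by ring
    rw [h2, ENNReal.mul_rpow_of_nonneg _ _ hrinv, ENNReal.mul_rpow_of_nonneg _ _ hrinv,
      ← ENNReal.rpow_mul]
    congr 3
    push_cast
    ring
  calc _ ≤ (C₁ : ℝ≥0∞) * 2 ^ ((l * n : ℤ) : ℝ) * (locMax ρ K g x ^ (1 / r) *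
        (((C₂ : ℝ≥0∞) * (ENNReal.ofReal (K ^ n) * V)) ^ (1 / r) * 2 ^ (-(l * (n / r)))) *
        2 ^ ((l + (N + 1 : ℕ) : ℝ) * (n / r)) *
        (ENNReal.ofReal ((R₀ + R₁) ^ n) * V * 2 ^ (-((l * n : ℤ) : ℝ))) * T) := by
        refine mul_le_mul_right (hsum.trans ?_) _
        gcongr
    _ = C₁ * (ENNReal.ofReal ((R₀ + R₁) ^ n) * V) *
        ((C₂ : ℝ≥0∞) * (ENNReal.ofReal (K ^ n) * V)) ^ (1 / r) *
        (2 ^ ((l * n : ℤ) : ℝ) * 2 ^ (-((l * n : ℤ) : ℝ))) *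
        (2 ^ (-(l * (n / r))) * 2 ^ ((l + (N + 1 : ℕ) : ℝ) * (n / r))) * T *
        locMax ρ K g x ^ (1 / r) := by ring
    _ = _ := by
        rw [← two_rpow_add, ← two_rpow_add, add_neg_cancel, ENNReal.rpow_zero, mul_one, hA]
        congr 4
        ring

/-! ### Weighted estimates for the local maximal function -/

/-- The measure `ω dx`. -/
def wMeasure (ω : Eucl n → ℝ) : Measure (Eucl n) :=
  volume.withDensity fun x => ENNReal.ofReal (ω x)

theorem IsWeight.aemeasurable {ω : Eucl n → ℝ} (hω : IsWeight ω) :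
    AEMeasurable (fun x => ENNReal.ofReal (ω x)) :=
  hω.1.aestronglyMeasurable.aemeasurable.ennreal_ofReal

theorem wMeasure_ball (ω : Eucl n → ℝ) (x : Eucl n) (t : ℝ) :
    wMeasure ω (Metric.ball x t) = ∫⁻ y in Metric.ball x t, ENNReal.ofReal (ω y) :=
  withDensity_apply _ Metric.isOpen_ball.measurableSet

theorem IsWeight.wMeasure_ball_ne_top {ω : Eucl n → ℝ} (hω : IsWeight ω) (x : Eucl n) (t : ℝ) :
    wMeasure ω (Metric.ball x t) ≠ ∞ := by
  rw [wMeasure_ball]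
  have h1 : IntegrableOn ω (Metric.ball x t) :=
    (hω.1.integrableOn_isCompact (isCompact_closedBall x t)).mono_set Metric.ball_subset_closedBall
  refine ne_top_of_le_ne_top h1.2.ne (lintegral_mono fun y => ?_)
  rw [← ofReal_norm]
  exact ENNReal.ofReal_le_ofReal (Real.le_norm_self _)

theorem IsWeight.lintegral_wMeasure {ω : Eucl n → ℝ} (hω : IsWeight ω) {g : Eucl n → ℝ≥0∞}
    (hg : AEMeasurable g) :
    ∫⁻ x, g x ∂(wMeasure ω) = ∫⁻ x, g x * ENNReal.ofReal (ω x) := by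
  rw [wMeasure, lintegral_withDensity_eq_lintegral_mul₀ hω.aemeasurable hg]
  simp [mul_comm]

theorem IsWeight.setLIntegral_wMeasure {ω : Eucl n → ℝ} (hω : IsWeight ω) {g : Eucl n → ℝ≥0∞}
    (hg : AEMeasurable g) (x : Eucl n) (t : ℝ) :
    ∫⁻ y in Metric.ball x t, g y ∂(wMeasure ω) =
      ∫⁻ y in Metric.ball x t, g y * ENNReal.ofReal (ω y) := by
  rw [wMeasure, restrict_withDensity Metric.isOpen_ball.measurableSet,
    lintegral_withDensity_eq_lintegral_mul₀ hω.aemeasurable.restrict hg.restrict]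
  simp [mul_comm]

theorem MemAp.isWeight {ρ ω : Eucl n → ℝ} {q : ℝ} (h : MemAp ρ q ω) : IsWeight ω := by
  obtain ⟨θ, -, ⟨-, h⟩ | ⟨-, h⟩⟩ := h
  · exact h.1
  · exact h.1

/-- On balls of radius comparable to at most `ρ`, the factor `Ψ_θ` is harmless and the conditions
become the classical ones. -/
theorem psiVol_le {ρ : Eucl n → ℝ} {θ κ : ℝ} (hθ : 0 ≤ θ) {x : Eucl n} {t : ℝ} (hρ : 0 < ρ x)
    (ht : 0 < t) (htκ : t ≤ κ * ρ x) :
    psiVol ρ θ x t ≤ ENNReal.ofReal ((1 + κ) ^ θ) * volume (Metric.ball x t) := by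
  refine mul_le_mul_left (ENNReal.ofReal_le_ofReal ?_) _
  refine Real.rpow_le_rpow (by positivity) ?_ hθ
  have : t / ρ x ≤ κ := (div_le_iff₀ hρ).2 htκ
  linarith

theorem psiVol_ne_zero {ρ : Eucl n → ℝ} {θ : ℝ} {x : Eucl n} {t : ℝ} (hρ : 0 < ρ x) (ht : 0 < t) :
    psiVol ρ θ x t ≠ 0 :=
  mul_ne_zero (ENNReal.ofReal_pos.2 (by positivity)).ne' (Metric.measure_ball_pos _ _ ht).ne'

theorem psiVol_ne_top {ρ : Eucl n → ℝ} {θ : ℝ} {x : Eucl n} {t : ℝ} : psiVol ρ θ x t ≠ ∞ :=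
  ENNReal.mul_ne_top ENNReal.ofReal_ne_top measure_ball_lt_top.ne

/-- For almost every `y` in the ball, the `A_1` condition bounds `ω(B)` by a multiple of `|B| ω(y)`;
multiply by `g y` and integrate. -/
theorem MemA1.exists_local_bound {ρ ω : Eucl n → ℝ} (hρ : ∀ x, 0 < ρ x) {θ : ℝ} (hθ : 0 ≤ θ)
    (hω : MemA1 ρ θ ω) (κ : ℝ) :
    ∃ C : ℝ≥0, ∀ (x : Eucl n) (t : ℝ), 0 < t → t ≤ κ * ρ x → ∀ g : Eucl n → ℝ≥0∞,
      (∫⁻ y in Metric.ball x t, g y) * wMeasure ω (Metric.ball x t) ≤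
        C * volume (Metric.ball x t) * ∫⁻ y in Metric.ball x t, g y * ENNReal.ofReal (ω y) := by
  obtain ⟨hw, C, hC⟩ := hω
  refine ⟨C * ((1 + κ) ^ θ).toNNReal, fun x t ht htκ g => ?_⟩
  have hP0 : psiVol ρ θ x t ≠ 0 := psiVol_ne_zero (hρ x) ht
  have h1 : ∀ᵐ y, y ∈ Metric.ball x t →
      wMeasure ω (Metric.ball x t) ≤ C * ENNReal.ofReal (ω y) * psiVol ρ θ x t := by
    filter_upwards [hC] with y hy hyB
    have h2 : (∫⁻ y in Metric.ball x t, ‖ω y‖ₑ) / psiVol ρ θ x t ≤ maxFun ρ θ ω y :=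
      le_iSup_of_le x (le_iSup_of_le t (le_iSup₂_of_le ht hyB le_rfl))
    have h3 := (ENNReal.div_le_iff hP0 psiVol_ne_top).1 (h2.trans hy)
    refine le_trans ?_ h3
    rw [wMeasure_ball]
    refine lintegral_mono fun y => ?_
    rw [← ofReal_norm]
    exact ENNReal.ofReal_le_ofReal (Real.le_norm_self _)
  rw [← lintegral_mul_const' _ _ (hw.wMeasure_ball_ne_top x t)]
  calc ∫⁻ y in Metric.ball x t, g y * wMeasure ω (Metric.ball x t)
      ≤ ∫⁻ y in Metric.ball x t, C * psiVol ρ θ x t * (g y * ENNReal.ofReal (ω y)) := by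
        refine lintegral_mono_ae ((ae_restrict_iff' Metric.isOpen_ball.measurableSet).2 ?_)
        filter_upwards [h1] with y hy hyB
        refine (mul_le_mul_right (hy hyB) _).trans (le_of_eq (by ring))
    _ = C * psiVol ρ θ x t * ∫⁻ y in Metric.ball x t, g y * ENNReal.ofReal (ω y) :=
        lintegral_const_mul' _ _ (ENNReal.mul_ne_top ENNReal.coe_ne_top psiVol_ne_top)
    _ ≤ _ := by
        refine mul_le_mul_left ?_ _
        rw [ENNReal.coe_mul, mul_assoc]
        exact mul_le_mul_right (psiVol_le hθ (hρ x) ht htκ) _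

/-- Hölder applied to `g = (g ω^(1/q)) ω^(-1/q)`. The second factor produces the integral of the
dual weight `ω^(-1/(q-1))`, which the `A_q` condition pairs with `ω(B)`. -/
theorem MemApGt.exists_local_bound {ρ ω : Eucl n → ℝ} (hρ : ∀ x, 0 < ρ x) {θ q : ℝ} (hθ : 0 ≤ θ)
    (hq : 1 < q) (hω : MemApGt ρ q θ ω) (κ : ℝ) :
    ∃ C : ℝ≥0, ∀ (x : Eucl n) (t : ℝ), 0 < t → t ≤ κ * ρ x → ∀ g : Eucl n → ℝ≥0∞, Measurable g →
      (∫⁻ y in Metric.ball x t, g y) ^ q * wMeasure ω (Metric.ball x t) ≤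
        C * volume (Metric.ball x t) ^ q *
          ∫⁻ y in Metric.ball x t, g y ^ q * ENNReal.ofReal (ω y) := by
  obtain ⟨hw, C, hC⟩ := hω
  have hfin : (C : ℝ≥0∞) * ENNReal.ofReal ((1 + κ) ^ θ) ^ q ≠ ∞ :=
    ENNReal.mul_ne_top ENNReal.coe_ne_top
      (ENNReal.rpow_ne_top_of_nonneg (by linarith) ENNReal.ofReal_ne_top)
  refine ⟨((C : ℝ≥0∞) * ENNReal.ofReal ((1 + κ) ^ θ) ^ q).toNNReal, fun x t ht htκ g hg => ?_⟩
  rw [ENNReal.coe_toNNReal hfin]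
  have hq0 : 0 < q := by linarith
  have hq1 : 0 < q - 1 := by linarith
  set P := psiVol ρ θ x t with hP
  have hP0 : P ≠ 0 := psiVol_ne_zero (hρ x) ht
  have hPt : P ≠ ∞ := psiVol_ne_top
  set U : Eucl n → ℝ≥0∞ := fun y => ENNReal.ofReal (ω y ^ (-(1 / (q - 1)))) with hU
  set W : Eucl n → ℝ≥0∞ := fun y => ENNReal.ofReal (ω y) with hW
  have hUm : AEMeasurable U :=
    (hw.1.aestronglyMeasurable.aemeasurable.pow_const _).ennreal_ofReal
  have hpq : q.HolderConjugate (q / (q - 1)) := Real.HolderConjugate.conjExponent hq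
  have hholder : (∫⁻ y in Metric.ball x t, g y) ≤
      (∫⁻ y in Metric.ball x t, g y ^ q * W y) ^ (1 / q) *
        (∫⁻ y in Metric.ball x t, U y) ^ ((q - 1) / q) := by
    have h1 := ENNReal.lintegral_mul_le_Lp_mul_Lq (volume.restrict (Metric.ball x t)) hpq
      (f := fun y => g y * W y ^ (1 / q)) (g := fun y => U y ^ ((q - 1) / q))
      (hg.aemeasurable.mul (hw.aemeasurable.restrict.pow_const _)) (hUm.restrict.pow_const _)
    have h2 (y : Eucl n) : (g y * W y ^ (1 / q)) ^ q = g y ^ q * W y := by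
      rw [ENNReal.mul_rpow_of_nonneg _ _ hq0.le, ← ENNReal.rpow_mul, one_div_mul_cancel hq0.ne',
        ENNReal.rpow_one]
    have h3 (y : Eucl n) : (U y ^ ((q - 1) / q)) ^ (q / (q - 1)) = U y := by
      rw [← ENNReal.rpow_mul, div_mul_div_cancel₀ hq0.ne', div_self hq1.ne', ENNReal.rpow_one]
    simp only [h2, h3, one_div_div] at h1
    refine le_trans (lintegral_mono_ae ?_) h1
    refine ae_restrict_of_ae ?_
    filter_upwards [hw.2] with y hy
    have h4 : W y ^ (1 / q) * U y ^ ((q - 1) / q) = 1 := by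
      simp only [hW, hU]
      rw [ENNReal.ofReal_rpow_of_pos hy, ENNReal.ofReal_rpow_of_pos (by positivity),
        ← ENNReal.ofReal_mul (by positivity), ← Real.rpow_mul hy.le, ← Real.rpow_add hy]
      have : 1 / q + -(1 / (q - 1)) * ((q - 1) / q) = 0 := by
        field_simp
        ring
      rw [this, Real.rpow_zero, ENNReal.ofReal_one]
    simp only [Pi.mul_apply]
    rw [mul_assoc, h4, mul_one]
  have hq' : (∫⁻ y in Metric.ball x t, g y) ^ q ≤
      (∫⁻ y in Metric.ball x t, g y ^ q * W y) * (∫⁻ y in Metric.ball x t, U y) ^ (q - 1) := by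
    refine (ENNReal.rpow_le_rpow hholder hq0.le).trans (le_of_eq ?_)
    rw [ENNReal.mul_rpow_of_nonneg _ _ hq0.le, ← ENNReal.rpow_mul, ← ENNReal.rpow_mul,
      one_div_mul_cancel hq0.ne', ENNReal.rpow_one, div_mul_cancel₀ _ hq0.ne']
  have hAq : (∫⁻ y in Metric.ball x t, U y) ^ (q - 1) * wMeasure ω (Metric.ball x t) ≤ C * P ^ q := by
    have h1 := hC x t ht
    rw [ENNReal.div_rpow_of_nonneg _ _ hq1.le, ← wMeasure_ball] at h1
    have hPq0 : P ^ (q - 1) ≠ 0 := (ENNReal.rpow_pos (pos_iff_ne_zero.2 hP0) hPt).ne'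
    have hPqt : P ^ (q - 1) ≠ ∞ := ENNReal.rpow_ne_top_of_nonneg hq1.le hPt
    have hPq : P ^ q = P * P ^ (q - 1) := by
      conv_rhs => rw [← ENNReal.rpow_one P]
      rw [← ENNReal.rpow_mul, one_mul, ← ENNReal.rpow_add _ _ hP0 hPt, add_sub_cancel]
    calc (∫⁻ y in Metric.ball x t, U y) ^ (q - 1) * wMeasure ω (Metric.ball x t)
        = (wMeasure ω (Metric.ball x t) / P * P) *
            ((∫⁻ y in Metric.ball x t, U y) ^ (q - 1) / P ^ (q - 1) * P ^ (q - 1)) := by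
          rw [ENNReal.div_mul_cancel hP0 hPt, ENNReal.div_mul_cancel hPq0 hPqt, mul_comm]
      _ = (wMeasure ω (Metric.ball x t) / P *
            ((∫⁻ y in Metric.ball x t, U y) ^ (q - 1) / P ^ (q - 1))) * (P * P ^ (q - 1)) := by
          ring
      _ ≤ C * (P * P ^ (q - 1)) := mul_le_mul_left h1 _
      _ = _ := by rw [hPq]
  calc (∫⁻ y in Metric.ball x t, g y) ^ q * wMeasure ω (Metric.ball x t)
      ≤ (∫⁻ y in Metric.ball x t, g y ^ q * W y) * ((∫⁻ y in Metric.ball x t, U y) ^ (q - 1) *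
          wMeasure ω (Metric.ball x t)) := by
        rw [← mul_assoc]
        exact mul_le_mul_left hq' _
    _ ≤ (∫⁻ y in Metric.ball x t, g y ^ q * W y) * (C *
          (ENNReal.ofReal ((1 + κ) ^ θ) * volume (Metric.ball x t)) ^ q) := by
        refine mul_le_mul_right (hAq.trans (mul_le_mul_right ?_ _)) _
        exact ENNReal.rpow_le_rpow (psiVol_le hθ (hρ x) ht htκ) hq0.le
    _ = _ := by
        rw [ENNReal.mul_rpow_of_nonneg _ _ hq0.le]
        ring

/-- On the balls `B(x, t)` with `t ≤ κ ρ(x)` the weights of `A_q^{ρ,∞}` satisfy the usual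
`A_q` estimate. -/
theorem MemAp.exists_local_bound {ρ ω : Eucl n → ℝ} (hρ : ∀ x, 0 < ρ x) {q : ℝ}
    (hω : MemAp ρ q ω) (κ : ℝ) :
    ∃ C : ℝ≥0, ∀ (x : Eucl n) (t : ℝ), 0 < t → t ≤ κ * ρ x → ∀ g : Eucl n → ℝ≥0∞, Measurable g →
      (∫⁻ y in Metric.ball x t, g y) ^ q * wMeasure ω (Metric.ball x t) ≤
        C * volume (Metric.ball x t) ^ q *
          ∫⁻ y in Metric.ball x t, g y ^ q ∂(wMeasure ω) := by
  have hw := hω.isWeight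
  obtain ⟨θ, hθ, ⟨rfl, h⟩ | ⟨hq, h⟩⟩ := hω
  · obtain ⟨C, hC⟩ := h.exists_local_bound hρ hθ κ
    refine ⟨C, fun x t ht htκ g hg => ?_⟩
    rw [hw.setLIntegral_wMeasure (hg.pow_const _).aemeasurable]
    simpa only [ENNReal.rpow_one] using hC x t ht htκ g
  · obtain ⟨C, hC⟩ := h.exists_local_bound hρ hθ hq κ
    refine ⟨C, fun x t ht htκ g hg => ?_⟩
    rw [hw.setLIntegral_wMeasure (hg.pow_const _).aemeasurable]
    exact hC x t ht htκ g hg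

/-- Test the local bound on the ball of radius `4 t` with the indicator of the concentric ball of
radius `t`. The ratio `4` matches the enlargement in the Vitali covering. -/
theorem MemAp.exists_doubling {ρ ω : Eucl n → ℝ} (hρ : ∀ x, 0 < ρ x) {q : ℝ} (hq : 1 ≤ q)
    (hω : MemAp ρ q ω) (κ : ℝ) :
    ∃ C : ℝ≥0, ∀ (x : Eucl n) (t : ℝ), 0 < t → t ≤ κ * ρ x →
      wMeasure ω (Metric.ball x (4 * t)) ≤ C * wMeasure ω (Metric.ball x t) := by
  have hq0 : 0 < q := by linarith
  obtain ⟨C, hC⟩ := hω.exists_local_bound hρ (4 * κ)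
  have hfin : (C : ℝ≥0∞) * ENNReal.ofReal (4 ^ n) ^ q ≠ ∞ :=
    ENNReal.mul_ne_top ENNReal.coe_ne_top
      (ENNReal.rpow_ne_top_of_nonneg hq0.le ENNReal.ofReal_ne_top)
  refine ⟨((C : ℝ≥0∞) * ENNReal.ofReal (4 ^ n) ^ q).toNNReal, fun x t ht htκ => ?_⟩
  rw [ENNReal.coe_toNNReal hfin]
  have hB : MeasurableSet (Metric.ball x t) := Metric.isOpen_ball.measurableSet
  have hsub : Metric.ball x t ⊆ Metric.ball x (4 * t) := Metric.ball_subset_ball (by linarith)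
  have h1 := hC x (4 * t) (by linarith) (by linarith) ((Metric.ball x t).indicator 1)
    (measurable_one.indicator hB)
  have h2 (μ : Measure (Eucl n)) :
      ∫⁻ y in Metric.ball x (4 * t), (Metric.ball x t).indicator 1 y ∂μ = μ (Metric.ball x t) := by
    rw [lintegral_indicator_one hB, Measure.restrict_apply hB, inter_eq_left.2 hsub]
  have h3 (y : Eucl n) : ((Metric.ball x t).indicator (1 : Eucl n → ℝ≥0∞) y) ^ q =
      (Metric.ball x t).indicator 1 y := by
    by_cases hy : y ∈ Metric.ball x t
    · simp [hy]
    · simp [hy, hq0]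
  simp only [h3, h2] at h1
  have hvol : volume (Metric.ball x (4 * t)) =
      ENNReal.ofReal (4 ^ n) * volume (Metric.ball x t) := by
    rw [Measure.addHaar_ball_of_pos _ _ (by linarith), Measure.addHaar_ball_of_pos _ _ ht,
      finrank_euclideanSpace, Fintype.card_fin, mul_pow, ENNReal.ofReal_mul (by positivity), mul_assoc]
  have hv0 : volume (Metric.ball x t) ^ q ≠ 0 :=
    (ENNReal.rpow_pos (Metric.measure_ball_pos _ _ ht) measure_ball_lt_top.ne).ne'
  have hvt : volume (Metric.ball x t) ^ q ≠ ∞ :=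
    ENNReal.rpow_ne_top_of_nonneg hq0.le measure_ball_lt_top.ne
  rw [hvol, ENNReal.mul_rpow_of_nonneg _ _ hq0.le] at h1
  refine (ENNReal.mul_le_mul_iff_right hv0 hvt).1 (h1.trans (le_of_eq ?_))
  ring

/-- Select disjoint balls with average above `a` whose enlargements cover the level set. Doubling
removes the enlargement, the local bound controls each ball, and disjointness sums the integrals. -/
theorem MemAp.exists_weak_type {ρ ω : Eucl n → ℝ} (hρ : ∀ x, 0 < ρ x) {q : ℝ} (hq : 1 ≤ q)
    (hω : MemAp ρ q ω) {K : ℝ} (hK : 0 < K) :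
    ∃ C : ℝ≥0, ∀ g : Eucl n → ℝ≥0∞, Measurable g → ∀ a : ℝ≥0∞, a ≠ 0 → a ≠ ∞ →
      wMeasure ω {x | a < locMax ρ K g x} ≤ C * (a ^ q)⁻¹ * ∫⁻ x, g x ^ q ∂(wMeasure ω) := by
  have hq0 : 0 < q := by linarith
  obtain ⟨C, hC⟩ := hω.exists_local_bound hρ K
  obtain ⟨D, hD⟩ := hω.exists_doubling hρ hq K
  refine ⟨D * C, fun g hg a ha0 hat => ?_⟩
  have haq0 : a ^ q ≠ 0 := (ENNReal.rpow_pos (pos_iff_ne_zero.2 ha0) hat).ne'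
  have haqt : a ^ q ≠ ∞ := ENNReal.rpow_ne_top_of_nonneg hq0.le hat
  -- Vitali's lemma needs bounded radii, but `ρ` may be unbounded: cut at `ρ ≤ j` and let `j`
  -- increase.
  set E : ℕ → Set (Eucl n) := fun j => {x | a < locMax ρ K g x ∧ ρ x ≤ j} with hE
  have hEU : {x | a < locMax ρ K g x} = ⋃ j, E j := by
    ext x
    simp only [hE, mem_iUnion, mem_ofPred_eq, exists_and_left]
    exact ⟨fun h => ⟨h, exists_nat_ge _⟩, fun h => h.1⟩
  have hEm : Monotone E := fun i j hij x hx => ⟨hx.1, hx.2.trans (by exact_mod_cast hij)⟩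
  rw [hEU, hEm.measure_iUnion]
  refine iSup_le fun j => ?_
  have hex : ∀ x ∈ E j, ∃ t : ℝ, 0 < t ∧ t ≤ K * ρ x ∧
      a * volume (Metric.ball x t) < ∫⁻ y in Metric.ball x t, g y := by
    rintro x ⟨hx, -⟩
    obtain ⟨l, hl⟩ := lt_iSup_iff.1 hx
    obtain ⟨hl2, hl3⟩ := lt_iSup_iff.1 hl
    refine ⟨K * 2 ^ (-l), by positivity, mul_le_mul_of_nonneg_left hl2.le hK.le, ?_⟩
    rwa [ENNReal.lt_div_iff_mul_lt (Or.inl (Metric.measure_ball_pos _ _ (by positivity)).ne')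
      (Or.inl measure_ball_lt_top.ne)] at hl3
  choose! t ht0 htK htg using hex
  obtain ⟨u, huE, hud, hucov⟩ := Vitali.exists_disjoint_subfamily_covering_enlargement_ball
    (E j) id t (K * j) (fun x hx => (htK x hx).trans (mul_le_mul_of_nonneg_left hx.2 hK.le)) 4
    (by norm_num)
  simp only [id] at hud hucov
  have huc : u.Countable := hud.countable_of_isOpen (fun _ _ => Metric.isOpen_ball)
    fun x hx => Metric.nonempty_ball.2 (ht0 x (huE hx))
  have hcov : E j ⊆ ⋃ b ∈ u, Metric.ball b (4 * t b) := by
    intro x hx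
    obtain ⟨b, hb, hsub⟩ := hucov x hx
    exact mem_biUnion hb (hsub (Metric.mem_ball_self (ht0 x hx)))
  have hball (b : Eucl n) (hb : b ∈ u) : wMeasure ω (Metric.ball b (4 * t b)) ≤
      (D * C : ℝ≥0) * (a ^ q)⁻¹ * ∫⁻ y in Metric.ball b (t b), g y ^ q ∂(wMeasure ω) := by
    have hbE := huE hb
    refine (hD b (t b) (ht0 b hbE) (htK b hbE)).trans ?_
    have h1 := hC b (t b) (ht0 b hbE) (htK b hbE) g hg
    have h2 : (a * volume (Metric.ball b (t b))) ^ q * wMeasure ω (Metric.ball b (t b)) ≤ _ :=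
      (mul_le_mul_left (ENNReal.rpow_le_rpow (htg b hbE).le hq0.le) _).trans h1
    have hv0 : volume (Metric.ball b (t b)) ^ q ≠ 0 :=
      (ENNReal.rpow_pos (Metric.measure_ball_pos _ _ (ht0 b hbE)) measure_ball_lt_top.ne).ne'
    have hvt : volume (Metric.ball b (t b)) ^ q ≠ ∞ :=
      ENNReal.rpow_ne_top_of_nonneg hq0.le measure_ball_lt_top.ne
    rw [ENNReal.mul_rpow_of_nonneg _ _ hq0.le] at h2
    have h3 : a ^ q * wMeasure ω (Metric.ball b (t b)) ≤
        C * ∫⁻ y in Metric.ball b (t b), g y ^ q ∂(wMeasure ω) := by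
      refine (ENNReal.mul_le_mul_iff_right hv0 hvt).1 (le_trans (le_of_eq ?_) (h2.trans (le_of_eq ?_)))
        <;> ring
    have h4 : wMeasure ω (Metric.ball b (t b)) =
        (a ^ q)⁻¹ * (a ^ q * wMeasure ω (Metric.ball b (t b))) := by
      rw [← mul_assoc, ENNReal.inv_mul_cancel haq0 haqt, one_mul]
    rw [h4]
    refine (mul_le_mul_right (mul_le_mul_right h3 _) _).trans (le_of_eq ?_)
    push_cast
    ring
  calc wMeasure ω (E j) ≤ wMeasure ω (⋃ b ∈ u, Metric.ball b (4 * t b)) := measure_mono hcov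
    _ ≤ ∑' b : u, wMeasure ω (Metric.ball (b : Eucl n) (4 * t b)) := measure_biUnion_le _ huc _
    _ ≤ ∑' b : u, (D * C : ℝ≥0) * (a ^ q)⁻¹ *
          ∫⁻ y in Metric.ball (b : Eucl n) (t b), g y ^ q ∂(wMeasure ω) :=
        ENNReal.tsum_le_tsum fun b => hball b b.2
    _ = (D * C : ℝ≥0) * (a ^ q)⁻¹ *
          ∫⁻ y in ⋃ b ∈ u, Metric.ball b (t b), g y ^ q ∂(wMeasure ω) := by
        rw [ENNReal.tsum_mul_left,
          lintegral_biUnion huc (fun _ _ => Metric.isOpen_ball.measurableSet) hud]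
    _ ≤ _ := mul_le_mul_right (setLIntegral_le_lintegral _ _) _

/-! ### The strong type estimate -/

theorem lintegral_Ioo_rpow {s b : ℝ} (hs : 0 < s) (hb : 0 ≤ b) :
    ∫⁻ t in Ioo (0 : ℝ) b, ENNReal.ofReal (s * t ^ (s - 1)) = ENNReal.ofReal (b ^ s) := by
  have hint : IntervalIntegrable (fun t : ℝ => s * t ^ (s - 1)) volume 0 b :=
    (intervalIntegral.intervalIntegrable_rpow' (by linarith)).const_mul s
  rw [setLIntegral_congr Ioo_ae_eq_Ioc, ← ofReal_integral_eq_lintegral_ofReal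
    ((intervalIntegrable_iff_integrableOn_Ioc_of_le hb).1 hint),
    ← intervalIntegral.integral_of_le hb, intervalIntegral.integral_const_mul,
    integral_rpow (Or.inl (by linarith)), sub_add_cancel, Real.zero_rpow hs.ne', sub_zero,
    mul_div_cancel₀ _ hs.ne']
  refine (ae_restrict_iff' measurableSet_Ioc).2 (.of_forall fun t ht => ?_)
  have := ht.1
  simp only [Pi.zero_apply]
  positivity

/-- The layer cake formula for one number. -/
theorem rpow_eq_lintegral_Ioi {s : ℝ} (hs : 0 < s) (a : ℝ≥0∞) :
    a ^ s = ∫⁻ t in Ioi (0 : ℝ), ENNReal.ofReal (s * t ^ (s - 1)) *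
      {t : ℝ | ENNReal.ofReal t < a}.indicator 1 t := by
  have hmul (t : ℝ) : ENNReal.ofReal (s * t ^ (s - 1)) *
      {t : ℝ | ENNReal.ofReal t < a}.indicator 1 t =
      {t : ℝ | ENNReal.ofReal t < a}.indicator (fun t => ENNReal.ofReal (s * t ^ (s - 1))) t := by
    by_cases ht : t ∈ {t : ℝ | ENNReal.ofReal t < a} <;> simp [ht]
  have hmeas : MeasurableSet {t : ℝ | ENNReal.ofReal t < a} :=
    measurableSet_lt ENNReal.measurable_ofReal measurable_const
  simp_rw [hmul]
  rw [lintegral_indicator hmeas, Measure.restrict_restrict hmeas]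
  rcases eq_or_ne a ∞ with rfl | ha
  · rw [ENNReal.top_rpow_of_pos hs]
    refine (ENNReal.eq_top_of_forall_nnreal_le fun b => ?_).symm
    have hb : (b : ℝ≥0∞) = ENNReal.ofReal (((b : ℝ) ^ (1 / s)) ^ s) := by
      rw [← Real.rpow_mul b.coe_nonneg, one_div_mul_cancel hs.ne', Real.rpow_one, ENNReal.ofReal_coe_nnreal]
    rw [hb, ← lintegral_Ioo_rpow hs (by positivity)]
    exact lintegral_mono_set fun t ht => ⟨ENNReal.ofReal_lt_top, ht.1⟩
  · have hset : {t : ℝ | ENNReal.ofReal t < a} ∩ Ioi 0 = Ioo 0 a.toReal := by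
      ext t
      constructor
      · rintro ⟨h1, h2⟩
        exact ⟨h2, (ENNReal.ofReal_lt_iff_lt_toReal (le_of_lt h2) ha).1 h1⟩
      · rintro ⟨h1, h2⟩
        exact ⟨(ENNReal.ofReal_lt_iff_lt_toReal h1.le ha).2 h2, h1⟩
    rw [hset, lintegral_Ioo_rpow hs ENNReal.toReal_nonneg,
      ← ENNReal.ofReal_rpow_of_nonneg ENNReal.toReal_nonneg hs.le, ENNReal.ofReal_toReal ha]

theorem measurable_iSup_prop {α : Type*} [MeasurableSpace α] {P : α → Prop}
    (hP : MeasurableSet {x | P x}) {F : α → ℝ≥0∞} (hF : Measurable F) :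
    Measurable fun x => ⨆ _ : P x, F x := by
  have : (fun x => ⨆ _ : P x, F x) = {x | P x}.indicator F := by
    funext x
    by_cases hx : P x <;> simp [hx]
  rw [this]
  exact hF.indicator hP

theorem measurable_setLIntegral_ball {g : Eucl n → ℝ≥0∞} (hg : Measurable g) (t : ℝ) :
    Measurable fun x => ∫⁻ y in Metric.ball x t, g y := by
  have h1 (x : Eucl n) : ∫⁻ y in Metric.ball x t, g y =
      ∫⁻ y, {p : Eucl n × Eucl n | dist p.2 p.1 < t}.indicator (fun p => g p.2) (x, y) := by
    rw [← lintegral_indicator Metric.isOpen_ball.measurableSet]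
    rfl
  simp_rw [h1]
  refine Measurable.lintegral_prod_right' ((hg.comp measurable_snd).indicator ?_)
  exact measurableSet_lt (measurable_snd.dist measurable_fst) measurable_const

theorem measurable_locMax {ρ : Eucl n → ℝ} (hρ : Measurable ρ) (K : ℝ) {g : Eucl n → ℝ≥0∞}
    (hg : Measurable g) : Measurable (locMax ρ K g) := by
  refine Measurable.iSup fun l => measurable_iSup_prop (measurableSet_lt measurable_const hρ) ?_
  refine (measurable_setLIntegral_ball hg _).div ?_
  simpa using measurable_setLIntegral_ball (n := n) measurable_one (K * 2 ^ (-l))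

/-- Averages preserve constants. This is the `L^∞` endpoint of the interpolation. -/
theorem locMax_le_add (ρ : Eucl n → ℝ) {K : ℝ} (hK : 0 < K) {g g' : Eucl n → ℝ≥0∞} {a : ℝ≥0∞}
    (h : ∀ x, g x ≤ g' x + a) (x : Eucl n) : locMax ρ K g x ≤ locMax ρ K g' x + a := by
  refine iSup₂_le fun l hl => ?_
  have hv0 : volume (Metric.ball x (K * 2 ^ (-l))) ≠ 0 :=
    (Metric.measure_ball_pos _ _ (by positivity)).ne'
  have hvt : volume (Metric.ball x (K * 2 ^ (-l))) ≠ ∞ := measure_ball_lt_top.ne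
  have h1 : (∫⁻ y in Metric.ball x (K * 2 ^ (-l)), g' y) / volume (Metric.ball x (K * 2 ^ (-l))) ≤
      locMax ρ K g' x :=
    le_iSup₂_of_le (f := fun (l : ℤ) (_ : (2 : ℝ) ^ (-l) < ρ x) =>
      (∫⁻ y in Metric.ball x (K * 2 ^ (-l)), g' y) / volume (Metric.ball x (K * 2 ^ (-l))))
      l hl le_rfl
  refine le_trans ?_ (add_le_add h1 le_rfl)
  rw [ENNReal.div_le_iff hv0 hvt, add_mul, ENNReal.div_mul_cancel hv0 hvt]
  refine (lintegral_mono h).trans (le_of_eq ?_)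
  rw [lintegral_add_right _ measurable_const, setLIntegral_const]

instance (ω : Eucl n → ℝ) : SFinite (wMeasure ω) := by
  unfold wMeasure
  infer_instance

/-- Marcinkiewicz interpolation between weak type `q` and the `L^∞` endpoint: at height `t` only the
part of `g` above `t / 2` matters. -/
theorem MemAp.exists_strong_type {ρ ω : Eucl n → ℝ} (hρ : ∀ x, 0 < ρ x) (hρm : Measurable ρ)
    {q s : ℝ} (hq : 1 ≤ q) (hqs : q < s) (hω : MemAp ρ q ω) {K : ℝ} (hK : 0 < K) :
    ∃ C : ℝ≥0, ∀ g : Eucl n → ℝ≥0∞, Measurable g →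
      ∫⁻ x, locMax ρ K g x ^ s ∂(wMeasure ω) ≤ C * ∫⁻ x, g x ^ s ∂(wMeasure ω) := by
  obtain ⟨C, hC⟩ := hω.exists_weak_type hρ hq hK
  have hq0 : 0 < q := by linarith
  have hs0 : 0 < s := by linarith
  have hsq : 0 < s - q := by linarith
  set A : ℝ≥0∞ := C * ENNReal.ofReal (s * 2 ^ q / (s - q)) * 2 ^ (s - q) with hA
  have hAt : A ≠ ∞ := by finiteness
  refine ⟨A.toNNReal, fun g hg => ?_⟩
  rw [ENNReal.coe_toNNReal hAt]
  have hM := measurable_locMax hρm K hg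
  have hdens (e : ℝ) : Measurable fun t : ℝ => ENNReal.ofReal (e * t ^ (e - 1)) :=
    ((measurable_id.pow_const _).const_mul _).ennreal_ofReal
  -- rewriting by the layer cake formula
  have h1 : ∫⁻ x, locMax ρ K g x ^ s ∂(wMeasure ω) =
      ∫⁻ t in Ioi (0 : ℝ), ENNReal.ofReal (s * t ^ (s - 1)) *
        wMeasure ω {x | ENNReal.ofReal t < locMax ρ K g x} := by
    simp_rw [rpow_eq_lintegral_Ioi hs0]
    rw [lintegral_lintegral_swap]
    · refine lintegral_congr fun t => ?_
      rw [lintegral_const_mul' _ _ ENNReal.ofReal_ne_top]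
      congr 1
      rw [← lintegral_indicator_one (measurableSet_lt measurable_const hM)]
      rfl
    · refine (((hdens s).comp measurable_snd).mul ?_).aemeasurable
      exact measurable_one.indicator (s := {p : Eucl n × ℝ | ENNReal.ofReal p.2 < locMax ρ K g p.1})
        (measurableSet_lt (ENNReal.measurable_ofReal.comp measurable_snd) (hM.comp measurable_fst))
  -- Layer cake for the remaining exponent `s - q`, applied to `2 g` because of the cut at `t / 2`;
  -- it evaluates the `t`-integral left by the weak type bound.
  have h2 : ∫⁻ x, g x ^ q * (2 * g x) ^ (s - q) ∂(wMeasure ω) =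
      ∫⁻ t in Ioi (0 : ℝ), ENNReal.ofReal ((s - q) * t ^ (s - q - 1)) *
        ∫⁻ x, {x | ENNReal.ofReal t < 2 * g x}.indicator (fun x => g x ^ q) x ∂(wMeasure ω) := by
    simp_rw [rpow_eq_lintegral_Ioi hsq]
    have hm1 : Measurable fun p : Eucl n × ℝ => ENNReal.ofReal ((s - q) * p.2 ^ (s - q - 1)) *
        {p : Eucl n × ℝ | ENNReal.ofReal p.2 < 2 * g p.1}.indicator 1 p :=
      ((hdens (s - q)).comp measurable_snd).mul (measurable_one.indicator
        (measurableSet_lt (ENNReal.measurable_ofReal.comp measurable_snd)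
          ((hg.const_mul 2).comp measurable_fst)))
    have h3 (x : Eucl n) : g x ^ q * ∫⁻ t in Ioi (0 : ℝ),
        ENNReal.ofReal ((s - q) * t ^ (s - q - 1)) *
          {t : ℝ | ENNReal.ofReal t < 2 * g x}.indicator 1 t =
        ∫⁻ t in Ioi (0 : ℝ), g x ^ q * (ENNReal.ofReal ((s - q) * t ^ (s - q - 1)) *
          {t : ℝ | ENNReal.ofReal t < 2 * g x}.indicator 1 t) :=
      (lintegral_const_mul _ (hm1.comp measurable_prodMk_left)).symm
    simp_rw [h3]
    rw [lintegral_lintegral_swap]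
    · refine lintegral_congr fun t => ?_
      rw [← lintegral_const_mul' _ _ ENNReal.ofReal_ne_top]
      refine lintegral_congr fun x => ?_
      by_cases hx : ENNReal.ofReal t < 2 * g x
      · rw [indicator_of_mem (by exact hx), indicator_of_mem (by exact hx), Pi.one_apply, mul_one,
          mul_comm]
      · simp [hx]
    · exact (((hg.pow_const q).comp measurable_fst).mul hm1).aemeasurable
  have hlevel (t : ℝ) (ht : 0 < t) : wMeasure ω {x | ENNReal.ofReal t < locMax ρ K g x} ≤
      C * ENNReal.ofReal ((t / 2) ^ q)⁻¹ *
        ∫⁻ x, {x | ENNReal.ofReal t < 2 * g x}.indicator (fun x => g x ^ q) x ∂(wMeasure ω) := by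
    set S := {x | ENNReal.ofReal t < 2 * g x} with hS
    have hSm : MeasurableSet S := measurableSet_lt measurable_const (hg.const_mul 2)
    have hsub : {x | ENNReal.ofReal t < locMax ρ K g x} ⊆
        {x | ENNReal.ofReal (t / 2) < locMax ρ K (S.indicator g) x} := by
      intro x hx
      have h4 : locMax ρ K g x ≤ locMax ρ K (S.indicator g) x + ENNReal.ofReal (t / 2) := by
        refine locMax_le_add ρ hK (fun y => ?_) x
        by_cases hy : y ∈ S
        · rw [indicator_of_mem hy]
          exact le_self_add
        · rw [indicator_of_notMem hy, zero_add, ENNReal.ofReal_div_of_pos two_pos]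
          rw [hS, mem_ofPred_eq, not_lt] at hy
          rw [ENNReal.le_div_iff_mul_le (by simp) (by simp), mul_comm]
          simpa using hy
      by_contra h5
      rw [mem_ofPred_eq, not_lt] at h5
      have h6 := h4.trans (add_le_add h5 le_rfl)
      rw [← ENNReal.ofReal_add (by positivity) (by positivity), add_halves] at h6
      exact absurd hx (not_lt.2 h6)
    refine (measure_mono hsub).trans ((hC _ (hg.indicator hSm) _
      (ENNReal.ofReal_pos.2 (by positivity)).ne' ENNReal.ofReal_ne_top).trans (le_of_eq ?_))
    rw [ENNReal.ofReal_rpow_of_pos (by positivity), ENNReal.ofReal_inv_of_pos (by positivity)]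
    congr 1
    refine lintegral_congr fun x => ?_
    by_cases hx : x ∈ S
    · simp [hx]
    · simp [hx, hq0]
  rw [h1]
  calc ∫⁻ t in Ioi (0 : ℝ), ENNReal.ofReal (s * t ^ (s - 1)) *
        wMeasure ω {x | ENNReal.ofReal t < locMax ρ K g x}
      ≤ ∫⁻ t in Ioi (0 : ℝ), C * ENNReal.ofReal (s * 2 ^ q / (s - q)) *
          (ENNReal.ofReal ((s - q) * t ^ (s - q - 1)) *
          ∫⁻ x, {x | ENNReal.ofReal t < 2 * g x}.indicator (fun x => g x ^ q) x ∂(wMeasure ω)) := by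
        refine setLIntegral_mono' measurableSet_Ioi fun t ht => ?_
        have ht0 : 0 < t := ht
        refine (mul_le_mul_right (hlevel t ht0) _).trans (le_of_eq ?_)
        have h7 : ENNReal.ofReal (s * t ^ (s - 1)) * ENNReal.ofReal ((t / 2) ^ q)⁻¹ =
            ENNReal.ofReal (s * 2 ^ q / (s - q)) * ENNReal.ofReal ((s - q) * t ^ (s - q - 1)) := by
          rw [← ENNReal.ofReal_mul (by positivity), ← ENNReal.ofReal_mul (by positivity)]
          congr 1
          rw [Real.div_rpow ht0.le two_pos.le, inv_div, show s - q - 1 = (s - 1) - q by ring,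
            Real.rpow_sub ht0 (s - 1) q]
          field_simp
        calc _ = C * (ENNReal.ofReal (s * t ^ (s - 1)) * ENNReal.ofReal ((t / 2) ^ q)⁻¹) *
              ∫⁻ x, {x | ENNReal.ofReal t < 2 * g x}.indicator (fun x => g x ^ q) x
                ∂(wMeasure ω) := by ring
          _ = _ := by
            rw [h7]
            ring
    _ = C * ENNReal.ofReal (s * 2 ^ q / (s - q)) *
          ∫⁻ x, g x ^ q * (2 * g x) ^ (s - q) ∂(wMeasure ω) := by
        rw [lintegral_const_mul' _ _ (by finiteness), h2]
    _ = A * ∫⁻ x, g x ^ s ∂(wMeasure ω) := by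
        have h8 (x : Eucl n) : g x ^ q * (2 * g x) ^ (s - q) = 2 ^ (s - q) * g x ^ s := by
          rw [ENNReal.mul_rpow_of_nonneg _ _ hsq.le, mul_left_comm,
            ← ENNReal.rpow_add_of_nonneg _ _ hq0.le hsq.le, add_sub_cancel]
        simp_rw [h8]
        rw [lintegral_const_mul' _ _ (by finiteness), hA]
        ring

/-! ### Measurability of the maximal functions -/

theorem measurable_vertMax {ρ : Eucl n → ℝ} (hρ : Measurable ρ) (ψ : TestFun n) (f : Distr n) :
    Measurable (vertMax ρ ψ f) :=
  Measurable.iSup fun l => measurable_iSup_prop (measurableSet_lt measurable_const hρ)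
    (continuous_conv ψ l f).enorm.measurable

/-- The supremum over test functions is uncountable, but suprema of continuous functions are lower
semicontinuous; only the sum over `l` and the condition on `ρ` are treated measurably. -/
theorem measurable_grandVert {ρ : Eucl n → ℝ} (hρ : Measurable ρ) (N : ℕ) (R : ℝ) (f : Distr n) :
    Measurable (grandVert ρ N R f) :=
  Measurable.iSup fun l => measurable_iSup_prop (measurableSet_lt measurable_const hρ)
    (lowerSemicontinuous_iSup fun φ => lowerSemicontinuous_iSup fun _ =>
      (continuous_conv φ l f).enorm.lowerSemicontinuous).measurable

/-- For fixed `z` the function is a constant on an open ball and zero elsewhere, so no regularity of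
`F` is required. -/
theorem lowerSemicontinuous_iSup_norm_sub_lt (t : ℝ) (F : Eucl n → ℝ≥0∞) :
    LowerSemicontinuous fun x => ⨆ (z : Eucl n) (_ : ‖x - z‖ < t), F z := by
  refine lowerSemicontinuous_iSup fun z => ?_
  have : (fun x : Eucl n => ⨆ _ : ‖x - z‖ < t, F z) = (Metric.ball z t).indicator fun _ => F z := by
    funext x
    by_cases hx : ‖x - z‖ < t
    · rw [indicator_of_mem (by rwa [Metric.mem_ball, dist_eq_norm])]
      simp [hx]
    · rw [indicator_of_notMem (by rwa [Metric.mem_ball, dist_eq_norm])]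
      simp [hx]
  rw [this]
  exact Metric.isOpen_ball.lowerSemicontinuous_indicator zero_le

theorem measurable_nontanMax {ρ : Eucl n → ℝ} (hρ : Measurable ρ) (ψ : TestFun n) (f : Distr n) :
    Measurable (nontanMax ρ ψ f) :=
  Measurable.iSup fun _ => measurable_iSup_prop (measurableSet_lt measurable_const hρ)
    (lowerSemicontinuous_iSup_norm_sub_lt _ _).measurable

theorem measurable_grandNontan {ρ : Eucl n → ℝ} (hρ : Measurable ρ) (N : ℕ) (R : ℝ)
    (f : Distr n) : Measurable (grandNontan ρ N R f) :=
  Measurable.iSup fun _ => measurable_iSup_prop (measurableSet_lt measurable_const hρ)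
    (lowerSemicontinuous_iSup_norm_sub_lt _ _).measurable

/-! ### Comparison of the maximal functions -/

theorem grandVert_le_grandNontan (ρ : Eucl n → ℝ) (N : ℕ) (R : ℝ) (f : Distr n) (x : Eucl n) :
    grandVert ρ N R f x ≤ grandNontan ρ N R f x :=
  iSup₂_mono fun l _ => le_iSup₂_of_le (f := fun (z : Eucl n) (_ : ‖x - z‖ < (2 : ℝ) ^ (-l)) =>
    ⨆ (φ : TestFun n) (_ : φ ∈ testClass n N R), ‖conv φ l f z‖ₑ) x
    (by rw [sub_self, norm_zero]; positivity) le_rfl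

theorem testClass_mono (N : ℕ) {R R' : ℝ} (h : R ≤ R') : testClass n N R ⊆ testClass n N R' :=
  fun _ hφ => ⟨hφ.1.trans (Metric.ball_subset_ball h), hφ.2⟩

theorem grandVert_mono (ρ : Eucl n → ℝ) (N : ℕ) {R R' : ℝ} (h : R ≤ R') (f : Distr n)
    (x : Eucl n) : grandVert ρ N R f x ≤ grandVert ρ N R' f x :=
  iSup₂_mono fun _ _ => biSup_mono fun _ hφ => testClass_mono N h hφ

theorem grandNontan_mono (ρ : Eucl n → ℝ) (N : ℕ) {R R' : ℝ} (h : R ≤ R') (f : Distr n)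
    (x : Eucl n) : grandNontan ρ N R f x ≤ grandNontan ρ N R' f x :=
  iSup₂_mono fun _ _ => iSup₂_mono fun _ _ => biSup_mono fun _ hφ => testClass_mono N h hφ

theorem vertMax_le_nontanMax (ρ : Eucl n → ℝ) (ψ : TestFun n) (f : Distr n) (x : Eucl n) :
    vertMax ρ ψ f x ≤ nontanMax ρ ψ f x :=
  iSup₂_mono fun l _ => le_iSup₂_of_le (f := fun (z : Eucl n) (_ : ‖x - z‖ < (2 : ℝ) ^ (-l)) =>
    ‖conv ψ l f z‖ₑ) x (by rw [sub_self, norm_zero]; positivity) le_rfl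

theorem vertMax_smul_le (ρ : Eucl n → ℝ) (c : ℂ) (ψ : TestFun n) (f : Distr n) (x : Eucl n) :
    vertMax ρ (c • ψ) f x ≤ ‖c‖₊ * vertMax ρ ψ f x := by
  refine iSup₂_le fun l hl => ?_
  rw [conv_smul, enorm_mul]
  exact mul_le_mul_right (le_iSup₂_of_le (f := fun (l : ℤ) (_ : (2 : ℝ) ^ (-l) < ρ x) =>
    ‖conv ψ l f x‖ₑ) l hl le_rfl) _

/-- Every test function supported in `B(0, R)` is a multiple of an element of `testClass n N R`. -/
theorem exists_mem_testClass (ψ : TestFun n) (N : ℕ) {R : ℝ} (hψ : tsupport ψ ⊆ Metric.ball 0 R) :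
    ∃ (C : ℝ≥0) (φ : TestFun n), φ ∈ testClass n N R ∧
      ∀ (l : ℤ) (f : Distr n) (x : Eucl n), ‖conv ψ l f x‖ₑ = C * ‖conv φ l f x‖ₑ := by
  obtain ⟨B, hB0, hB⟩ := exists_derivBound ψ N
  have hBc : ‖((B⁻¹ : ℝ) : ℂ)‖ * B = 1 := by
    rw [Complex.norm_real, Real.norm_of_nonneg (by positivity), inv_mul_cancel₀ hB0.ne']
  refine ⟨‖(B : ℂ)‖₊, ((B⁻¹ : ℝ) : ℂ) • ψ, mem_testClass_iff.2 ⟨?_, fun k hk => ?_⟩,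
    fun l f x => ?_⟩
  · exact (tsupport_smul_subset_right (fun _ => ((B⁻¹ : ℝ) : ℂ)) ψ).trans hψ
  · exact ((hB k hk).smul _).mono hBc.le
  · have h2 : conv ψ l f x = (B : ℂ) * conv (((B⁻¹ : ℝ) : ℂ) • ψ) l f x := by
      rw [conv_smul, ← mul_assoc]
      push_cast
      rw [mul_inv_cancel₀ (by exact_mod_cast hB0.ne'), one_mul]
    rw [h2, enorm_mul]
    rfl

theorem exists_nontanMax_le (ψ : TestFun n) (N : ℕ) {R : ℝ} (hψ : tsupport ψ ⊆ Metric.ball 0 R) :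
    ∃ C : ℝ≥0, ∀ (ρ : Eucl n → ℝ) (f : Distr n) (x : Eucl n),
      nontanMax ρ ψ f x ≤ C * grandNontan ρ N R f x := by
  obtain ⟨C, φ, hφ, h⟩ := exists_mem_testClass ψ N hψ
  refine ⟨C, fun ρ f x => iSup₂_le fun l hl => iSup₂_le fun z hz => ?_⟩
  rw [h]
  refine mul_le_mul_right ?_ _
  exact le_iSup₂_of_le l hl (le_iSup₂_of_le z hz (le_iSup₂_of_le φ hφ le_rfl))

theorem exists_vertMax_le (ψ : TestFun n) (N : ℕ) {R : ℝ} (hψ : tsupport ψ ⊆ Metric.ball 0 R) :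
    ∃ C : ℝ≥0, ∀ (ρ : Eucl n → ℝ) (f : Distr n) (x : Eucl n),
      vertMax ρ ψ f x ≤ C * grandVert ρ N R f x := by
  obtain ⟨C, φ, hφ, h⟩ := exists_mem_testClass ψ N hψ
  refine ⟨C, fun ρ f x => iSup₂_le fun l hl => ?_⟩
  rw [h]
  refine mul_le_mul_right ?_ _
  exact le_iSup₂_of_le l hl (le_iSup₂_of_le φ hφ le_rfl)

theorem wnorm_le_mul {ω : Eucl n → ℝ} {p : ℝ} (hp : 0 < p) {C : ℝ≥0} {g h : Eucl n → ℝ≥0∞}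
    (hgh : ∀ x, g x ≤ C * h x) : wnorm ω p g ≤ C * wnorm ω p h := by
  have hCp : (C : ℝ≥0∞) ^ p ≠ ∞ := ENNReal.rpow_ne_top_of_nonneg hp.le ENNReal.coe_ne_top
  have h1 : ∫⁻ x, g x ^ p * ENNReal.ofReal (ω x) ≤
      (C : ℝ≥0∞) ^ p * ∫⁻ x, h x ^ p * ENNReal.ofReal (ω x) := by
    rw [← lintegral_const_mul' _ _ hCp]
    refine lintegral_mono fun x => ?_
    rw [← mul_assoc, ← ENNReal.mul_rpow_of_nonneg _ _ hp.le]
    exact mul_le_mul_left (ENNReal.rpow_le_rpow (hgh x) hp.le) _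
  refine (ENNReal.rpow_le_rpow h1 (by positivity)).trans (le_of_eq ?_)
  rw [ENNReal.mul_rpow_of_nonneg _ _ (by positivity), ← ENNReal.rpow_mul, mul_one_div_cancel hp.ne',
    ENNReal.rpow_one]
  rfl

theorem wnorm_mono {ω : Eucl n → ℝ} {p : ℝ} (hp : 0 < p) {g h : Eucl n → ℝ≥0∞}
    (hgh : ∀ x, g x ≤ h x) : wnorm ω p g ≤ wnorm ω p h := by
  simpa using wnorm_le_mul (ω := ω) hp (C := 1) (by simpa using hgh)

/-- The `p`-th power of the pointwise bound is `locMax (vertMax^r)^(p/r)`, to which the strong type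
estimate with exponent `p / r > q` applies. Dividing `ψ` by its integral costs only a constant. -/
theorem exists_wnorm_grandNontan_le {ρ : Eucl n → ℝ} (hρ : IsCriticalRadius ρ) {ω : Eucl n → ℝ}
    {p q r : ℝ} (hr0 : 0 < r) (hr1 : r ≤ 1) (hq : 1 ≤ q) (hqp : q < p / r) (hω : MemAp ρ q ω)
    {ψ : TestFun n} (hψ : (∫ x, ψ x) ≠ 0) {N : ℕ} (hN : n < N * r) {R : ℝ} (hR : 0 ≤ R) :
    ∃ C : ℝ≥0, ∀ f : Distr n, wnorm ω p (grandNontan ρ N R f) ≤ C * wnorm ω p (vertMax ρ ψ f) := by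
  have hpr : 0 < p / r := by linarith
  have hp : 0 < p := by
    have := mul_pos hpr hr0
    rwa [div_mul_cancel₀ _ hr0.ne'] at this
  have hw := hω.isWeight
  set c : ℂ := (∫ x, ψ x)⁻¹ with hc
  have hψ1 : ∫ x, (c • ψ) x = 1 := by
    change ∫ x, c * ψ x = 1
    rw [integral_const_mul, hc, inv_mul_cancel₀ hψ]
  obtain ⟨C, K, hK, h⟩ := exists_grandNontan_le_locMax hρ hψ1 hR hr0 hr1 hN
  obtain ⟨D, hD⟩ := hω.exists_strong_type hρ.2.1 hρ.1 hq hqp hK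
  set D' : ℝ≥0 := D ^ (1 / p) with hD'
  refine ⟨C * D' * ‖c‖₊, fun f => ?_⟩
  have hV := measurable_vertMax hρ.1 (c • ψ) f
  have hM := measurable_locMax hρ.1 K (hV.pow_const r)
  have h1 : wnorm ω p (fun x => locMax ρ K (fun w => vertMax ρ (c • ψ) f w ^ r) x ^ (1 / r)) ≤
      D' * wnorm ω p (vertMax ρ (c • ψ) f) := by
    have h2 := hD _ (hV.pow_const r)
    rw [hw.lintegral_wMeasure (hM.pow_const _).aemeasurable,
      hw.lintegral_wMeasure ((hV.pow_const r).pow_const _).aemeasurable] at h2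
    simp only [← ENNReal.rpow_mul, mul_div_cancel₀ _ hr0.ne'] at h2
    simp only [wnorm, ← ENNReal.rpow_mul, one_div_mul_eq_div]
    refine (ENNReal.rpow_le_rpow h2 (by positivity)).trans (le_of_eq ?_)
    rw [ENNReal.mul_rpow_of_nonneg _ _ (by positivity), hD', ENNReal.coe_rpow_of_nonneg _ (by positivity)]
  calc wnorm ω p (grandNontan ρ N R f)
      ≤ C * (D' * wnorm ω p (vertMax ρ (c • ψ) f)) :=
        (wnorm_le_mul hp (h f)).trans (mul_le_mul_right h1 _)
    _ ≤ C * (D' * (‖c‖₊ * wnorm ω p (vertMax ρ ψ f))) := by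
        refine mul_le_mul_right (mul_le_mul_right ?_ _) _
        exact wnorm_le_mul hp (vertMax_smul_le ρ c ψ f)
    _ = _ := by
        push_cast
        ring

/-- The support of `ψ₀` may exceed the unit ball; this bump gives a vertical maximal function
dominated by `grandVert` of radius `1`. -/
theorem exists_testFun_integral_ne_zero (n : ℕ) :
    ∃ ψ : TestFun n, tsupport ψ ⊆ Metric.ball 0 1 ∧ (∫ x, ψ x) ≠ 0 := by
  let b : ContDiffBump (0 : Eucl n) := ⟨1 / 4, 1 / 2, by norm_num, by norm_num⟩
  have hsupp : HasCompactSupport fun x => ((b x : ℝ) : ℂ) :=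
    b.hasCompactSupport.comp_left (g := fun t : ℝ => (t : ℂ)) Complex.ofReal_zero
  refine ⟨⟨fun x => ((b x : ℝ) : ℂ), Complex.ofRealCLM.contDiff.comp b.contDiff, hsupp, by simp⟩,
    ?_, ?_⟩
  · refine (tsupport_comp_subset (g := fun t : ℝ => (t : ℂ)) Complex.ofReal_zero b).trans ?_
    rw [b.tsupport_eq]
    exact Metric.closedBall_subset_ball (by norm_num)
  · change (∫ x, ((b x : ℝ) : ℂ)) ≠ 0
    rw [integral_complex_ofReal]
    exact_mod_cast (b.integral_pos (μ := volume)).ne'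

/-- The exponents that the order `N_{p,ω}` makes available. -/
theorem exists_exponents {ρ ω : Eucl n → ℝ} (hω : MemAInfty ρ ω) {p : ℝ} (hp0 : 0 < p)
    (hp1 : p ≤ 1) {N : ℕ} (hN : orderIndex ρ ω p ≤ (N : ℤ)) :
    ∃ q r : ℝ, 0 < r ∧ r ≤ 1 ∧ 1 ≤ q ∧ q < p / r ∧ MemAp ρ q ω ∧ n < N * r := by
  set Q := critIndex ρ ω with hQ
  have hne : {p : ℝ | 1 ≤ p ∧ MemAp ρ p ω}.Nonempty := hω
  have hQ1 : 1 ≤ Q := le_csInf hne fun _ h => h.1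
  have h1 : ⌊2 * ((n : ℝ) * Q / p)⌋ + 1 ≤ (N : ℤ) := (le_max_right _ _).trans hN
  have h2 : 2 * ((n : ℝ) * Q / p) < N := by
    refine (Int.lt_floor_add_one _).trans_le ?_
    exact_mod_cast h1
  have h3 : 0 ≤ (n : ℝ) * Q / p := by positivity
  have hN0 : (0 : ℝ) < N := by linarith
  -- Any `r` strictly between these numbers works: the left inequality is `n < N r`, while the right
  -- one gives `Q < p / r`, leaving room for a `q` in the defining set, and `r ≤ 1` since `p ≤ 1 ≤
  -- Q`.
  have h4 : (n : ℝ) / N < p / Q := by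
    have h5 : (n : ℝ) * Q / p < N := by linarith
    rw [div_lt_iff₀ hp0] at h5
    rw [div_lt_div_iff₀ hN0 (by linarith)]
    linarith
  obtain ⟨r, hr1, hr2⟩ := exists_between h4
  have hr0 : 0 < r := lt_of_le_of_lt (by positivity) hr1
  have h6 : Q < p / r := by
    rw [lt_div_iff₀ (by linarith)] at hr2
    rw [lt_div_iff₀ hr0]
    linarith
  obtain ⟨q, ⟨hq1, hq⟩, hqr⟩ := exists_lt_of_csInf_lt hne h6
  refine ⟨q, r, hr0, ?_, hq1, hqr, hq, ?_⟩
  · exact hr2.le.trans ((div_le_one (by linarith)).2 (by linarith))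
  · rwa [div_lt_iff₀ hN0, mul_comm] at hr1

/-- The six maximal functions of the characterization of the local Hardy space. -/
def maximalFamily (ρ : Eucl n → ℝ) (ψ : TestFun n) (N : ℕ) (R : ℝ) (f : Distr n) :
    Fin 6 → Eucl n → ℝ≥0∞ :=
  ![grandVert ρ N R f, vertMax ρ ψ f, nontanMax ρ ψ f, grandNontan ρ N R f, grandNontan ρ N 1 f,
    grandVert ρ N 1 f]

/-- `grandVert` of radius `1` serves as hub. Each function is below `grandNontan` of radius `max R₀
R`, which returns to the hub through the auxiliary bump; conversely the hub is below each grand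
maximal function directly and below those of `ψ` through the main estimate. -/
theorem exists_wnorm_maximal_le {ρ : Eucl n → ℝ} (hρ : IsCriticalRadius ρ) {ω : Eucl n → ℝ}
    {p q r : ℝ} (hp : 0 < p) (hr0 : 0 < r) (hr1 : r ≤ 1) (hq : 1 ≤ q) (hqp : q < p / r)
    (hω : MemAp ρ q ω) {ψ : TestFun n} (hψ : (∫ x, ψ x) ≠ 0) {N : ℕ} (hN : n < N * r) {R : ℝ}
    (hR : 1 ≤ R) :
    ∃ C : ℝ≥0, ∀ (f : Distr n) (i j : Fin 6), wnorm ω p (maximalFamily ρ ψ N R f i) ≤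
      C * wnorm ω p (maximalFamily ρ ψ N R f j) := by
  obtain ⟨ψ', hψ's, hψ'⟩ := exists_testFun_integral_ne_zero n
  obtain ⟨R₀, hR₀, hψs⟩ := exists_tsupport_subset_ball ψ
  obtain ⟨C₁, hC₁⟩ := exists_wnorm_grandNontan_le hρ hr0 hr1 hq hqp hω hψ hN (zero_le_one.trans hR)
  obtain ⟨C₂, hC₂⟩ := exists_wnorm_grandNontan_le hρ hr0 hr1 hq hqp hω hψ' hN
    (hR₀.le.trans (le_max_left R₀ R))
  obtain ⟨C₃, hC₃⟩ := exists_vertMax_le ψ' N hψ's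
  obtain ⟨C₄, hC₄⟩ := exists_nontanMax_le ψ N hψs
  -- everything is dominated by the smallest grand maximal function, and conversely
  have hlarge (f : Distr n) : wnorm ω p (grandNontan ρ N (max R₀ R) f) ≤
      (C₂ * C₃ : ℝ≥0) * wnorm ω p (grandVert ρ N 1 f) := by
    refine (hC₂ f).trans ((mul_le_mul_right (wnorm_le_mul hp (hC₃ ρ f)) _).trans (le_of_eq ?_))
    push_cast
    ring
  have hnontan (f : Distr n) : wnorm ω p (nontanMax ρ ψ f) ≤
      C₄ * wnorm ω p (grandNontan ρ N (max R₀ R) f) :=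
    wnorm_le_mul hp fun x => (hC₄ ρ f x).trans
      (mul_le_mul_right (grandNontan_mono ρ N (le_max_left _ _) f x) _)
  have hup (f : Distr n) (i : Fin 6) : wnorm ω p (maximalFamily ρ ψ N R f i) ≤
      ((C₄ + 1) * (C₂ * C₃) : ℝ≥0) * wnorm ω p (grandVert ρ N 1 f) := by
    have h1 : wnorm ω p (maximalFamily ρ ψ N R f i) ≤
        (C₄ + 1 : ℝ≥0) * wnorm ω p (grandNontan ρ N (max R₀ R) f) := by
      have hone : wnorm ω p (grandNontan ρ N (max R₀ R) f) ≤
          (C₄ + 1 : ℝ≥0) * wnorm ω p (grandNontan ρ N (max R₀ R) f) :=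
        le_mul_of_one_le_left zero_le (by exact_mod_cast le_add_self)
      have hnt : wnorm ω p (nontanMax ρ ψ f) ≤
          (C₄ + 1 : ℝ≥0) * wnorm ω p (grandNontan ρ N (max R₀ R) f) :=
        (hnontan f).trans (mul_le_mul_left (by exact_mod_cast le_self_add) _)
      have hmax : R ≤ max R₀ R := le_max_right _ _
      fin_cases i
      · exact (wnorm_mono hp fun x => (grandVert_le_grandNontan ρ N R f x).trans
          (grandNontan_mono ρ N hmax f x)).trans hone
      · exact (wnorm_mono hp (vertMax_le_nontanMax ρ ψ f)).trans hnt
      · exact hnt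
      · exact (wnorm_mono hp (grandNontan_mono ρ N hmax f)).trans hone
      · exact (wnorm_mono hp (grandNontan_mono ρ N (hR.trans hmax) f)).trans hone
      · exact (wnorm_mono hp fun x => (grandVert_le_grandNontan ρ N 1 f x).trans
          (grandNontan_mono ρ N (hR.trans hmax) f x)).trans hone
    refine h1.trans ((mul_le_mul_right (hlarge f) _).trans (le_of_eq ?_))
    push_cast
    ring
  have hdown (f : Distr n) (i : Fin 6) : wnorm ω p (grandVert ρ N 1 f) ≤
      (C₁ + 1 : ℝ≥0) * wnorm ω p (maximalFamily ρ ψ N R f i) := by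
    have hone (a : ℝ≥0∞) : a ≤ (C₁ + 1 : ℝ≥0) * a :=
      le_mul_of_one_le_left zero_le (by exact_mod_cast le_add_self)
    have hv : wnorm ω p (grandVert ρ N 1 f) ≤ (C₁ + 1 : ℝ≥0) * wnorm ω p (vertMax ρ ψ f) :=
      (wnorm_mono hp fun x => (grandVert_le_grandNontan ρ N 1 f x).trans
        (grandNontan_mono ρ N hR f x)).trans
        ((hC₁ f).trans (mul_le_mul_left (by exact_mod_cast le_self_add) _))
    fin_cases i
    · exact (wnorm_mono hp (grandVert_mono ρ N hR f)).trans (hone _)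
    · exact hv
    · exact hv.trans (mul_le_mul_right (wnorm_mono hp (vertMax_le_nontanMax ρ ψ f)) _)
    · exact (wnorm_mono hp fun x => (grandVert_le_grandNontan ρ N 1 f x).trans
        (grandNontan_mono ρ N hR f x)).trans (hone _)
    · exact (wnorm_mono hp (grandVert_le_grandNontan ρ N 1 f)).trans (hone _)
    · exact hone _
  refine ⟨(C₄ + 1) * (C₂ * C₃) * (C₁ + 1), fun f i j => ?_⟩
  refine (hup f i).trans ((mul_le_mul_right (hdown f j) _).trans (le_of_eq ?_))
  push_cast
  ring

end LocalHardy

end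

theorem theorem3p2 {n : ℕ} (hn : 1 ≤ n)
    (ρ : LocalHardy.Eucl n → ℝ) (hρ : LocalHardy.IsCriticalRadius ρ)
    (ω : LocalHardy.Eucl n → ℝ) (hω : LocalHardy.MemAInfty ρ ω)
    (p : ℝ) (hp0 : 0 < p) (hp1 : p ≤ 1)
    (ψ₀ : LocalHardy.TestFun n) (hψ₀ : (∫ x, ψ₀ x) ≠ 0)
    (R : ℝ) (hR : 1 < R)
    (N : ℕ) (hN : LocalHardy.orderIndex ρ ω p ≤ (N : ℤ)) :
    (∀ f : LocalHardy.Distr n, List.TFAE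
      [f ∈ LocalHardy.hardySpace ρ ω p N R,
        LocalHardy.MemLpw ω p (LocalHardy.vertMax ρ ψ₀ f),
        LocalHardy.MemLpw ω p (LocalHardy.nontanMax ρ ψ₀ f),
        LocalHardy.MemLpw ω p (LocalHardy.grandNontan ρ N R f),
        LocalHardy.MemLpw ω p (LocalHardy.grandNontan ρ N 1 f),
        LocalHardy.MemLpw ω p (LocalHardy.grandVert ρ N 1 f)]) ∧
    ∃ C : ℝ≥0, 1 < C ∧ ∀ f ∈ LocalHardy.hardySpace ρ ω p N R,
      LocalHardy.Comparable C (LocalHardy.hardyNorm ρ ω p N R f)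
        (LocalHardy.wnorm ω p (LocalHardy.vertMax ρ ψ₀ f)) ∧
      LocalHardy.Comparable C (LocalHardy.wnorm ω p (LocalHardy.vertMax ρ ψ₀ f))
        (LocalHardy.wnorm ω p (LocalHardy.nontanMax ρ ψ₀ f)) ∧
      LocalHardy.Comparable C (LocalHardy.wnorm ω p (LocalHardy.nontanMax ρ ψ₀ f))
        (LocalHardy.wnorm ω p (LocalHardy.grandNontan ρ N R f)) ∧
      LocalHardy.Comparable C (LocalHardy.wnorm ω p (LocalHardy.grandNontan ρ N R f))
        (LocalHardy.wnorm ω p (LocalHardy.grandNontan ρ N 1 f)) ∧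
      LocalHardy.Comparable C (LocalHardy.wnorm ω p (LocalHardy.grandNontan ρ N 1 f))
        (LocalHardy.wnorm ω p (LocalHardy.grandVert ρ N 1 f)) := by
  obtain ⟨q, r, hr0, hr1, hq1, hqr, hq, hNr⟩ := LocalHardy.exists_exponents hω hp0 hp1 hN
  obtain ⟨C, hC⟩ := LocalHardy.exists_wnorm_maximal_le hρ hp0 hr0 hr1 hq1 hqr hq hψ₀ hNr hR.le
  have hmeas (f : LocalHardy.Distr n) (i : Fin 6) :
      Measurable (LocalHardy.maximalFamily ρ ψ₀ N R f i) := by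
    fin_cases i
    · exact LocalHardy.measurable_grandVert hρ.1 N R f
    · exact LocalHardy.measurable_vertMax hρ.1 ψ₀ f
    · exact LocalHardy.measurable_nontanMax hρ.1 ψ₀ f
    · exact LocalHardy.measurable_grandNontan hρ.1 N R f
    · exact LocalHardy.measurable_grandNontan hρ.1 N 1 f
    · exact LocalHardy.measurable_grandVert hρ.1 N 1 f
  have hiff (f : LocalHardy.Distr n) (i j : Fin 6) :
      LocalHardy.MemLpw ω p (LocalHardy.maximalFamily ρ ψ₀ N R f i) →
        LocalHardy.MemLpw ω p (LocalHardy.maximalFamily ρ ψ₀ N R f j) := fun h =>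
    ⟨(hmeas f j).aemeasurable, (hC f j i).trans_lt (ENNReal.mul_lt_top ENNReal.coe_lt_top h.2)⟩
  -- `C + 2` secures a constant larger than one.
  refine ⟨fun f => ?_, C + 2, ?_, fun f _ => ?_⟩
  · tfae_have 1 → 2 := hiff f 0 1
    tfae_have 2 → 3 := hiff f 1 2
    tfae_have 3 → 4 := hiff f 2 3
    tfae_have 4 → 5 := hiff f 3 4
    tfae_have 5 → 6 := hiff f 4 5
    tfae_have 6 → 1 := hiff f 5 0
    tfae_finish
  · exact lt_of_lt_of_le one_lt_two le_add_self
  · have hcomp (i j : Fin 6) : LocalHardy.Comparable (C + 2)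
        (LocalHardy.wnorm ω p (LocalHardy.maximalFamily ρ ψ₀ N R f i))
        (LocalHardy.wnorm ω p (LocalHardy.maximalFamily ρ ψ₀ N R f j)) := by
      have hle : (C : ℝ≥0∞) ≤ ((C + 2 : ℝ≥0) : ℝ≥0∞) := by exact_mod_cast le_self_add
      exact ⟨(hC f i j).trans (mul_le_mul_left hle _), (hC f j i).trans (mul_le_mul_left hle _)⟩
    exact ⟨hcomp 0 1, hcomp 1 2, hcomp 2 3, hcomp 3 4, hcomp 4 5⟩
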